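/- **Notation.** For $d\ge 1$, $\theta=(\theta_1,\dots,\theta_d)\in\mathbf T^d=(\mathbf R/\mathbf Z)^d$ and real $r,L$, the Bohr set is $\Lambda_{\theta,r,L}=\{n\in\mathbf Z: |n|\le L,\ \|n\theta_j\|<r \text{ for } j=1,\dots,d\}$, where $\|\cdot\|$ is the distance to the nearest integer. It is *regular* if for every $\kappa\in(0,1)$ and all real $r',L'$ with $|r-r'|<\frac{\kappa}{100d}r$ and $|L-L'|<\frac{\kappa}{100d}L$ one has $1-\kappa<|\Lambda_{\theta,r',L'}|/|\Lambda_{\theta,r,L}|<1+\kappa$. For $\eta\in(0,1]$, a regular Bohr set $\Lambda_{\theta,r',L'}$ is an *$\eta$ attendant* of $\Lambda_{\theta,r,L}$ if $\eta r/2\le r'\le\eta r$ and $\eta L/2\le L'\le\eta L$. For finite sets $Q,W$ with $W\ne\emptyset$ put $\delta_W(Q)=|Q\cap W|/|W|$. For finite $Q,W\subset\mathbf Z$ and real $c$ let $\|(Q\cap W-cW)^\wedge\|_\infty=\sup_{x\in\mathbf T}\bigl|\sum_{s\in W}(1_Q(s)-c)e^{-2\pi i s x}\bigr|$. Let $Q\subseteq\Lambda$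 and $\beta=|Q|/|\Lambda|$. We say that $Q$ is *$\alpha$-uniform in $\Lambda$ relative to $\Lambda'$* if 1. $\#\{m\in\Lambda: \|(Q\cap(\Lambda'+m)-\beta(\Lambda'+m))^\wedge\|_\infty\ge\alpha|\Lambda'|\}\le\alpha|\Lambda|$, 2. $\frac1{|\Lambda|}\sum_{m\in\Lambda}|\delta_{\Lambda'+m}(Q)-\beta|^2\le\alpha^2$, 3. $\|(Q\cap\Lambda-\beta\Lambda)^\wedge\|_\infty\le\alpha|\Lambda|$. **Theorem.** Let $\Lambda_1=\Lambda_{\theta,\varepsilon_0,N}$ and $\Lambda_2=\Lambda_{\theta,\varepsilon_2,N_2}$ be regular Bohr sets with $\theta\in\mathbf T^d$, $d\ge1$, $0<\varepsilon_0\le1$, $N>0$, $\varepsilon_0\le\varepsilon_2$ and $N\le N_2$. Let $E_1\subseteq\Lambda_1$, $E_2\subseteq\Lambda_2$, $|E_i|=\beta_i|\Lambda_i|$, and let $A\subseteq E_1\times E_2$ be a nonempty set with $|A|=\delta|E_1||E_2|$ that contains no triple $\{(k,m),(k+t,m),(k,m+t)\}$ with $t\ne0$. Put $$\alpha_0=2^{-2000}\delta^{96}\beta_1^{48}\beta_2^{48},\qquad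 \varepsilon=\frac{2^{-100}\alpha_0^2}{100d},\qquad \varepsilon'=2^{-10}\varepsilon^2 .$$ Suppose that $E_1$ and $E_2$ are $(\alpha_0,\varepsilon')$-uniform in $\Lambda_1$ and $\Lambda_2$, in the sense that for some $\varepsilon'$ attendant $\Lambda'$ of $\Lambda_1$ the set $E_i$ is $\alpha_0$-uniform in $\Lambda_i$ relative to $\Lambda'$ for $i=1,2$. Suppose also that $$\log N\ \ge\ 2^{10}\,d\,\log\frac1{\varepsilon_0\varepsilon}.$$ Then there are a regular Bohr set $\tilde\Lambda=\Lambda_{\theta,\tilde\varepsilon,\tilde N}$ with the same vector $\theta$ and with $\tilde\varepsilon\ge2^{-5}\varepsilon'\varepsilon_0$, $\tilde N\ge2^{-5}\varepsilon'N$, a vector $(y_1,y_2)\in\mathbf Z^2$, and sets $F_1\subseteq E_1\cap(\tilde\Lambda+y_1)$, $F_2\subseteq E_2\cap(\tilde\Lambda+y_2)$ such that $$|F_1|\ge2^{-125}\delta^{12}\beta_1|\tilde\Lambda|,\qquad |F_2|\ge2^{-125}\delta^{12}\beta_2|\tilde\Lambda|,\qquad \delta_{F_1\times F_2}(A)\ge\delta+2^{-500}\delta^{37}.$$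 -/

import Mathlib

/-- The Bohr set `Λ_{θ,ε,N} = {n ∈ ℤ : |n| ≤ N, ‖n θ_j‖ < ε for all j}`, where `‖·‖` is the distance
to the nearest integer, that is, the norm of the circle `ℝ / ℤ`. See `mem_bohrSet`. -/
noncomputable def bohrSet {d : ℕ} (θ : Fin d → UnitAddCircle) (ε N : ℝ) : Finset ℤ :=
  open Classical in (Finset.Icc ⌈-N⌉ ⌊N⌋).filter (fun n => ∀ j, ‖n • θ j‖ < ε)

theorem mem_bohrSet {d : ℕ} (θ : Fin d → UnitAddCircle) (ε N : ℝ) (n : ℤ) :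
    n ∈ bohrSet θ ε N ↔ |(n : ℝ)| ≤ N ∧ ∀ j, ‖n • θ j‖ < ε := by
  simp [bohrSet, Int.ceil_le, Int.le_floor, abs_le]

/-- Regular Bohr sets: for every `κ ∈ (0,1)`, changing the radius and the length by a factor
`1 + t` with `|t| < κ / (100 d)` changes the cardinality by a factor in `(1 - κ, 1 + κ)`. -/
def IsRegularBohr {d : ℕ} (θ : Fin d → UnitAddCircle) (ε N : ℝ) : Prop :=
  ∀ κ : ℝ, 0 < κ → κ < 1 → ∀ ε' N' : ℝ,
    |ε - ε'| < κ / (100 * d) * ε → |N - N'| < κ / (100 * d) * N →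
      1 - κ < ((bohrSet θ ε' N').card : ℝ) / (bohrSet θ ε N).card ∧
      ((bohrSet θ ε' N').card : ℝ) / (bohrSet θ ε N).card < 1 + κ

/-- `Λ_{θ,ε',N'}` is an `η` attendant of `Λ_{θ,ε₀,N₀}` (with the same vector `θ`). -/
def IsAttendant {d : ℕ} (η : ℝ) (θ : Fin d → UnitAddCircle) (ε₀ N₀ ε' N' : ℝ) : Prop :=
  (0 < η ∧ η ≤ 1) ∧ IsRegularBohr θ ε' N' ∧
    (η * ε₀ / 2 ≤ ε' ∧ ε' ≤ η * ε₀) ∧ (η * N₀ / 2 ≤ N' ∧ N' ≤ η * N₀)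

/-- The translate `W + m`. -/
def shiftBy (W : Finset ℤ) (m : ℤ) : Finset ℤ := W.image (fun n => n + m)

/-- The density `|Q ∩ W| / |W|` of `Q` in `W`. -/
noncomputable def densityIn {X : Type*} [DecidableEq X] (W Q : Finset X) : ℝ :=
  ((Q ∩ W).card : ℝ) / W.card

/-- `‖(Q ∩ W - c W)^‖_∞`: the supremum over the circle of the absolute value of the Fourier
transform `∑ s, f s * e(-s x)` of the function `f` equal to `1_Q - c` on `W` and to `0` off `W`. -/
noncomputable def balancedFourierSup (Q W : Finset ℤ) (c : ℝ) : ℝ :=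
  ⨆ x : UnitAddCircle, ‖∑ s ∈ W, (((if s ∈ Q then 1 else 0) - c : ℝ) : ℂ) * fourier (-s) x‖

/-- `Q ⊆ Λ`, of density `δ = |Q| / |Λ|`, is `α`-uniform in `Λ` relative to the translates of `Λ'`:
the set of `m ∈ Λ` for which the balanced function of `Q` on `Λ' + m` has a large Fourier
coefficient is small, the density of `Q` on `Λ' + m` is close to `δ` in mean square, and
the balanced function of `Q` on `Λ` has small Fourier coefficients. The set `Q` is
`(α, η)`-uniform when this holds with `Λ'` an `η` attendant. -/
structure IsUniformIn (α : ℝ) (Λ Λ' Q : Finset ℤ) : Prop where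
  subset : Q ⊆ Λ
  local_fourier :
    ((Λ.filter (fun m => α * Λ'.card ≤
        balancedFourierSup Q (shiftBy Λ' m) (densityIn Λ Q))).card : ℝ) ≤ α * Λ.card
  local_density :
    1 / (Λ.card : ℝ) * ∑ m ∈ Λ, |densityIn (shiftBy Λ' m) Q - densityIn Λ Q| ^ 2 ≤ α ^ 2
  global_fourier : balancedFourierSup Q Λ (densityIn Λ Q) ≤ α * Λ.card

/-- `A` contains no triple `(k, m), (k + t, m), (k, m + t)` with `t ≠ 0`. -/
def CornerFree (A : Finset (ℤ × ℤ)) : Prop :=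
  ∀ k m t : ℤ, t ≠ 0 → ¬ ((k, m) ∈ A ∧ (k + t, m) ∈ A ∧ (k, m + t) ∈ A)

/-! Write f = 1_A - δ on E₁ × E₂ and parametrize corners by (x, y, z), with vertices (x, y), (z - y,
y), (x, z - x) and side z - x - y. If A has no corners, only z = x + y contributes to the sum of 1_A
over all three vertices. So the sum of f · 1_A · 1_A equals |A| - δ ∑ n(z)², where n(z) counts A on
the antidiagonal z. By Cauchy-Schwarz this is very negative (`sum_cellCount_le`), once the ambient
sets are large enough for the degenerate corners to be negligible.

The sum is localized to cells (i + c + B) × (j + B), with B the attendant Bohr set. In a cell, two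
applications of Cauchy-Schwarz (`pow_four_sum_le_box`) eliminate the other two vertices and leave a
box norm of f, weighted by the number of z with z - y, z - y' ∈ E₁ and z - x, z - x' ∈ E₂. Local
Fourier uniformity and Parseval show that the translates of E₁ and E₂ seen on B have the expected
pairwise correlations on average (`isMixing_translates`). This property passes to products, and a
second moment computation shows that the weight is nearly constant (`IsMixing.prod`,
`IsMixing.sum_abs_sub_le`). Hence the unweighted box norm is large. A large box norm gives a product
set of increased density, obtained by sorting rows and columns according to adjacency to one popular
point (`exists_increment_of_boxSum`).

That last step fails if the mean of f on the cell is very negative. The cell is therefore chosen to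
maximize a score: minus the normalized corner count plus a large multiple of the mean. Since δ is
the exact density of A, the means add up to zero over all cells, so the extra term is free on
average. In a cell of large score, either the mean itself gives an increment or the box norm is
large with the mean not too negative (`mean_or_box_large`).

The set Λ₂ may be comparable with Λ₁ or much larger. A is therefore first cut into narrow vertical
strips above i + C₁. This confines z to a translate of C₂ and keeps the centers z - (i + c) close to
j. The sets C₀ ⊆ C₁ ⊆ C₂ ⊆ C₃ are dilates of B at a scale where the size is stable
(`exists_stable_dilate`), so boundary effects are negligible. -/

/-- The real-valued indicator function of a finite set. -/
noncomputable def ind {X : Type*} [DecidableEq X] (S : Finset X) (x : X) : ℝ :=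
  if x ∈ S then 1 else 0

/-! ### Indicator functions -/

section ind
variable {X : Type*} [DecidableEq X]

theorem ind_of_mem {S : Finset X} {x : X} (h : x ∈ S) : ind S x = 1 := if_pos h

theorem ind_of_notMem {S : Finset X} {x : X} (h : x ∉ S) : ind S x = 0 := if_neg h

theorem ind_nonneg (S : Finset X) (x : X) : 0 ≤ ind S x := by
  unfold ind; split_ifs <;> norm_num

theorem ind_le_one (S : Finset X) (x : X) : ind S x ≤ 1 := by
  unfold ind; split_ifs <;> norm_num

theorem ind_mul_self (S : Finset X) (x : X) : ind S x * ind S x = ind S x := by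
  unfold ind; split_ifs <;> norm_num

theorem abs_ind_sub_le_one (S : Finset X) (x : X) {β : ℝ} (h0 : 0 ≤ β) (h1 : β ≤ 1) :
    |ind S x - β| ≤ 1 := by
  unfold ind; split_ifs <;> rw [abs_le] <;> constructor <;> linarith

theorem sum_ind (S T : Finset X) : ∑ x ∈ T, ind S x = ((T.filter (· ∈ S)).card : ℝ) := by
  simp [ind, Finset.filter_mem_eq_inter]

theorem sum_ind_of_subset {S T : Finset X} (h : S ⊆ T) : ∑ x ∈ T, ind S x = (S.card : ℝ) := by
  rw [sum_ind, Finset.filter_mem_eq_inter, Finset.inter_eq_right.2 h]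

end ind

/-- Reindexing a sum against a translated indicator function. -/
theorem sum_ind_add_mul {R : Type*} [Semiring R] (E U : Finset ℤ) (s : ℤ) (w : ℝ →+* R) (φ : ℤ → R)
    (h : ∀ e ∈ E, e - s ∈ U) : ∑ t ∈ U, w (ind E (t + s)) * φ t = ∑ e ∈ E, φ (e - s) := by
  have : ∑ t ∈ U, w (ind E (t + s)) * φ t = ∑ t ∈ U.filter (fun t => t + s ∈ E), φ t := by
    rw [Finset.sum_filter]
    refine Finset.sum_congr rfl fun t _ => ?_
    unfold ind; split_ifs <;> simp
  rw [this]
  refine Finset.sum_nbij' (fun t => t + s) (fun e => e - s) ?_ ?_ ?_ ?_ ?_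
  · intro t ht; exact (Finset.mem_filter.1 ht).2
  · intro e he; simp [h e he, he]
  · intro t _; ring
  · intro e _; ring
  · intro t _; simp

/-! ### Fourier analysis on the circle -/

open MeasureTheory in
/-- Parseval's identity for trigonometric polynomials on the circle. -/
theorem integral_sq_norm_trigPoly (U : Finset ℤ) (c : ℤ → ℂ) :
    ∫ x : UnitAddCircle, ‖∑ n ∈ U, c n * fourier n x‖ ^ 2 ∂AddCircle.haarAddCircle
      = ∑ n ∈ U, ‖c n‖ ^ 2 := by
  have h0 : ∀ n : ℤ, ∫ x : UnitAddCircle, fourier n x ∂AddCircle.haarAddCircle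
      = if n = 0 then 1 else 0 := by
    intro n
    have := (orthonormal_iff_ite.1 (orthonormal_fourier (T := (1 : ℝ)))) 0 n
    rw [ContinuousMap.inner_toLp] at this
    simp only [fourier_zero, map_one, mul_one] at this
    rw [this]
    simp [eq_comm]
  have hc : ((∫ x : UnitAddCircle, ‖∑ n ∈ U, c n * fourier n x‖ ^ 2
      ∂AddCircle.haarAddCircle : ℝ) : ℂ) = ((∑ n ∈ U, ‖c n‖ ^ 2 : ℝ) : ℂ) := by
    rw [← integral_complex_ofReal]
    have : ∀ x : UnitAddCircle, ((‖∑ n ∈ U, c n * fourier n x‖ ^ 2 : ℝ) : ℂ)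
        = ∑ n ∈ U, ∑ m ∈ U, (c n * starRingEnd ℂ (c m)) * fourier (n - m) x := by
      intro x
      push_cast
      rw [← Complex.mul_conj', map_sum, Finset.sum_mul_sum]
      refine Finset.sum_congr rfl fun n _ => Finset.sum_congr rfl fun m _ => ?_
      rw [map_mul, sub_eq_add_neg, fourier_add, fourier_neg]
      ring
    simp_rw [this]
    have hint : ∀ (a : ℂ) (n : ℤ), Integrable (fun x : UnitAddCircle => a * fourier n x)
        AddCircle.haarAddCircle := fun a n =>
      (Continuous.integrable_of_hasCompactSupport (by fun_prop)
        (HasCompactSupport.of_compactSpace _))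
    rw [integral_finsetSum _ fun n _ => integrable_finsetSum _ fun m _ => hint _ _]
    push_cast
    refine Finset.sum_congr rfl fun n hn => ?_
    rw [integral_finsetSum _ fun m _ => hint _ _]
    simp_rw [integral_const_mul, h0, sub_eq_zero]
    simp [hn, Complex.mul_conj']
  exact_mod_cast hc

open MeasureTheory in
/-- The correlation of a function with small Fourier transform with any finite set is small
in mean square. -/
theorem sum_sq_correlation_le (S T E : Finset ℤ) (g : ℤ → ℝ) (K : ℝ)
    (hK : ∀ x : UnitAddCircle, ‖∑ s ∈ S, (g s : ℂ) * fourier (-s) x‖ ≤ K) :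
    ∑ t ∈ T, (∑ s ∈ S, g s * ind E (t + s)) ^ 2 ≤ K ^ 2 * E.card := by
  classical
  -- All differences e - s are adjoined so that the correlation vanishes off U. Its trigonometric
  -- polynomial is then exactly a product of two transforms.
  set U : Finset ℤ := T ∪ (S ×ˢ E).image (fun p => p.2 - p.1) with hU
  set c : ℤ → ℝ := fun t => ∑ s ∈ S, g s * ind E (t + s) with hc
  have hmem : ∀ s ∈ S, ∀ e ∈ E, e - s ∈ U := fun s hs e he =>
    Finset.mem_union_right _ (Finset.mem_image.2 ⟨(s, e), by simp [hs, he], rfl⟩)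
  have hfac : ∀ x : UnitAddCircle, ∑ t ∈ U, (c t : ℂ) * fourier t x
      = (∑ s ∈ S, (g s : ℂ) * fourier (-s) x) * ∑ e ∈ E, fourier e x := by
    intro x
    simp_rw [hc]
    push_cast
    simp_rw [Finset.sum_mul]
    rw [Finset.sum_comm]
    refine Finset.sum_congr rfl fun s hs => ?_
    rw [Finset.mul_sum]
    have := sum_ind_add_mul E U s Complex.ofRealHom (fun t => (g s : ℂ) * fourier t x) (hmem s hs)
    simp only [Complex.ofRealHom_eq_coe] at this
    rw [Finset.sum_congr rfl (fun t _ => show (g s : ℂ) * (ind E (t + s) : ℂ) * fourier t x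
      = (ind E (t + s) : ℂ) * ((g s : ℂ) * fourier t x) by ring), this]
    refine Finset.sum_congr rfl fun e _ => ?_
    rw [sub_eq_add_neg, fourier_add]
    ring
  have h1 := integral_sq_norm_trigPoly U (fun t => (c t : ℂ))
  have h2 := integral_sq_norm_trigPoly E (fun _ => 1)
  simp only [one_mul, norm_one, one_pow, Finset.sum_const, nsmul_eq_mul, mul_one] at h2
  have hcont : ∀ φ : UnitAddCircle → ℂ, Continuous φ →
      Integrable (fun x => ‖φ x‖ ^ 2) AddCircle.haarAddCircle := fun φ hφ =>
    (Continuous.integrable_of_hasCompactSupport (by fun_prop)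
        (HasCompactSupport.of_compactSpace _))
  calc ∑ t ∈ T, (c t) ^ 2 ≤ ∑ t ∈ U, (c t) ^ 2 :=
        Finset.sum_le_sum_of_subset_of_nonneg Finset.subset_union_left
          fun _ _ _ => sq_nonneg _
    _ = ∑ t ∈ U, ‖(c t : ℂ)‖ ^ 2 := by simp
    _ = _ := h1.symm
    _ ≤ ∫ x : UnitAddCircle, K ^ 2 * ‖∑ e ∈ E, (fourier e x : ℂ)‖ ^ 2
          ∂AddCircle.haarAddCircle := by
        refine integral_mono (hcont _ (by fun_prop)) ((hcont _ (by fun_prop)).const_mul _) ?_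
        intro x
        simp only [hfac x, norm_mul, mul_pow]
        gcongr
        exact hK x
    _ = K ^ 2 * E.card := by rw [integral_const_mul, h2]

/-! ### Mixing families -/

/-- The family `(p z)` of functions from `S` to `[0,1]` is, up to `η` on average, made of functions
of mean `c` with pairwise correlations `c ^ 2`. -/
structure IsMixing {ι σ : Type*} (Z : Finset ι) (S : Finset σ) (p : ι → σ → ℝ) (c η : ℝ) :
    Prop where
  nonneg : ∀ z s, 0 ≤ p z s
  le_one : ∀ z s, p z s ≤ 1
  mean_nonneg : 0 ≤ c
  mean_le_one : c ≤ 1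
  pair : ∑ z ∈ Z, ∑ z' ∈ Z, |∑ s ∈ S, p z s * p z' s - c ^ 2 * S.card|
    ≤ η * S.card * (Z.card : ℝ) ^ 2
  single : ∑ z ∈ Z, |∑ s ∈ S, p z s - c * S.card| ≤ η * S.card * Z.card

theorem abs_mul_sub_mul_le {a b u v P Q : ℝ} (hb : 0 ≤ b) (hb' : b ≤ Q) (hu : 0 ≤ u)
    (hu' : u ≤ P) : |a * b - u * v| ≤ Q * |a - u| + P * |b - v| := by
  have : a * b - u * v = b * (a - u) + u * (b - v) := by ring
  rw [this]
  refine (abs_add_le _ _).trans ?_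
  rw [abs_mul, abs_mul, abs_of_nonneg hb, abs_of_nonneg hu]
  gcongr

/-- Sums over S × T factor, and ab - uv telescopes with every factor bounded by a cardinality, so
the errors simply add. -/
theorem IsMixing.prod {ι σ τ : Type*} {Z : Finset ι} {S : Finset σ} {T : Finset τ}
    {p : ι → σ → ℝ} {q : ι → τ → ℝ} {c c' η η' : ℝ}
    (hp : IsMixing Z S p c η) (hq : IsMixing Z T q c' η') :
    IsMixing Z (S ×ˢ T) (fun z x => p z x.1 * q z x.2) (c * c') (η + η') := by
  have cardle : ∀ {κ : Type _} (U : Finset κ) (f : κ → ℝ), (∀ s, f s ≤ 1) →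
      ∑ s ∈ U, f s ≤ U.card := fun U f hf => by
    simpa using Finset.sum_le_sum (s := U) (fun s _ => hf s)
  have hc0 := hp.mean_nonneg
  have hc1 := hp.mean_le_one
  refine ⟨fun z s => mul_nonneg (hp.nonneg _ _) (hq.nonneg _ _),
    fun z s => mul_le_one₀ (hp.le_one _ _) (hq.nonneg _ _) (hq.le_one _ _),
    mul_nonneg hp.mean_nonneg hq.mean_nonneg,
    mul_le_one₀ hp.mean_le_one hq.mean_nonneg hq.mean_le_one, ?_, ?_⟩
  · have key : ∀ z z', |∑ x ∈ S ×ˢ T, p z x.1 * q z x.2 * (p z' x.1 * q z' x.2)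
        - (c * c') ^ 2 * (S ×ˢ T).card| ≤ T.card * |∑ s ∈ S, p z s * p z' s - c ^ 2 * S.card|
          + S.card * |∑ s ∈ T, q z s * q z' s - c' ^ 2 * T.card| := by
      intro z z'
      have e1 : ∑ x ∈ S ×ˢ T, p z x.1 * q z x.2 * (p z' x.1 * q z' x.2)
          = (∑ s ∈ S, p z s * p z' s) * ∑ s ∈ T, q z s * q z' s := by
        rw [Finset.sum_product, Finset.sum_mul_sum]
        exact Finset.sum_congr rfl fun _ _ => Finset.sum_congr rfl fun _ _ => by ring
      have e2 : (c * c') ^ 2 * ((S ×ˢ T).card : ℝ)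
          = (c ^ 2 * S.card) * (c' ^ 2 * T.card) := by
        rw [Finset.card_product]; push_cast; ring
      rw [e1, e2]
      refine abs_mul_sub_mul_le
        (Finset.sum_nonneg fun s _ => mul_nonneg (hq.nonneg _ _) (hq.nonneg _ _))
        (cardle _ _ fun s => mul_le_one₀ (hq.le_one _ _) (hq.nonneg _ _) (hq.le_one _ _))
        (by positivity) ?_
      exact mul_le_of_le_one_left (by positivity) (pow_le_one₀ hc0 hc1)
    calc _ ≤ ∑ z ∈ Z, ∑ z' ∈ Z, (T.card * |∑ s ∈ S, p z s * p z' s - c ^ 2 * S.card|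
          + S.card * |∑ s ∈ T, q z s * q z' s - c' ^ 2 * T.card|) :=
          Finset.sum_le_sum fun z _ => Finset.sum_le_sum fun z' _ => key z z'
      _ = T.card * ∑ z ∈ Z, ∑ z' ∈ Z, |∑ s ∈ S, p z s * p z' s - c ^ 2 * S.card|
          + S.card * ∑ z ∈ Z, ∑ z' ∈ Z, |∑ s ∈ T, q z s * q z' s - c' ^ 2 * T.card| := by
          simp_rw [Finset.sum_add_distrib, Finset.mul_sum]
      _ ≤ T.card * (η * S.card * (Z.card : ℝ) ^ 2) + S.card * (η' * T.card * (Z.card : ℝ) ^ 2) := by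
          gcongr
          · exact hp.pair
          · exact hq.pair
      _ = _ := by rw [Finset.card_product]; push_cast; ring
  · have key : ∀ z, |∑ x ∈ S ×ˢ T, p z x.1 * q z x.2
        - (c * c') * (S ×ˢ T).card| ≤ T.card * |∑ s ∈ S, p z s - c * S.card|
          + S.card * |∑ s ∈ T, q z s - c' * T.card| := by
      intro z
      have e1 : ∑ x ∈ S ×ˢ T, p z x.1 * q z x.2 = (∑ s ∈ S, p z s) * ∑ s ∈ T, q z s := by
        rw [Finset.sum_product, Finset.sum_mul_sum]
      have e2 : (c * c') * ((S ×ˢ T).card : ℝ) = (c * S.card) * (c' * T.card) := by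
        rw [Finset.card_product]; push_cast; ring
      rw [e1, e2]
      refine abs_mul_sub_mul_le (Finset.sum_nonneg fun s _ => hq.nonneg _ _)
        (cardle _ _ fun s => hq.le_one _ _) (by positivity) ?_
      exact mul_le_of_le_one_left (by positivity) hc1
    calc _ ≤ ∑ z ∈ Z, (T.card * |∑ s ∈ S, p z s - c * S.card|
          + S.card * |∑ s ∈ T, q z s - c' * T.card|) :=
          Finset.sum_le_sum fun z _ => key z
      _ = T.card * ∑ z ∈ Z, |∑ s ∈ S, p z s - c * S.card|
          + S.card * ∑ z ∈ Z, |∑ s ∈ T, q z s - c' * T.card| := by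
          simp_rw [Finset.sum_add_distrib, Finset.mul_sum]
      _ ≤ T.card * (η * S.card * Z.card) + S.card * (η' * T.card * Z.card) := by
          gcongr
          · exact hp.single
          · exact hq.single
      _ = _ := by rw [Finset.card_product]; push_cast; ring

/-- The sum of a mixing family is close to constant on average. -/
theorem IsMixing.sum_abs_sub_le {ι σ : Type*} {Z : Finset ι} {S : Finset σ}
    {p : ι → σ → ℝ} {c η : ℝ} (h : IsMixing Z S p c η) (hη : 0 ≤ η) :
    ∑ s ∈ S, |∑ z ∈ Z, p z s - c * Z.card| ≤ √(3 * η) * S.card * Z.card := by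
  have hc0 := h.mean_nonneg
  have hc1 := h.mean_le_one
  have hvar : ∑ s ∈ S, (∑ z ∈ Z, p z s - c * Z.card) ^ 2
      ≤ 3 * η * S.card * (Z.card : ℝ) ^ 2 := by
    have e1 : ∑ s ∈ S, (∑ z ∈ Z, p z s) ^ 2 = ∑ z ∈ Z, ∑ z' ∈ Z, ∑ s ∈ S, p z s * p z' s := by
      simp_rw [sq, Finset.sum_mul_sum]
      rw [Finset.sum_comm]
      exact Finset.sum_congr rfl fun _ _ => Finset.sum_comm
    have e2 : ∑ s ∈ S, ∑ z ∈ Z, p z s = ∑ z ∈ Z, ∑ s ∈ S, p z s := Finset.sum_comm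
    -- Second moment. The pair condition contributes η and the cross term at most 2η, hence the 3η
    -- under the root.
    have e3 : ∑ s ∈ S, (∑ z ∈ Z, p z s - c * Z.card) ^ 2
        = ∑ z ∈ Z, ∑ z' ∈ Z, (∑ s ∈ S, p z s * p z' s - c ^ 2 * S.card)
          - 2 * c * Z.card * ∑ z ∈ Z, (∑ s ∈ S, p z s - c * S.card) := by
      simp_rw [sub_sq, Finset.sum_add_distrib, Finset.sum_sub_distrib, e1, mul_assoc,
        ← Finset.mul_sum, ← Finset.sum_mul, e2]
      simp only [Finset.sum_const, nsmul_eq_mul]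
      ring
    have h1 := (Finset.sum_le_sum fun z (_ : z ∈ Z) => Finset.sum_le_sum fun z' (_ : z' ∈ Z) =>
      le_abs_self (∑ s ∈ S, p z s * p z' s - c ^ 2 * S.card)).trans h.pair
    have h2 : |∑ z ∈ Z, (∑ s ∈ S, p z s - c * S.card)| ≤ η * S.card * Z.card :=
      (Finset.abs_sum_le_sum_abs _ _).trans h.single
    have h3 : -(2 * c * Z.card * ∑ z ∈ Z, (∑ s ∈ S, p z s - c * S.card))
        ≤ 2 * 1 * Z.card * (η * S.card * Z.card) := by
      rw [← mul_neg]
      have := (neg_le_abs _).trans h2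
      calc _ ≤ 2 * c * Z.card * (η * S.card * Z.card) := by gcongr
        _ ≤ _ := by gcongr
    rw [e3]
    linarith
  have hcs := sq_sum_le_card_mul_sum_sq (s := S) (f := fun s => |∑ z ∈ Z, p z s - c * Z.card|)
  simp only [sq_abs] at hcs
  refine abs_le_of_sq_le_sq' ?_ (by positivity) |>.2
  rw [mul_pow, mul_pow, Real.sq_sqrt (by positivity)]
  calc _ ≤ _ := hcs
    _ ≤ S.card * (3 * η * S.card * (Z.card : ℝ) ^ 2) := by gcongr
    _ = _ := by ring

/-! ### Translates of a Fourier-uniform set are mixing -/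

theorem sum_shiftBy {M : Type*} [AddCommMonoid M] (B : Finset ℤ) (m : ℤ) (f : ℤ → M) :
    ∑ s ∈ shiftBy B m, f s = ∑ b ∈ B, f (b + m) :=
  Finset.sum_image fun _ _ _ _ h => add_right_cancel h

theorem card_shiftBy (B : Finset ℤ) (m : ℤ) : (shiftBy B m).card = B.card :=
  Finset.card_image_of_injective _ (add_left_injective m)

theorem mem_shiftBy {B : Finset ℤ} {m n : ℤ} : n ∈ shiftBy B m ↔ n - m ∈ B := by
  unfold shiftBy
  rw [Finset.mem_image]
  exact ⟨fun ⟨a, ha, h⟩ => by rwa [← h, add_sub_cancel_right], fun h => ⟨_, h, by ring⟩⟩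

theorem sum_neg_of_symm {M : Type*} [AddCommMonoid M] {B : Finset ℤ} (hB : ∀ b ∈ B, -b ∈ B)
    (f : ℤ → M) : ∑ b ∈ B, f (-b) = ∑ b ∈ B, f b :=
  Finset.sum_nbij' (fun b => -b) (fun b => -b) hB hB (by simp) (by simp) (by simp)

theorem sum_le_of_good_bad {ι : Type*} [DecidableEq ι] {Z Zg : Finset ι} {f : ι → ℝ}
    {a b γ : ℝ} (ha : 0 ≤ a) (hb : 0 ≤ b) (hZg : Zg ⊆ Z)
    (hbad : ((Z \ Zg).card : ℝ) ≤ γ * Z.card)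
    (hg : ∀ z ∈ Zg, f z ≤ a) (h : ∀ z ∈ Z, f z ≤ b) : ∑ z ∈ Z, f z ≤ (a + γ * b) * Z.card := by
  rw [← Finset.sum_sdiff hZg]
  have h1 : ∑ z ∈ Z \ Zg, f z ≤ (Z \ Zg).card * b := by
    simpa using Finset.sum_le_card_nsmul _ _ b fun z hz => h z (Finset.mem_sdiff.1 hz).1
  have h2 : ∑ z ∈ Zg, f z ≤ Zg.card * a := by
    simpa using Finset.sum_le_card_nsmul _ _ a hg
  have h3 : (Zg.card : ℝ) ≤ Z.card := by exact_mod_cast Finset.card_le_card hZg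
  nlinarith

/-- The translates of a set which is locally Fourier uniform form a mixing family. -/
theorem isMixing_translates (B E Z Zg : Finset ℤ) (p : ℤ) (β α γ : ℝ) (hβ0 : 0 ≤ β) (hβ1 : β ≤ 1)
    (hα : 0 ≤ α) (hγ : 0 ≤ γ) (hB : ∀ b ∈ B, -b ∈ B) (hZg : Zg ⊆ Z)
    (hbad : ((Z \ Zg).card : ℝ) ≤ γ * Z.card) (hE : (E.card : ℝ) ≤ 2 * Z.card)
    (hF : ∀ z ∈ Zg, ∀ x : UnitAddCircle, ‖∑ s ∈ shiftBy B (z - p),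
      ((ind E s - β : ℝ) : ℂ) * fourier (-s) x‖ ≤ α * B.card) :
    IsMixing Z B (fun z b => ind E (z - p - b)) β (2 * γ + 4 * α) := by
  have card01 : ∀ f : ℤ → ℝ, (∀ b, 0 ≤ f b) → (∀ b, f b ≤ 1) → ∀ t : ℝ, 0 ≤ t → t ≤ 1 →
      |∑ b ∈ B, f b - t * B.card| ≤ B.card := by
    intro f h0 h1 t ht0 ht1
    have : ∑ b ∈ B, f b - t * B.card = ∑ b ∈ B, (f b - t) := by simp [mul_comm]
    rw [this]
    refine (Finset.abs_sum_le_sum_abs _ _).trans ?_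
    have : ∀ b ∈ B, |f b - t| ≤ 1 := fun b _ => by
      rw [abs_le]; constructor <;> linarith [h0 b, h1 b]
    simpa using Finset.sum_le_sum this
  have hsingle0 : ∀ z ∈ Z, |∑ b ∈ B, ind E (z - p - b) - β * B.card| ≤ B.card := fun z _ =>
    card01 _ (fun _ => ind_nonneg _ _) (fun _ => ind_le_one _ _) _ hβ0 hβ1
  have hsingleg : ∀ z ∈ Zg, |∑ b ∈ B, ind E (z - p - b) - β * B.card| ≤ α * B.card := by
    intro z hz
    -- The zero frequency measures the density on the translate. The symmetry of B then turns b into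
    -- -b.
    have h := hF z hz 0
    simp only [fourier_eval_zero, mul_one] at h
    rw [← Complex.ofReal_sum, Complex.norm_real, Real.norm_eq_abs, sum_shiftBy] at h
    rw [← sum_neg_of_symm hB (fun b => ind E (z - p - b))]
    convert h using 2
    simp [mul_comm, add_comm]
  have hsingle : ∑ z ∈ Z, |∑ b ∈ B, ind E (z - p - b) - β * B.card|
      ≤ (γ + α) * B.card * Z.card := by
    have := sum_le_of_good_bad (by positivity) (by positivity) hZg hbad hsingleg hsingle0
    linarith
  refine ⟨fun _ _ => ind_nonneg _ _, fun _ _ => ind_le_one _ _, hβ0, hβ1, ?_, ?_⟩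
  · have hpair0 : ∀ z ∈ Z, ∑ z' ∈ Z, |∑ b ∈ B, ind E (z - p - b) * ind E (z' - p - b)
        - β ^ 2 * B.card| ≤ B.card * Z.card := by
      intro z _
      have : ∀ z' ∈ Z, |∑ b ∈ B, ind E (z - p - b) * ind E (z' - p - b)
        - β ^ 2 * B.card| ≤ B.card := fun z' _ =>
        card01 _ (fun _ => mul_nonneg (ind_nonneg _ _) (ind_nonneg _ _))
          (fun _ => mul_le_one₀ (ind_le_one _ _) (ind_nonneg _ _) (ind_le_one _ _)) _
          (by positivity) (pow_le_one₀ hβ0 hβ1)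
      simpa [mul_comm] using Finset.sum_le_sum this
    have hpairg : ∀ z ∈ Zg, ∑ z' ∈ Z, |∑ b ∈ B, ind E (z - p - b) * ind E (z' - p - b)
        - β ^ 2 * B.card| ≤ (γ + 3 * α) * B.card * Z.card := by
      intro z hz
      -- For a good z, the mean β is subtracted from the factor of z only. Parseval bounds the
      -- correlations with all z' in mean square by (α|B|)²|E|, and |E| ≤ 2|Z| makes this small on
      -- average over z'. The part with mean β reduces to the single sums for z'.
      set g : ℤ → ℝ := fun s => ind E s - β with hg
      have hcorr := sum_sq_correlation_le (shiftBy B (z - p)) (shiftBy Z (-z)) E g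
        (α * B.card) (hF z hz)
      simp only [sum_shiftBy] at hcorr
      set c : ℤ → ℝ := fun z' => ∑ b ∈ B, g (b + (z - p)) * ind E (z' + -z + (b + (z - p))) with hc
      have hcs := sq_sum_le_card_mul_sum_sq (s := Z) (f := fun z' => |c z'|)
      simp only [sq_abs] at hcs
      have hc1 : ∑ z' ∈ Z, |c z'| ≤ 2 * α * B.card * Z.card := by
        refine abs_le_of_sq_le_sq' ?_ (by positivity) |>.2
        calc _ ≤ _ := hcs
          _ ≤ Z.card * ((α * B.card) ^ 2 * (2 * Z.card)) := by
            gcongr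
            exact hcorr.trans (by gcongr)
          _ ≤ _ := by
            have : 0 ≤ (α * B.card * Z.card) ^ 2 := sq_nonneg _
            nlinarith
      have hsplit : ∀ z' ∈ Z, |∑ b ∈ B, ind E (z - p - b) * ind E (z' - p - b)
          - β ^ 2 * B.card| ≤ |c z'| + |∑ b ∈ B, ind E (z' - p - b) - β * B.card| := by
        intro z' _
        have e : ∑ b ∈ B, ind E (z - p - b) * ind E (z' - p - b) - β ^ 2 * B.card
            = c z' + β * (∑ b ∈ B, ind E (z' - p - b) - β * B.card) := by
          have : c z' = ∑ b ∈ B, (ind E (z - p - b) - β) * ind E (z' - p - b) := by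
            rw [← sum_neg_of_symm hB, hc]
            refine Finset.sum_congr rfl fun b _ => ?_
            have e1 : b + (z - p) = z - p - -b := by ring
            have e2 : z' + -z + (z - p - -b) = z' - p - -b := by ring
            rw [e1, e2]
          rw [this]
          simp_rw [sub_mul, Finset.sum_sub_distrib, ← Finset.mul_sum]
          ring
        rw [e]
        refine (abs_add_le _ _).trans ?_
        refine add_le_add le_rfl ?_
        rw [abs_mul, abs_of_nonneg hβ0]
        exact mul_le_of_le_one_left (abs_nonneg _) hβ1
      calc _ ≤ ∑ z' ∈ Z, (|c z'| + |∑ b ∈ B, ind E (z' - p - b) - β * B.card|) :=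
            Finset.sum_le_sum hsplit
        _ ≤ 2 * α * B.card * Z.card + (γ + α) * B.card * Z.card := by
            rw [Finset.sum_add_distrib]; gcongr
        _ = _ := by ring
    have := sum_le_of_good_bad (by positivity) (by positivity) hZg hbad hpairg hpair0
    have h0 : 0 ≤ α * B.card * (Z.card : ℝ) ^ 2 := by positivity
    nlinarith
  · have h0 : 0 ≤ (γ + 3 * α) * B.card * (Z.card : ℝ) := by positivity
    nlinarith

/-! ### Box norms -/

/-- A weighted form of the Cauchy-Schwarz inequality. -/
theorem sq_sum_mul_le_of_abs_le {ι : Type*} (s : Finset ι) (h q G : ι → ℝ)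
    (hq : ∀ i ∈ s, |h i| ≤ q i) :
    (∑ i ∈ s, h i * G i) ^ 2 ≤ (∑ i ∈ s, q i) * ∑ i ∈ s, q i * G i ^ 2 := by
  have hq0 : ∀ i ∈ s, 0 ≤ q i := fun i hi => (abs_nonneg _).trans (hq i hi)
  have h1 : |∑ i ∈ s, h i * G i| ≤ ∑ i ∈ s, q i * |G i| := by
    refine (Finset.abs_sum_le_sum_abs _ _).trans (Finset.sum_le_sum fun i hi => ?_)
    rw [abs_mul]
    exact mul_le_mul_of_nonneg_right (hq i hi) (abs_nonneg _)
  rw [← sq_abs]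
  refine (pow_le_pow_left₀ (abs_nonneg _) h1 2).trans ?_
  refine Finset.sum_sq_le_sum_mul_sum_of_sq_le_mul s hq0
    (fun i hi => mul_nonneg (hq0 i hi) (sq_nonneg _)) fun i _ => le_of_eq ?_
  rw [mul_pow, sq_abs]; ring

/-- The fourth power of a sum over pairs is bounded by a weighted box norm, by two applications
of the Cauchy-Schwarz inequality. -/
theorem pow_four_sum_le_box {ι X Y : Type*} (Z : Finset ι) (S : Finset X) (R : Finset Y)
    (F : X → Y → ℝ) (g p : ι → Y → ℝ) (h q : ι → X → ℝ)
    (hg : ∀ z ∈ Z, ∀ y ∈ R, |g z y| ≤ p z y) (hh : ∀ z ∈ Z, ∀ x ∈ S, |h z x| ≤ q z x) :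
    (∑ z ∈ Z, ∑ x ∈ S, ∑ y ∈ R, F x y * g z y * h z x) ^ 4 ≤
      (∑ z ∈ Z, ∑ x ∈ S, q z x) ^ 2 * (∑ z ∈ Z, ∑ w ∈ R ×ˢ R, p z w.1 * p z w.2) *
      ∑ u ∈ S ×ˢ S, ∑ w ∈ R ×ˢ R, F u.1 w.1 * F u.1 w.2 * F u.2 w.1 * F u.2 w.2 *
        ∑ z ∈ Z, (q z u.1 * q z u.2) * (p z w.1 * p z w.2) := by
  set V : ℝ := ∑ z ∈ Z, ∑ w ∈ R ×ˢ R,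
    (g z w.1 * g z w.2) * ∑ x ∈ S, q z x * (F x w.1 * F x w.2) with hV
  have e1 : ∑ z ∈ Z, ∑ x ∈ S, ∑ y ∈ R, F x y * g z y * h z x
      = ∑ i ∈ Z ×ˢ S, h i.1 i.2 * ∑ y ∈ R, F i.2 y * g i.1 y := by
    rw [Finset.sum_product]
    refine Finset.sum_congr rfl fun z _ => Finset.sum_congr rfl fun x _ => ?_
    rw [Finset.mul_sum]
    exact Finset.sum_congr rfl fun y _ => by ring
  -- First Cauchy-Schwarz, over (z, x) with weight q. It removes h and doubles y.
  have h1 : (∑ z ∈ Z, ∑ x ∈ S, ∑ y ∈ R, F x y * g z y * h z x) ^ 2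
      ≤ (∑ z ∈ Z, ∑ x ∈ S, q z x) * V := by
    rw [e1]
    refine (sq_sum_mul_le_of_abs_le (Z ×ˢ S) (fun i => h i.1 i.2) (fun i => q i.1 i.2) _
      fun i hi => hh _ (Finset.mem_product.1 hi).1 _ (Finset.mem_product.1 hi).2).trans_eq ?_
    rw [Finset.sum_product, Finset.sum_product, hV]
    congr 1
    refine Finset.sum_congr rfl fun z _ => ?_
    simp_rw [Finset.mul_sum]
    rw [Finset.sum_comm]
    refine Finset.sum_congr rfl fun x _ => ?_
    rw [sq, Finset.sum_mul_sum, Finset.sum_product, Finset.mul_sum]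
    refine Finset.sum_congr rfl fun y _ => ?_
    rw [Finset.mul_sum]
    exact Finset.sum_congr rfl fun y' _ => by ring
  -- Second Cauchy-Schwarz, over (z, y, y') with weight p p. It removes g and doubles x.
  have h2 : V ^ 2 ≤ (∑ z ∈ Z, ∑ w ∈ R ×ˢ R, p z w.1 * p z w.2) *
      ∑ z ∈ Z, ∑ w ∈ R ×ˢ R, (p z w.1 * p z w.2) *
        (∑ x ∈ S, q z x * (F x w.1 * F x w.2)) ^ 2 := by
    rw [hV, ← Finset.sum_product', ← Finset.sum_product', ← Finset.sum_product']
    refine sq_sum_mul_le_of_abs_le (Z ×ˢ (R ×ˢ R)) (fun i => g i.1 i.2.1 * g i.1 i.2.2)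
      (fun i => p i.1 i.2.1 * p i.1 i.2.2) _ fun i hi => ?_
    simp only [Finset.mem_product] at hi
    rw [abs_mul]
    exact mul_le_mul (hg _ hi.1 _ hi.2.1) (hg _ hi.1 _ hi.2.2) (abs_nonneg _)
      ((abs_nonneg _).trans (hg _ hi.1 _ hi.2.1))
  have e2 : ∑ z ∈ Z, ∑ w ∈ R ×ˢ R, (p z w.1 * p z w.2) *
        (∑ x ∈ S, q z x * (F x w.1 * F x w.2)) ^ 2
      = ∑ u ∈ S ×ˢ S, ∑ w ∈ R ×ˢ R, F u.1 w.1 * F u.1 w.2 * F u.2 w.1 * F u.2 w.2 *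
        ∑ z ∈ Z, (q z u.1 * q z u.2) * (p z w.1 * p z w.2) := by
    have e3 : ∀ (z : ι) (w : Y × Y), (p z w.1 * p z w.2) * (∑ x ∈ S, q z x * (F x w.1 * F x w.2)) ^ 2
        = ∑ u ∈ S ×ˢ S, F u.1 w.1 * F u.1 w.2 * F u.2 w.1 * F u.2 w.2 *
          ((q z u.1 * q z u.2) * (p z w.1 * p z w.2)) := by
      intro z w
      rw [sq, Finset.sum_mul_sum, Finset.sum_product, Finset.mul_sum]
      refine Finset.sum_congr rfl fun x _ => ?_
      rw [Finset.mul_sum]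
      exact Finset.sum_congr rfl fun y _ => by ring
    simp_rw [e3, Finset.mul_sum]
    calc _ = ∑ z ∈ Z, ∑ u ∈ S ×ˢ S, ∑ w ∈ R ×ˢ R, F u.1 w.1 * F u.1 w.2 * F u.2 w.1 * F u.2 w.2 *
          ((q z u.1 * q z u.2) * (p z w.1 * p z w.2)) :=
          Finset.sum_congr rfl fun z _ => Finset.sum_comm
      _ = ∑ u ∈ S ×ˢ S, ∑ z ∈ Z, ∑ w ∈ R ×ˢ R, F u.1 w.1 * F u.1 w.2 * F u.2 w.1 * F u.2 w.2 *
          ((q z u.1 * q z u.2) * (p z w.1 * p z w.2)) := Finset.sum_comm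
      _ = _ := Finset.sum_congr rfl fun u _ => Finset.sum_comm
  rw [e2] at h2
  calc _ = ((∑ z ∈ Z, ∑ x ∈ S, ∑ y ∈ R, F x y * g z y * h z x) ^ 2) ^ 2 := by ring
    _ ≤ ((∑ z ∈ Z, ∑ x ∈ S, q z x) * V) ^ 2 := by gcongr
    _ = (∑ z ∈ Z, ∑ x ∈ S, q z x) ^ 2 * V ^ 2 := by ring
    _ ≤ _ := by
      rw [mul_assoc]
      gcongr

/-- The fourth power of the (unnormalized) box norm of `F` on `S × R`. -/
noncomputable def boxSum {X Y : Type*} (F : X → Y → ℝ) (S : Finset X) (R : Finset Y) : ℝ :=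
  ∑ u ∈ S ×ˢ S, ∑ w ∈ R ×ˢ R, F u.1 w.1 * F u.1 w.2 * F u.2 w.1 * F u.2 w.2

/-- If the box norm of the balanced function of a set is large, and its mean is not too negative,
then the set has increased density on a large product set. -/
theorem exists_increment_of_boxSum {X Y : Type*} [DecidableEq X] [DecidableEq Y]
    (A : X → Y → Prop) [∀ x y, Decidable (A x y)]
    (S : Finset X) (R : Finset Y) (δ ω : ℝ) (hδ0 : 0 ≤ δ) (hδ1 : δ ≤ 1) (hω : 0 < ω)
    (hS : 0 < S.card) (hR : 0 < R.card)
    (hbox : ω * (S.card : ℝ) ^ 2 * (R.card : ℝ) ^ 2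
      ≤ boxSum (fun x y => (if A x y then 1 else 0) - δ) S R)
    (hmean : -(ω / 8) * (S.card * R.card) ≤ ∑ x ∈ S, ∑ y ∈ R, ((if A x y then 1 else 0) - δ)) :
    ∃ F₁ ⊆ S, ∃ F₂ ⊆ R, ω / 4 * (S.card * R.card)
      ≤ ∑ x ∈ F₁, ∑ y ∈ F₂, ((if A x y then 1 else 0) - δ : ℝ) := by
  set F : X → Y → ℝ := fun x y => (if A x y then 1 else 0) - δ with hF
  have hS' : (0 : ℝ) < S.card := by exact_mod_cast hS
  have hR' : (0 : ℝ) < R.card := by exact_mod_cast hR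
  have hF1 : ∀ x y, |F x y| ≤ 1 := by
    intro x y
    simp only [hF]; split_ifs <;> rw [abs_le] <;> constructor <;> linarith
  by_contra! hno
  -- Averaging the box norm over one vertex gives a pair (x₀, y₀) whose neighborhoods correlate with
  -- F.
  obtain ⟨x₀, hx₀, y₀, hy₀, h0⟩ : ∃ x₀ ∈ S, ∃ y₀ ∈ R, ω * (S.card * R.card)
      ≤ ∑ x ∈ S, ∑ y ∈ R, F x y * F x y₀ * F x₀ y * F x₀ y₀ := by
    by_contra! hlt
    have : boxSum F S R = ∑ x₀ ∈ S, ∑ y₀ ∈ R,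
        ∑ x ∈ S, ∑ y ∈ R, F x y * F x y₀ * F x₀ y * F x₀ y₀ := by
      unfold boxSum
      simp_rw [Finset.sum_product]
      rw [Finset.sum_comm]
      refine Finset.sum_congr rfl fun x₀ _ => ?_
      rw [Finset.sum_comm (s := R) (t := S)]
      exact Finset.sum_congr rfl fun x _ => Finset.sum_comm
    rw [this] at hbox
    have hne : S.Nonempty := Finset.card_pos.1 hS
    have hne' : R.Nonempty := Finset.card_pos.1 hR
    have := Finset.sum_lt_sum_of_nonempty hne fun x₀ hx₀ =>
      Finset.sum_lt_sum_of_nonempty hne' fun y₀ hy₀ => hlt x₀ hx₀ y₀ hy₀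
    simp only [Finset.sum_const, nsmul_eq_mul] at this
    nlinarith
  -- Rows are sorted by adjacency to y₀ and columns by adjacency to x₀. On each of the four blocks F
  -- x y₀ and F x₀ y are constant, so the sum becomes a combination of the block sums G a b.
  set P : Bool → Finset X := fun b => S.filter (fun x => decide (A x y₀) = b) with hP
  set Q : Bool → Finset Y := fun b => R.filter (fun y => decide (A x₀ y) = b) with hQ
  set w : Bool → ℝ := fun b => if b then 1 - δ else -δ with hw
  set G : Bool → Bool → ℝ := fun a b => ∑ x ∈ P a, ∑ y ∈ Q b, F x y with hG
  have split : ∀ φ : X → Y → ℝ, ∑ x ∈ S, ∑ y ∈ R, φ x y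
      = ∑ a : Bool, ∑ b : Bool, ∑ x ∈ P a, ∑ y ∈ Q b, φ x y := by
    intro φ
    have : ∀ a : Bool, ∑ b : Bool, ∑ x ∈ P a, ∑ y ∈ Q b, φ x y
        = ∑ x ∈ P a, ∑ y ∈ R, φ x y := by
      intro a
      rw [Finset.sum_comm]
      refine Finset.sum_congr rfl fun x _ => ?_
      exact Finset.sum_fiberwise R (fun y => decide (A x₀ y)) _
    simp_rw [this]
    exact (Finset.sum_fiberwise S (fun x => decide (A x y₀)) _).symm
  have hsum : ∑ x ∈ S, ∑ y ∈ R, F x y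
      = G true true + G true false + (G false true + G false false) := by
    rw [split F]; simp only [Fintype.sum_bool, hG]
  have hsum' := split fun x y => F x y * F x y₀ * F x₀ y * F x₀ y₀
  have hwt : ∀ a b, ∑ x ∈ P a, ∑ y ∈ Q b, F x y * F x y₀ * F x₀ y * F x₀ y₀
      = w a * w b * F x₀ y₀ * G a b := by
    intro a b
    simp only [hG, Finset.mul_sum]
    refine Finset.sum_congr rfl fun x hx => Finset.sum_congr rfl fun y hy => ?_
    have h1 : F x y₀ = w a := by
      have := (Finset.mem_filter.1 hx).2
      rw [← this]
      by_cases hA : A x y₀ <;> simp [hF, hw, hA]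
    have h2 : F x₀ y = w b := by
      have := (Finset.mem_filter.1 hy).2
      rw [← this]
      by_cases hA : A x₀ y <;> simp [hF, hw, hA]
    rw [h1, h2]; ring
  simp_rw [hwt] at hsum'
  simp only [Fintype.sum_bool] at hsum'
  have hup : ∀ a b, G a b ≤ ω / 4 * (S.card * R.card) := fun a b =>
    (hno _ (Finset.filter_subset _ _) _ (Finset.filter_subset _ _)).le
  set m : ℝ := S.card * R.card with hm
  have hm0 : 0 < m := mul_pos hS' hR'
  have hωm : 0 < ω * m := mul_pos hω hm0
  have hmean' := hmean.trans_eq hsum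
  -- Each block sum is at most (ω/4)m and the total is at least -(ω/8)m. So each is at least -(1/8 +
  -- 3/4)ωm. Since the weights |w| add up to 1, a combination of size at most (7/8)ωm results,
  -- contradicting the choice of (x₀, y₀).
  have hlow : ∀ a b, |G a b| ≤ 7 / 8 * ω * m := by
    have h11 := hup true true
    have h10 := hup true false
    have h01 := hup false true
    have h00 := hup false false
    clear_value G
    intro a b
    rw [abs_le]
    cases a <;> cases b <;> constructor <;> linarith
  have hterm : ∀ a b, w a * w b * F x₀ y₀ * G a b ≤ |w a| * |w b| * (7 / 8 * ω * m) := by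
    intro a b
    refine (le_abs_self _).trans ?_
    rw [abs_mul, abs_mul, abs_mul]
    have := hF1 x₀ y₀
    calc _ ≤ |w a| * |w b| * 1 * (7 / 8 * ω * m) := by
          gcongr
          exact hlow a b
      _ = _ := by ring
  clear split hwt hno hbox hup hlow hsum hmean hmean'
  have hw1 : |w true| = 1 - δ := abs_of_nonneg (sub_nonneg.2 hδ1)
  have hw0 : |w false| = δ := (abs_neg δ).trans (abs_of_nonneg hδ0)
  have h11 := hterm true true
  have h10 := hterm true false
  have h01 := hterm false true
  have h00 := hterm false false
  rw [hw1] at h11 h10 h01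
  rw [hw0] at h10 h01 h00
  have htot : ω * m ≤ 7 / 8 * ω * m := by
    calc ω * m ≤ _ := h0.trans_eq hsum'
      _ ≤ (1 - δ) * (1 - δ) * (7 / 8 * ω * m) + (1 - δ) * δ * (7 / 8 * ω * m)
          + (δ * (1 - δ) * (7 / 8 * ω * m) + δ * δ * (7 / 8 * ω * m)) :=
          add_le_add (add_le_add h11 h10) (add_le_add h01 h00)
      _ = _ := by ring
  linarith

/-! ### From a large score on one cell to a density increment -/

/-- The weight ∑ p z s is replaced by its mean c|Z| against a bounded test function, at the cost of
its L¹ deviation on all of S. This removes the weight from the box norm. -/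
theorem IsMixing.sum_mul_le {ι σ : Type*} {Z : Finset ι} {S S' : Finset σ}
    {p : ι → σ → ℝ} {c η : ℝ} (h : IsMixing Z S p c η) (hη : 0 ≤ η) (hS : S' ⊆ S)
    (φ : σ → ℝ) (hφ : ∀ s ∈ S', |φ s| ≤ 1) :
    ∑ s ∈ S', φ s * ∑ z ∈ Z, p z s ≤ c * Z.card * ∑ s ∈ S', φ s + √(3 * η) * S.card * Z.card := by
  have h1 : ∑ s ∈ S', φ s * ∑ z ∈ Z, p z s
      = c * Z.card * ∑ s ∈ S', φ s + ∑ s ∈ S', φ s * (∑ z ∈ Z, p z s - c * Z.card) := by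
    simp_rw [mul_sub, Finset.sum_sub_distrib, ← Finset.sum_mul]
    ring
  rw [h1]
  gcongr
  calc _ ≤ ∑ s ∈ S', |∑ z ∈ Z, p z s - c * Z.card| := by
        refine Finset.sum_le_sum fun s hs => (le_abs_self _).trans ?_
        rw [abs_mul]
        exact mul_le_of_le_one_left (abs_nonneg _) (hφ s hs)
    _ ≤ ∑ s ∈ S, |∑ z ∈ Z, p z s - c * Z.card| :=
        Finset.sum_le_sum_of_subset_of_nonneg hS fun _ _ _ => abs_nonneg _
    _ ≤ _ := h.sum_abs_sub_le hη

/-- The numerical relation between the normalized corner count `t` and box norm `b`. -/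
theorem four_pow_le_of_bounds {P L H T box ς s r ε Q₁ Q₂ Q₃ β₁ β₂ : ℝ} (hβ₁ : 0 < β₁) (hβ₂ : 0 < β₂)
    (hβ₁' : β₁ ≤ 1) (hβ₂' : β₂ ≤ 1)
    (hP : P = β₁ * β₂) (hL : 0 < L) (hH : 0 < H) (hε : ε ≤ 1) (hς : ς ≤ ε * P ^ 4)
    (hr0 : 0 ≤ r) (hs : s ≤ 2 * β₁ * L) (hr : r ≤ 2 * β₂ * L)
    (h : T ^ 4 ≤ Q₁ ^ 2 * Q₂ * Q₃) (hQ₁0 : 0 ≤ Q₁) (hQ₂0 : 0 ≤ Q₂) (hQ₃0 : 0 ≤ P ^ 2 * box + ς * L ^ 4)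
    (hQ₁ : Q₁ ≤ β₂ * H * s + ς * L * H) (hQ₂ : Q₂ ≤ β₁ ^ 2 * H * r ^ 2 + ς * L ^ 2 * H)
    (hQ₃ : Q₃ ≤ P ^ 2 * H * box + ς * L ^ 4 * H) :
    (T / (P ^ 2 * L ^ 2 * H)) ^ 4 ≤ 45 * (box / (P ^ 2 * L ^ 4) + ε) := by
  have hP0 : 0 < P := by rw [hP]; positivity
  have hP1 : P ≤ 1 := by rw [hP]; exact mul_le_one₀ hβ₁' hβ₂.le hβ₂'
  have hςP2 : ς ≤ P ^ 2 := by
    calc ς ≤ ε * P ^ 4 := hς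
      _ ≤ 1 * P ^ 4 := by gcongr
      _ = P ^ 4 := one_mul _
      _ ≤ P ^ 2 := pow_le_pow_of_le_one hP0.le hP1 (by norm_num)
  have hςP : ς ≤ P := hςP2.trans (by nlinarith)
  -- The densities of S and R are at most twice the expected ones. This gives 3 = 2 + 1 here and 5 =
  -- 2² + 1 below, and 45 = 3² · 5.
  have h1 : Q₁ ≤ 3 * (P * L * H) := by
    calc Q₁ ≤ β₂ * H * s + ς * L * H := hQ₁
      _ ≤ β₂ * H * (2 * β₁ * L) + P * L * H := by gcongr
      _ = _ := by rw [hP]; ring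
  have h2 : Q₂ ≤ 5 * (P ^ 2 * L ^ 2 * H) := by
    calc Q₂ ≤ β₁ ^ 2 * H * r ^ 2 + ς * L ^ 2 * H := hQ₂
      _ ≤ β₁ ^ 2 * H * (2 * β₂ * L) ^ 2 + P ^ 2 * L ^ 2 * H := by gcongr
      _ = _ := by rw [hP]; ring
  have h3 : Q₃ ≤ (P ^ 2 * box + ς * L ^ 4) * H := hQ₃.trans_eq (by ring)
  have h4 : T ^ 4 ≤ (3 * (P * L * H)) ^ 2 * (5 * (P ^ 2 * L ^ 2 * H)) *
      ((P ^ 2 * box + ε * P ^ 4 * L ^ 4) * H) := by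
    calc T ^ 4 ≤ _ := h
      _ ≤ Q₁ ^ 2 * Q₂ * ((P ^ 2 * box + ς * L ^ 4) * H) := by gcongr
      _ ≤ (3 * (P * L * H)) ^ 2 * (5 * (P ^ 2 * L ^ 2 * H)) *
        ((P ^ 2 * box + ς * L ^ 4) * H) := by gcongr
      _ ≤ _ := by gcongr
  rw [div_pow, div_le_iff₀ (by positivity)]
  refine h4.trans_eq ?_
  field_simp
  ring

/-- Either the mean `m` is large, or the box norm is large and `m` is not too negative. -/
theorem mean_or_box_large {δ Q sr box t m : ℝ} (hδ : 0 < δ)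
    (hQ : 0 < Q) (hsr0 : 0 ≤ sr) (hsr1 : Q ≤ 4 * sr) (hsr2 : sr ≤ 4 * Q)
    (ht : t ≤ 6) (hbox : t ^ 4 ≤ 45 * (box / Q ^ 2 + δ ^ 12 / 2 ^ 60))
    (hv : δ ^ 3 / 2 ^ 8 ≤ t + 2 ^ 60 / δ ^ 12 * (m / Q)) :
    δ ^ 15 / 2 ^ 80 * sr ≤ m ∨
      (δ ^ 12 / 2 ^ 47 * sr ^ 2 ≤ box ∧ -((δ ^ 12 / 2 ^ 47) / 8) * sr ≤ m) := by
  obtain ⟨M, hM⟩ : ∃ M, M = m / Q := ⟨_, rfl⟩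
  have hmM : m = M * Q := by rw [hM]; field_simp
  rw [← hM] at hv
  have hδpos : 0 < δ ^ 12 := by positivity
  have hδ3 : 0 < δ ^ 3 := by positivity
  have hδ15 : δ ^ 15 = δ ^ 12 * δ ^ 3 := by ring
  by_cases hcase : δ ^ 15 / 2 ^ 69 ≤ M
  · left
    rw [hmM]
    have h15 : 0 < δ ^ 15 := by positivity
    have := mul_le_mul_of_nonneg_right hcase hQ.le
    have := mul_le_mul_of_nonneg_left hsr2 h15.le
    have := mul_pos h15 hQ
    linarith
  · right
    push Not at hcase
    have h1 : 2 ^ 60 / δ ^ 12 * M ≤ δ ^ 3 / 2 ^ 9 := by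
      rw [div_mul_eq_mul_div, div_le_iff₀ hδpos]
      rw [hδ15] at hcase
      linarith
    have h2 : δ ^ 3 / 2 ^ 9 ≤ t := by linarith
    have h3 : δ ^ 12 / 2 ^ 36 ≤ t ^ 4 := by
      have := pow_le_pow_left₀ (by positivity) h2 4
      refine le_trans (le_of_eq ?_) this
      ring
    have h4 : δ ^ 12 / 2 ^ 43 ≤ box / Q ^ 2 := by linarith
    rw [le_div_iff₀ (by positivity)] at h4
    constructor
    · have h5 : sr ^ 2 ≤ 16 * Q ^ 2 := by
        have := pow_le_pow_left₀ hsr0 hsr2 2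
        linarith
      have := mul_le_mul_of_nonneg_left h5 hδpos.le
      linarith
    · have h6 : -6 ≤ 2 ^ 60 / δ ^ 12 * M := by linarith
      rw [div_mul_eq_mul_div, le_div_iff₀ hδpos] at h6
      have h7 : -(δ ^ 12 / 2 ^ 57) ≤ M := by linarith
      rw [hmM]
      have := mul_le_mul_of_nonneg_right h7 hQ.le
      have := mul_le_mul_of_nonneg_left hsr1 hδpos.le
      have := mul_nonneg hδpos.le hsr0
      linarith

/-- A cell on which the corner count is unusually small, or the density unusually large, contains
a product set on which the density is increased. -/
theorem exists_increment_of_mixing {ι X : Type*} [DecidableEq X] (Z : Finset ι) (B S R : Finset X)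
    (hS : S ⊆ B) (hR : R ⊆ B) (A : X → X → Prop) [∀ x y, Decidable (A x y)]
    (g p h q : ι → X → ℝ) (β₁ β₂ η δ : ℝ) (hβ₁ : 0 < β₁) (hβ₂ : 0 < β₂) (hδ : 0 < δ) (hδ1 : δ ≤ 1)
    (hη : 0 ≤ η) (hB : 0 < B.card) (hZ : 0 < Z.card)
    (hp : IsMixing Z B p β₁ η) (hq : IsMixing Z B q β₂ η)
    (hg : ∀ z ∈ Z, ∀ y ∈ R, |g z y| ≤ p z y) (hh : ∀ z ∈ Z, ∀ x ∈ S, |h z x| ≤ q z x)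
    (hS1 : β₁ * B.card / 2 ≤ S.card) (hS2 : S.card ≤ 2 * β₁ * B.card)
    (hR1 : β₂ * B.card / 2 ≤ R.card) (hR2 : R.card ≤ 2 * β₂ * B.card)
    (hς : √(12 * η) ≤ δ ^ 12 / 2 ^ 60 * (β₁ * β₂) ^ 4)
    (hv : δ ^ 3 / 2 ^ 8 ≤
      (-∑ z ∈ Z, ∑ x ∈ S, ∑ y ∈ R, ((if A x y then 1 else 0) - δ) * g z y * h z x)
          / ((β₁ * β₂) ^ 2 * (B.card : ℝ) ^ 2 * Z.card)
        + 2 ^ 60 / δ ^ 12 * ((∑ x ∈ S, ∑ y ∈ R, ((if A x y then 1 else 0) - δ))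
          / (β₁ * β₂ * (B.card : ℝ) ^ 2))) :
    ∃ F₁ ⊆ S, ∃ F₂ ⊆ R, δ ^ 15 / 2 ^ 80 * (S.card * R.card)
        ≤ ∑ x ∈ F₁, ∑ y ∈ F₂, ((if A x y then 1 else 0) - δ : ℝ) ∧
      δ ^ 12 / 2 ^ 50 * S.card ≤ F₁.card ∧ δ ^ 12 / 2 ^ 50 * R.card ≤ F₂.card := by
  set F : X → X → ℝ := fun x y => (if A x y then 1 else 0) - δ with hF
  have hF1 : ∀ x y, |F x y| ≤ 1 := by
    intro x y
    simp only [hF]; split_ifs <;> rw [abs_le] <;> constructor <;> linarith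
  set L : ℝ := (B.card : ℝ) with hL
  set H : ℝ := (Z.card : ℝ) with hH
  set P : ℝ := β₁ * β₂ with hP
  have hL0 : 0 < L := by rw [hL]; exact_mod_cast hB
  have hH0 : 0 < H := by rw [hH]; exact_mod_cast hZ
  have hP0 : 0 < P := mul_pos hβ₁ hβ₂
  have hS0 : 0 < (S.card : ℝ) := lt_of_lt_of_le (by positivity) hS1
  have hR0 : 0 < (R.card : ℝ) := lt_of_lt_of_le (by positivity) hR1
  have hδ12 : δ ^ 12 ≤ 1 := pow_le_one₀ hδ.le hδ1
  have hδ3 : δ ^ 3 ≤ 1 := pow_le_one₀ hδ.le hδ1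
  set T : ℝ := ∑ z ∈ Z, ∑ x ∈ S, ∑ y ∈ R, F x y * g z y * h z x with hT
  set m : ℝ := ∑ x ∈ S, ∑ y ∈ R, F x y with hm
  have hSR1 : P * L ^ 2 ≤ 4 * (S.card * R.card) := by
    have := mul_le_mul hS1 hR1 (by positivity) hS0.le
    calc P * L ^ 2 = 4 * (β₁ * L / 2 * (β₂ * L / 2)) := by rw [hP]; ring
      _ ≤ _ := by gcongr
  have hSR2 : (S.card * R.card : ℝ) ≤ 4 * (P * L ^ 2) := by
    calc (S.card * R.card : ℝ) ≤ (2 * β₁ * L) * (2 * β₂ * L) := by gcongr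
      _ = _ := by rw [hP]; ring
  have hpos : ∀ z s, |p z s * q z s| = p z s * q z s := fun z s =>
    abs_of_nonneg (mul_nonneg (hp.nonneg _ _) (hq.nonneg _ _))
  have hbox_le : boxSum F S R ≤ (S.card * R.card : ℝ) ^ 2 := by
    calc boxSum F S R ≤ ∑ u ∈ S ×ˢ S, ∑ w ∈ R ×ˢ R, (1 : ℝ) := by
          refine Finset.sum_le_sum fun u _ => Finset.sum_le_sum fun w _ => (le_abs_self _).trans ?_
          simp only [abs_mul]
          exact mul_le_one₀ (mul_le_one₀ (mul_le_one₀ (hF1 _ _) (abs_nonneg _) (hF1 _ _))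
            (abs_nonneg _) (hF1 _ _)) (abs_nonneg _) (hF1 _ _)
      _ = _ := by simp [Finset.card_product]; ring
  -- The fourfold product of mixing families has error 4η, and √(3 · 4η) = √(12η).
  set ς : ℝ := √(12 * η) with hςd
  have hs6 : √(3 * (η + η)) ≤ ς := Real.sqrt_le_sqrt (by linarith)
  have hs3 : √(3 * η) ≤ ς := Real.sqrt_le_sqrt (by linarith)
  have hcs := pow_four_sum_le_box Z S R F g p h q hg hh
  have hQ1 : ∑ z ∈ Z, ∑ x ∈ S, q z x ≤ β₂ * H * S.card + ς * L * H := by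
    have := hq.sum_mul_le hη hS (fun _ => 1) (by simp)
    simp only [one_mul, Finset.sum_const, nsmul_eq_mul, mul_one] at this
    rw [Finset.sum_comm]
    refine this.trans ?_
    gcongr
  have hQ2 : ∑ z ∈ Z, ∑ w ∈ R ×ˢ R, p z w.1 * p z w.2
      ≤ β₁ ^ 2 * H * (R.card : ℝ) ^ 2 + ς * L ^ 2 * H := by
    have := (hp.prod hp).sum_mul_le (by linarith) (Finset.product_subset_product hR hR)
      (fun _ => 1) (by simp)
    simp only [one_mul, Finset.sum_const, nsmul_eq_mul, mul_one, Finset.card_product] at this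
    rw [Finset.sum_comm]
    refine this.trans ?_
    push_cast
    rw [← sq, ← sq, ← sq]
    gcongr
  have hQ3 : ∑ u ∈ S ×ˢ S, ∑ w ∈ R ×ˢ R, F u.1 w.1 * F u.1 w.2 * F u.2 w.1 * F u.2 w.2 *
        ∑ z ∈ Z, (q z u.1 * q z u.2) * (p z w.1 * p z w.2)
      ≤ P ^ 2 * H * boxSum F S R + ς * L ^ 4 * H := by
    have := ((hq.prod hq).prod (hp.prod hp)).sum_mul_le (by linarith)
      (Finset.product_subset_product (Finset.product_subset_product hS hS)
        (Finset.product_subset_product hR hR))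
      (fun v => F v.1.1 v.2.1 * F v.1.1 v.2.2 * F v.1.2 v.2.1 * F v.1.2 v.2.2) (by
        intro v _
        simp only [abs_mul]
        exact mul_le_one₀ (mul_le_one₀ (mul_le_one₀ (hF1 _ _) (abs_nonneg _) (hF1 _ _))
            (abs_nonneg _) (hF1 _ _)) (abs_nonneg _) (hF1 _ _))
    simp only [Finset.card_product, Finset.sum_product (s := S ×ˢ S) (t := R ×ˢ R)] at this
    unfold boxSum
    refine this.trans (le_of_eq ?_)
    have e : (3 * (η + η + (η + η))) = 12 * η := by ring
    rw [e]
    push_cast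
    rw [hP]
    ring
  have hQ10 : 0 ≤ ∑ z ∈ Z, ∑ x ∈ S, q z x :=
    Finset.sum_nonneg fun _ _ => Finset.sum_nonneg fun _ _ => hq.nonneg _ _
  have hQ20 : 0 ≤ ∑ z ∈ Z, ∑ w ∈ R ×ˢ R, p z w.1 * p z w.2 :=
    Finset.sum_nonneg fun _ _ => Finset.sum_nonneg fun _ _ =>
      mul_nonneg (hp.nonneg _ _) (hp.nonneg _ _)
  have hbox0 : 0 ≤ boxSum F S R := by
    unfold boxSum
    rw [Finset.sum_comm]
    refine Finset.sum_nonneg fun w _ => ?_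
    have : ∑ u ∈ S ×ˢ S, F u.1 w.1 * F u.1 w.2 * F u.2 w.1 * F u.2 w.2
        = (∑ x ∈ S, F x w.1 * F x w.2) ^ 2 := by
      rw [sq, Finset.sum_mul_sum, Finset.sum_product]
      exact Finset.sum_congr rfl fun _ _ => Finset.sum_congr rfl fun _ _ => by ring
    rw [this]; positivity
  have hς0 : 0 ≤ ς := Real.sqrt_nonneg _
  have hmain := four_pow_le_of_bounds (ε := δ ^ 12 / 2 ^ 60) hβ₁ hβ₂ hp.mean_le_one hq.mean_le_one
    hP hL0 hH0 (by linarith) hς hR0.le hS2 hR2 hcs hQ10 hQ20 (by positivity) hQ1 hQ2 hQ3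
  rw [neg_div] at hv
  set t : ℝ := -(T / (P ^ 2 * L ^ 2 * H)) with ht
  set b : ℝ := boxSum F S R / (P ^ 2 * L ^ 4) with hb
  have hmain' : t ^ 4 ≤ 45 * (b + δ ^ 12 / 2 ^ 60) := by
    rw [ht, Even.neg_pow (by decide)]; exact hmain
  have hb16 : b ≤ 16 := by
    rw [hb, div_le_iff₀ (by positivity)]
    calc boxSum F S R ≤ (S.card * R.card : ℝ) ^ 2 := hbox_le
      _ ≤ (4 * (P * L ^ 2)) ^ 2 := by gcongr
      _ = _ := by ring
  -- Trivial bound: the box norm gives t⁴ ≤ 45(16 + 1) < 6⁴.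
  have ht6 : t ≤ 6 := by
    by_contra! hlt
    have : (6 : ℝ) ^ 4 < t ^ 4 := pow_lt_pow_left₀ hlt (by norm_num) (by norm_num)
    linarith
  have hδpos : 0 < δ ^ 12 := pow_pos hδ _
  have hSR0 : 0 < (S.card * R.card : ℝ) := mul_pos hS0 hR0
  have hbeq : b = boxSum F S R / (P * L ^ 2) ^ 2 := by rw [hb]; congr 1; ring
  rw [hbeq] at hmain'
  -- If the mean is large, the whole of S × R already serves as the product set.
  rcases mean_or_box_large hδ (mul_pos hP0 (pow_pos hL0 2)) hSR0.le hSR1 hSR2 ht6 hmain' hv with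
    h | ⟨h5, h8⟩
  · exact ⟨S, subset_rfl, R, subset_rfl, h, mul_le_of_le_one_left hS0.le (by linarith),
      mul_le_of_le_one_left hR0.le (by linarith)⟩
  · obtain ⟨F₁, hF₁, F₂, hF₂, hinc⟩ := exists_increment_of_boxSum A S R δ (δ ^ 12 / 2 ^ 47) hδ.le hδ1
      (by linarith) (by exact_mod_cast hS0) (by exact_mod_cast hR0)
      (by rw [mul_assoc, ← mul_pow]; exact h5) h8
    -- Since F ≤ 1, the increment also bounds |F₁||F₂| below, which forces each side to be large.
    have hub : ∑ x ∈ F₁, ∑ y ∈ F₂, F x y ≤ F₁.card * F₂.card := by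
      calc _ ≤ ∑ x ∈ F₁, ∑ y ∈ F₂, (1 : ℝ) :=
            Finset.sum_le_sum fun x _ => Finset.sum_le_sum fun y _ => (le_abs_self _).trans (hF1 x y)
        _ = _ := by simp
    have hc1 : (F₁.card : ℝ) ≤ S.card := by exact_mod_cast Finset.card_le_card hF₁
    have hc2 : (F₂.card : ℝ) ≤ R.card := by exact_mod_cast Finset.card_le_card hF₂
    have hinc2 := hinc.trans hub
    have hle : δ ^ 12 / 2 ^ 50 ≤ δ ^ 12 / 2 ^ 47 / 4 := by linarith
    have hle2 : δ ^ 15 / 2 ^ 80 ≤ δ ^ 12 / 2 ^ 47 / 4 := by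
      have : δ ^ 15 ≤ δ ^ 12 := pow_le_pow_of_le_one hδ.le hδ1 (by norm_num)
      linarith
    have hinc3 := (mul_le_mul_of_nonneg_right hle hSR0.le).trans hinc2
    refine ⟨F₁, hF₁, F₂, hF₂, (mul_le_mul_of_nonneg_right hle2 hSR0.le).trans hinc, ?_, ?_⟩
    · refine le_of_mul_le_mul_right ?_ hR0
      rw [mul_assoc]
      exact hinc3.trans (mul_le_mul_of_nonneg_left hc2 (Nat.cast_nonneg _))
    · refine le_of_mul_le_mul_left ?_ hS0
      rw [mul_left_comm]
      exact hinc3.trans (mul_le_mul_of_nonneg_right hc1 (Nat.cast_nonneg _))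

/-! ### Cells and the count of corners -/

/-- The sum over the cell `(i + B) × (j + B)` of the balanced function of `A` on `X × Y` against
the other two vertices of corners, the antidiagonal of the corner running over `Z`. -/
noncomputable def cellCount (A : Finset (ℤ × ℤ)) (X Y B Z : Finset ℤ) (δ : ℝ) (i j : ℤ) : ℝ :=
  ∑ z ∈ Z, ∑ b ∈ B.filter (fun b => i + b ∈ X), ∑ c ∈ B.filter (fun c => j + c ∈ Y),
    (ind A (i + b, j + c) - δ) * ind A (z - j - c, j + c) * ind A (i + b, z - i - b)

/-- The sum of the balanced function of `A` on `X × Y` over the cell `(i + B) × (j + B)`. -/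
noncomputable def cellMean (A : Finset (ℤ × ℤ)) (X Y B : Finset ℤ) (δ : ℝ) (i j : ℤ) : ℝ :=
  ∑ b ∈ B.filter (fun b => i + b ∈ X), ∑ c ∈ B.filter (fun c => j + c ∈ Y),
    (ind A (i + b, j + c) - δ)

/-- Averaging a sum over the translates of `B`. -/
theorem sum_tile (I B X : Finset ℤ) (f : ℤ → ℝ) (h : ∀ x ∈ X, ∀ b ∈ B, x - b ∈ I) :
    ∑ i ∈ I, ∑ b ∈ B.filter (fun b => i + b ∈ X), f (i + b) = B.card * ∑ x ∈ X, f x := by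
  simp_rw [Finset.sum_filter]
  rw [Finset.sum_comm]
  have : ∀ b ∈ B, ∑ i ∈ I, (if i + b ∈ X then f (i + b) else 0) = ∑ x ∈ X, f x := by
    intro b hb
    rw [← Finset.sum_filter]
    refine Finset.sum_nbij' (fun i => i + b) (fun x => x - b) ?_ ?_ ?_ ?_ ?_
    · intro i hi; exact (Finset.mem_filter.1 hi).2
    · intro x hx; simp [h x hx b hb, hx]
    · intro i _; ring
    · intro i _; ring
    · intro i _; rfl
  rw [Finset.sum_congr rfl this]
  simp

theorem sum_tile₂ (I J B X Y : Finset ℤ) (f : ℤ → ℤ → ℝ) (hX : ∀ x ∈ X, ∀ b ∈ B, x - b ∈ I)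
    (hY : ∀ y ∈ Y, ∀ b ∈ B, y - b ∈ J) :
    ∑ i ∈ I, ∑ j ∈ J, ∑ b ∈ B.filter (fun b => i + b ∈ X), ∑ c ∈ B.filter (fun c => j + c ∈ Y),
      f (i + b) (j + c) = (B.card : ℝ) ^ 2 * ∑ x ∈ X, ∑ y ∈ Y, f x y := by
  have : ∀ i ∈ I, ∑ j ∈ J, ∑ b ∈ B.filter (fun b => i + b ∈ X),
      ∑ c ∈ B.filter (fun c => j + c ∈ Y), f (i + b) (j + c)
      = ∑ b ∈ B.filter (fun b => i + b ∈ X), B.card * ∑ y ∈ Y, f (i + b) y := by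
    intro i _
    rw [Finset.sum_comm]
    exact Finset.sum_congr rfl fun b _ => sum_tile J B Y (f (i + b)) hY
  rw [Finset.sum_congr rfl this, sum_tile I B X (fun x => B.card * ∑ y ∈ Y, f x y) hX,
    ← Finset.mul_sum]
  ring

theorem sum_ind_product {A : Finset (ℤ × ℤ)} {X Y : Finset ℤ} (hA : A ⊆ X ×ˢ Y) :
    ∑ x ∈ X, ∑ y ∈ Y, ind A (x, y) = A.card := by
  rw [← sum_ind_of_subset hA, Finset.sum_product]

/-- The hypotheses on I and J supply every base point x - b and y - b, so each point of X × Y is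
counted in exactly |B|² cells. -/
theorem sum_cellMean (A : Finset (ℤ × ℤ)) (X Y B I J : Finset ℤ) (δ : ℝ) (hA : A ⊆ X ×ˢ Y)
    (hX : ∀ x ∈ X, ∀ b ∈ B, x - b ∈ I) (hY : ∀ y ∈ Y, ∀ b ∈ B, y - b ∈ J) :
    ∑ i ∈ I, ∑ j ∈ J, cellMean A X Y B δ i j
      = (B.card : ℝ) ^ 2 * (A.card - δ * X.card * Y.card) := by
  unfold cellMean
  rw [sum_tile₂ I J B X Y (fun x y => ind A (x, y) - δ) hX hY]
  simp_rw [Finset.sum_sub_distrib, sum_ind_product hA]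
  simp
  left; ring

/-- For fixed z, the second vertex depends only on y and the third only on x. Their double sum is
thus the square of the number of points of A on the antidiagonal z. -/
theorem sum_antidiagonal_right {A : Finset (ℤ × ℤ)} {X Y : Finset ℤ} (hA : A ⊆ X ×ˢ Y) (z : ℤ) :
    ∑ y ∈ Y, ind A (z - y, y) = ((A.filter (fun p => p.1 + p.2 = z)).card : ℝ) := by
  simp only [ind, Finset.sum_boole]
  congr 1
  refine Finset.card_nbij' (fun y => (z - y, y)) (fun p => p.2) ?_ ?_ ?_ ?_
  · intro y hy; simp only [Finset.coe_filter, Set.mem_ofPred_eq] at *; exact ⟨hy.2, by ring⟩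
  · rintro ⟨x, y⟩ hp
    simp only [Finset.coe_filter, Set.mem_ofPred_eq] at *
    have : z - y = x := by linarith [hp.2]
    exact ⟨(Finset.mem_product.1 (hA hp.1)).2, this ▸ hp.1⟩
  · intro y _; rfl
  · rintro ⟨x, y⟩ hp
    simp only [Finset.coe_filter, Set.mem_ofPred_eq] at *
    simp only [Prod.mk.injEq, and_true]
    linarith [hp.2]

theorem sum_antidiagonal_left {A : Finset (ℤ × ℤ)} {X Y : Finset ℤ} (hA : A ⊆ X ×ˢ Y) (z : ℤ) :
    ∑ x ∈ X, ind A (x, z - x) = ((A.filter (fun p => p.1 + p.2 = z)).card : ℝ) := by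
  simp only [ind, Finset.sum_boole]
  congr 1
  refine Finset.card_nbij' (fun x => (x, z - x)) (fun p => p.1) ?_ ?_ ?_ ?_
  · intro y hy; simp only [Finset.coe_filter, Set.mem_ofPred_eq] at *; exact ⟨hy.2, by ring⟩
  · rintro ⟨x, y⟩ hp
    simp only [Finset.coe_filter, Set.mem_ofPred_eq] at *
    have : z - x = y := by linarith [hp.2]
    exact ⟨(Finset.mem_product.1 (hA hp.1)).1, this ▸ hp.1⟩
  · intro y _; rfl
  · rintro ⟨x, y⟩ hp
    simp only [Finset.coe_filter, Set.mem_ofPred_eq] at *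
    simp only [Prod.mk.injEq, true_and]
    linarith [hp.2]

/-- The side of the corner is z - x - y. A nonzero side is excluded, and for side zero the three
vertices coincide. -/
theorem corner_product_eq {A : Finset (ℤ × ℤ)} (hA : CornerFree A) (x y z : ℤ) :
    ind A (x, y) * ind A (z - y, y) * ind A (x, z - x)
      = if z = x + y then ind A (x, y) else 0 := by
  split_ifs with h
  · subst h
    rw [add_sub_cancel_right, add_sub_cancel_left, ind_mul_self, ind_mul_self]
  · have := hA x y (z - x - y) (by intro h0; apply h; linarith)
    rw [show x + (z - x - y) = z - y by ring, show y + (z - x - y) = z - x by ring] at this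
    unfold ind
    split_ifs <;> simp_all

/-- For a corner-free set the sum of the corner counts over all cells is very negative. -/
theorem sum_cellCount_le (A : Finset (ℤ × ℤ)) (X Y B I J D : Finset ℤ) (Z : ℤ → Finset ℤ) (δ : ℝ)
    (hδ : 0 ≤ δ) (hA : A ⊆ X ×ˢ Y) (hcorner : CornerFree A)
    (hX : ∀ x ∈ X, ∀ b ∈ B, x - b ∈ I) (hY : ∀ y ∈ Y, ∀ b ∈ B, y - b ∈ J)
    (hD : ∀ x ∈ X, ∀ y ∈ Y, x + y ∈ D) (hZ : ∀ j ∈ J, ∀ x ∈ X, ∀ b ∈ B, x + (j + b) ∈ Z j)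
    (hD0 : 0 < D.card) :
    ∑ i ∈ I, ∑ j ∈ J, cellCount A X Y B (Z j) δ i j
      ≤ (B.card : ℝ) ^ 2 * (A.card - δ * ((A.card : ℝ) ^ 2 / D.card)) := by
  set φ : ℤ → ℤ → ℝ := fun x y => ∑ z ∈ D,
    (ind A (x, y) - δ) * ind A (z - y, y) * ind A (x, z - x) with hφ
  have h1 : ∀ i ∈ I, ∀ j ∈ J, cellCount A X Y B (Z j) δ i j
      = ∑ b ∈ B.filter (fun b => i + b ∈ X), ∑ c ∈ B.filter (fun c => j + c ∈ Y),
        φ (i + b) (j + c) := by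
    intro i _ j hj
    unfold cellCount
    rw [Finset.sum_comm]
    refine Finset.sum_congr rfl fun b _ => ?_
    rw [Finset.sum_comm]
    refine Finset.sum_congr rfl fun c hc => ?_
    rw [Finset.mem_filter] at hc
    -- A nonzero term has (z - y, y) ∈ A, so z is a sum x' + y with x' ∈ X. Both D and Z j contain
    -- all these sums, so either range may be used.
    have hzero : ∀ z, z ∉ D ∨ z ∉ Z j → (ind A (i + b, j + c) - δ) * ind A (z - (j + c), j + c)
        * ind A (i + b, z - (i + b)) = 0 := by
      intro z hz
      have : (z - (j + c), j + c) ∉ A := by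
        intro hmem
        have hx := (Finset.mem_product.1 (hA hmem)).1
        simp only at hx
        rcases hz with hz | hz
        · apply hz
          have := hD _ hx _ hc.2
          rwa [sub_add_cancel] at this
        · apply hz
          have := hZ j hj _ hx _ hc.1
          rwa [sub_add_cancel] at this
      rw [ind_of_notMem this]; ring
    simp only [hφ, sub_sub]
    rw [Finset.sum_subset (Finset.subset_union_left (s₂ := D)) fun z _ hz => hzero z (.inr hz)]
    exact (Finset.sum_subset Finset.subset_union_right fun z _ hz => hzero z (.inl hz)).symm
  rw [Finset.sum_congr rfl fun i hi => Finset.sum_congr rfl fun j hj => h1 i hi j hj,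
    sum_tile₂ I J B X Y φ hX hY]
  gcongr
  set n : ℤ → ℝ := fun z => ((A.filter (fun p => p.1 + p.2 = z)).card : ℝ) with hn
  have h2 : ∑ x ∈ X, ∑ y ∈ Y, φ x y = A.card - δ * ∑ z ∈ D, n z ^ 2 := by
    have e1 : ∀ x ∈ X, ∀ y ∈ Y, φ x y
        = ind A (x, y) - δ * ∑ z ∈ D, ind A (z - y, y) * ind A (x, z - x) := by
      intro x hx y hy
      simp only [hφ, sub_mul, Finset.sum_sub_distrib, corner_product_eq hcorner, Finset.mul_sum]
      rw [Finset.sum_ite_eq' D, if_pos (hD x hx y hy)]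
      simp [mul_assoc]
    rw [Finset.sum_congr rfl fun x hx => Finset.sum_congr rfl fun y hy => e1 x hx y hy]
    simp_rw [Finset.sum_sub_distrib, sum_ind_product hA, ← Finset.mul_sum]
    congr 2
    calc _ = ∑ x ∈ X, ∑ z ∈ D, ∑ y ∈ Y, ind A (z - y, y) * ind A (x, z - x) :=
          Finset.sum_congr rfl fun x _ => Finset.sum_comm
      _ = ∑ z ∈ D, ∑ x ∈ X, ∑ y ∈ Y, ind A (z - y, y) * ind A (x, z - x) := Finset.sum_comm
      _ = _ := by
        refine Finset.sum_congr rfl fun z _ => ?_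
        simp_rw [← Finset.sum_mul, ← Finset.mul_sum]
        rw [sum_antidiagonal_right hA, sum_antidiagonal_left hA, sq]
  rw [h2]
  have h3 : ∑ z ∈ D, n z = A.card := by
    rw [Finset.card_eq_sum_card_fiberwise (f := fun p : ℤ × ℤ => p.1 + p.2) (t := D)]
    · push_cast; rfl
    · intro p hp
      have := Finset.mem_product.1 (hA hp)
      exact hD _ this.1 _ this.2
  -- Cauchy-Schwarz over the antidiagonals, whose counts add up to |A|.
  have h4 : (A.card : ℝ) ^ 2 / D.card ≤ ∑ z ∈ D, n z ^ 2 := by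
    rw [div_le_iff₀ (by exact_mod_cast hD0), ← h3, mul_comm]
    exact sq_sum_le_card_mul_sum_sq
  gcongr

/-- With `cellMean_le`, the worst-case contribution of a bad triple to the score. -/
theorem neg_cellCount_le (A : Finset (ℤ × ℤ)) (X Y B Z : Finset ℤ) (δ : ℝ) (hδ : 0 ≤ δ)
    (hδ1 : δ ≤ 1) (i j : ℤ) : -cellCount A X Y B Z δ i j ≤ (B.card : ℝ) ^ 2 * Z.card := by
  unfold cellCount
  simp_rw [← Finset.sum_neg_distrib]
  calc _ ≤ ∑ z ∈ Z, ∑ b ∈ B.filter (fun b => i + b ∈ X), ∑ c ∈ B.filter (fun c => j + c ∈ Y),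
        (1 : ℝ) := by
        refine Finset.sum_le_sum fun z _ => Finset.sum_le_sum fun b _ => Finset.sum_le_sum
          fun c _ => (neg_le_abs _).trans ?_
        rw [abs_mul, abs_mul, abs_of_nonneg (ind_nonneg A (z - j - c, j + c)),
          abs_of_nonneg (ind_nonneg A (i + b, z - i - b))]
        exact mul_le_one₀ (mul_le_one₀ (abs_ind_sub_le_one _ _ hδ hδ1) (ind_nonneg _ _)
          (ind_le_one _ _)) (ind_nonneg _ _) (ind_le_one _ _)
    _ = Z.card * ((B.filter (fun b => i + b ∈ X)).card * (B.filter (fun c => j + c ∈ Y)).card) := by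
        simp
    _ ≤ Z.card * (B.card * B.card) := by gcongr <;> exact Finset.filter_subset _ _
    _ = _ := by ring

theorem cellMean_le (A : Finset (ℤ × ℤ)) (X Y B : Finset ℤ) (δ : ℝ) (hδ : 0 ≤ δ) (hδ1 : δ ≤ 1)
    (i j : ℤ) : cellMean A X Y B δ i j ≤ (B.card : ℝ) ^ 2 := by
  unfold cellMean
  calc _ ≤ ∑ b ∈ B.filter (fun b => i + b ∈ X), ∑ c ∈ B.filter (fun c => j + c ∈ Y), (1 : ℝ) :=
        Finset.sum_le_sum fun b _ => Finset.sum_le_sum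
          fun c _ => (le_abs_self _).trans (abs_ind_sub_le_one _ _ hδ hδ1)
    _ = (B.filter (fun b => i + b ∈ X)).card * (B.filter (fun c => j + c ∈ Y)).card := by
        simp
    _ ≤ B.card * B.card := by gcongr <;> exact Finset.filter_subset _ _
    _ = _ := by ring

/-! ### Averaging: most triples are good -/

/-- Summing over translates of `C` the number of elements whose projection lies in the translate. -/
theorem sum_card_filter_translate {τ : Type*} (T : Finset τ) (π : τ → ℤ) (P C : Finset ℤ)
    (h : ∀ t ∈ T, ∀ c ∈ C, π t - c ∈ P) :
    ∑ i ∈ P, ((T.filter (fun t => π t - i ∈ C)).card : ℝ) = C.card * T.card := by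
  simp_rw [Finset.card_filter]
  push_cast
  rw [Finset.sum_comm]
  have : ∀ t ∈ T, ∑ i ∈ P, (if π t - i ∈ C then (1 : ℝ) else 0) = C.card := by
    intro t ht
    rw [Finset.sum_boole]
    congr 1
    refine Finset.card_nbij' (fun i => π t - i) (fun c => π t - c) ?_ ?_ ?_ ?_
    · intro i hi; simp only [Finset.coe_filter, Set.mem_ofPred_eq] at hi; exact hi.2
    · intro c hc
      simp only [Finset.coe_filter, Set.mem_ofPred_eq, sub_sub_cancel]
      exact ⟨h t ht c hc, hc⟩
    · intro i _; ring
    · intro i _; ring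
  rw [Finset.sum_congr rfl this]
  simp [mul_comm]

/-- A sum which is large, and whose bad terms contribute little, has a large good term. -/
theorem exists_good_of_sum_le {Ω : Type*} [DecidableEq Ω] (S : Finset Ω) (good : Ω → Prop)
    [DecidablePred good] (v : Ω → ℝ) (V W U : ℝ) (hV : 0 < V) (hW : 0 < W)
    (hsum : V ≤ ∑ ω ∈ S, v ω) (hcard : (S.card : ℝ) ≤ W) (hv : ∀ ω ∈ S, v ω ≤ U)
    (hbad : ((S.filter (fun ω => ¬ good ω)).card : ℝ) * U ≤ V / 2) :
    ∃ ω ∈ S, good ω ∧ V / (2 * W) ≤ v ω := by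
  by_contra! hno
  have h1 : ∑ ω ∈ S.filter good, v ω ≤ (S.filter good).card * (V / (2 * W)) := by
    simpa using Finset.sum_le_card_nsmul (S.filter good) v (V / (2 * W)) fun ω hω =>
      (hno ω (Finset.mem_filter.1 hω).1 (Finset.mem_filter.1 hω).2).le
  have h2 : ∑ ω ∈ S.filter (fun ω => ¬ good ω), v ω
      ≤ (S.filter (fun ω => ¬ good ω)).card * U := by
    simpa using Finset.sum_le_card_nsmul (S.filter (fun ω => ¬ good ω)) v U fun ω hω =>
      hv ω (Finset.mem_filter.1 hω).1
  have h3 := Finset.sum_filter_add_sum_filter_not S good v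
  have h4 : ((S.filter good).card : ℝ) ≤ S.card := by exact_mod_cast Finset.card_filter_le _ _
  have h5 : ((S.filter good).card : ℝ) * (V / (2 * W)) ≤ V / 2 := by
    calc _ ≤ W * (V / (2 * W)) := by gcongr; linarith
      _ = V / 2 := by field_simp
  have hne : (S.filter good).Nonempty := by
    by_contra hemp
    rw [Finset.not_nonempty_iff_eq_empty] at hemp
    rw [hemp] at h3
    simp at h3
    linarith
  have h1' : ∑ ω ∈ S.filter good, v ω < (S.filter good).card * (V / (2 * W)) := by
    simpa using Finset.sum_lt_sum_of_nonempty hne fun ω hω =>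
      (hno ω (Finset.mem_filter.1 hω).1 (Finset.mem_filter.1 hω).2)
  linarith

/-- Markov's inequality for the number of bad elements in translates. -/
theorem card_markov (P C P' G : Finset ℤ) (f : ℤ → ℤ → ℤ) (t : ℝ)
    (hf : ∀ e, Function.Injective fun i => f i e) (hP' : ∀ i ∈ P, ∀ e ∈ C, f i e ∈ P') :
    ((P.filter (fun i => t < (C.filter (fun e => f i e ∉ G)).card)).card : ℝ) * t
      ≤ C.card * (P' \ G).card := by
  calc _ ≤ ∑ i ∈ P.filter (fun i => t < (C.filter (fun e => f i e ∉ G)).card),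
        ((C.filter (fun e => f i e ∉ G)).card : ℝ) := by
        simpa using Finset.card_nsmul_le_sum (P.filter
          (fun i => t < (C.filter (fun e => f i e ∉ G)).card)) _ t
          fun i hi => (Finset.mem_filter.1 hi).2.le
    _ ≤ ∑ i ∈ P, ((C.filter (fun e => f i e ∉ G)).card : ℝ) :=
        Finset.sum_le_sum_of_subset_of_nonneg (Finset.filter_subset _ _)
          fun _ _ _ => Nat.cast_nonneg _
    _ = ∑ e ∈ C, ((P.filter (fun i => f i e ∉ G)).card : ℝ) := by
        simp_rw [Finset.card_filter]
        push_cast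
        exact Finset.sum_comm
    _ ≤ ∑ e ∈ C, ((P' \ G).card : ℝ) := by
        refine Finset.sum_le_sum fun e he => ?_
        rw [Nat.cast_le]
        refine Finset.card_le_card_of_injOn (fun i => f i e) ?_ ((hf e).injOn)
        intro i hi
        rw [Finset.mem_coe, Finset.mem_filter] at hi
        rw [Finset.mem_coe, Finset.mem_sdiff]
        exact ⟨hP' i hi.1 e he, hi.2⟩
    _ = _ := by simp

theorem card_filter_notMem_le (P C P' G : Finset ℤ) (f : ℤ → ℤ → ℤ)
    (hf : ∀ e, Function.Injective fun i => f i e) (hP' : ∀ i ∈ P, ∀ e ∈ C, f i e ∈ P') :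
    ∑ e ∈ C, ((P.filter (fun i => f i e ∉ G)).card : ℝ) ≤ C.card * (P' \ G).card := by
  calc _ ≤ ∑ e ∈ C, ((P' \ G).card : ℝ) := by
        refine Finset.sum_le_sum fun e he => ?_
        rw [Nat.cast_le]
        refine Finset.card_le_card_of_injOn (fun i => f i e) ?_ ((hf e).injOn)
        intro i hi
        rw [Finset.mem_coe, Finset.mem_filter] at hi
        rw [Finset.mem_coe, Finset.mem_sdiff]
        exact ⟨hP' i hi.1 e he, hi.2⟩
    _ = _ := by simp

/-- The conditions on a triple `(i, c, j)` under which the cell `(i + c + B) × (j + B)`, seen inside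
`(i + C₁) × ℤ`, is covered by the uniformity hypotheses. -/
structure GoodTriple (C₀ C₂ G₁ G₂ : Finset ℤ) (γ : ℝ) (ω : ℤ × ℤ × ℤ) : Prop where
  few₁ : ((C₂.filter (fun e => ω.1 + e ∉ G₁)).card : ℝ) ≤ γ * C₂.card
  mem_core : ω.2.1 ∈ C₀
  mem_left : ω.1 + ω.2.1 ∈ G₁
  mem_right : ω.2.2 ∈ G₂
  few₂ : ((C₂.filter (fun e => ω.2.2 + (e - ω.2.1) ∉ G₂)).card : ℝ) ≤ γ * C₂.card

/-- The five summands are the five ways to fail `GoodTriple`. The two Markov bounds give 8α/γ, a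
single bad center on either side gives 8α, and c outside the core gives 4κ. -/
theorem triple_sum_le {a p q k s₃ q₃ s₄ H α γ κ N₁ N₂ : ℝ} (ha : a ≤ 2 * α / γ * N₁)
    (hs₃ : s₃ ≤ H * (2 * α * N₁)) (hq₃ : q₃ ≤ 2 * α * N₂) (hs₄ : s₄ ≤ H * (2 * α / γ * N₂))
    (hp : p ≤ 2 * N₁) (hq : q ≤ 2 * N₂) (hk : k ≤ κ * H) (hp0 : 0 ≤ p) (hq0 : 0 ≤ q) (hH : 0 ≤ H)
    (hk0 : 0 ≤ k) (hq₃0 : 0 ≤ q₃) (hs₄0 : 0 ≤ s₄) (hγ : 0 ≤ γ) (hα : 0 ≤ α) (hκ : 0 ≤ κ) (hN₁ : 0 ≤ N₁) (hN₂ : 0 ≤ N₂) :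
    (a * (H * q) + p * (k * q)) + (s₃ * q + (p * (H * q₃) + p * s₄))
      ≤ (8 * α / γ + 8 * α + 4 * κ) * (N₁ * N₂ * H) := by
  calc _ ≤ (2 * α / γ * N₁ * (H * (2 * N₂)) + 2 * N₁ * (κ * H * (2 * N₂)))
        + (H * (2 * α * N₁) * (2 * N₂)
          + (2 * N₁ * (H * (2 * α * N₂)) + 2 * N₁ * (H * (2 * α / γ * N₂)))) := by gcongr
    _ = _ := by ring

/-- Most triples are good. -/
theorem card_not_goodTriple_le (C₀ C₂ G₁ G₂ P P' Q Q' : Finset ℤ) (α γ κ N₁ N₂ : ℝ) (hγ : 0 < γ)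
    (hC₂ : 0 < C₂.card) (hC₀ : ((C₂ \ C₀).card : ℝ) ≤ κ * C₂.card) (hκ : 0 ≤ κ)
    (hα : 0 ≤ α) (hN₁ : 0 ≤ N₁) (hN₂ : 0 ≤ N₂)
    (hP : (P.card : ℝ) ≤ 2 * N₁) (hQ : (Q.card : ℝ) ≤ 2 * N₂)
    (hP' : ∀ i ∈ P, ∀ e ∈ C₂, i + e ∈ P')
    (hQ0 : ∀ j ∈ Q, j ∈ Q') (hQ' : ∀ j ∈ Q, ∀ e ∈ C₂, ∀ c ∈ C₂, j + (e - c) ∈ Q')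
    (hG₁ : ((P' \ G₁).card : ℝ) ≤ 2 * α * N₁) (hG₂ : ((Q' \ G₂).card : ℝ) ≤ 2 * α * N₂) :
    open Classical in
    (((P ×ˢ C₂ ×ˢ Q).filter (fun ω => ¬ GoodTriple C₀ C₂ G₁ G₂ γ ω)).card : ℝ)
      ≤ (8 * α / γ + 8 * α + 4 * κ) * (N₁ * N₂ * C₂.card) := by
  classical
  set H : ℝ := (C₂.card : ℝ) with hH
  have hH0 : 0 < H := by rw [hH]; exact_mod_cast hC₂
  set b₁ : ℤ → Prop := fun i => γ * H < (C₂.filter (fun e => i + e ∉ G₁)).card with hb₁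
  set b₄ : ℤ → ℤ → Prop := fun c j => γ * H < (C₂.filter (fun e => j + (e - c) ∉ G₂)).card with hb₄
  have hm1 : ((P.filter b₁).card : ℝ) ≤ 2 * α / γ * N₁ := by
    have := card_markov P C₂ P' G₁ (fun i e => i + e) (γ * H) (fun e => add_left_injective e) hP'
    have h2 : ((P.filter b₁).card : ℝ) * (γ * H) ≤ (2 * α / γ * N₁) * (γ * H) := by
      calc _ ≤ H * (P' \ G₁).card := this
        _ ≤ H * (2 * α * N₁) := by gcongr
        _ = _ := by field_simp
    exact le_of_mul_le_mul_right h2 (by positivity)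
  have hm4 : ∀ c ∈ C₂, ((Q.filter (b₄ c)).card : ℝ) ≤ 2 * α / γ * N₂ := by
    intro c hc
    have := card_markov Q C₂ Q' G₂ (fun j e => j + (e - c)) (γ * H)
      (fun e => add_left_injective (e - c)) (fun j hj e he => hQ' j hj e he c hc)
    have h2 : ((Q.filter (b₄ c)).card : ℝ) * (γ * H) ≤ (2 * α / γ * N₂) * (γ * H) := by
      calc _ ≤ H * (Q' \ G₂).card := this
        _ ≤ H * (2 * α * N₂) := by gcongr
        _ = _ := by field_simp
    exact le_of_mul_le_mul_right h2 (by positivity)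
  have hm2 : ∑ c ∈ C₂, ((P.filter (fun i => i + c ∉ G₁)).card : ℝ) ≤ H * (2 * α * N₁) :=
    (card_filter_notMem_le P C₂ P' G₁ (fun i e => i + e) (fun e => add_left_injective e) hP').trans
      (by gcongr)
  have hm3 : ((Q.filter (fun j => j ∉ G₂)).card : ℝ) ≤ 2 * α * N₂ := by
    refine le_trans ?_ hG₂
    rw [Nat.cast_le]
    refine Finset.card_le_card fun j hj => ?_
    rw [Finset.mem_filter] at hj
    exact Finset.mem_sdiff.2 ⟨hQ0 j hj.1, hj.2⟩
  have hsub : (P ×ˢ C₂ ×ˢ Q).filter (fun ω => ¬ GoodTriple C₀ C₂ G₁ G₂ γ ω)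
      ⊆ (((P.filter b₁) ×ˢ C₂ ×ˢ Q) ∪ (P ×ˢ (C₂ \ C₀) ×ˢ Q)) ∪
        ((P ×ˢ C₂ ×ˢ Q).filter (fun ω => ω.1 + ω.2.1 ∉ G₁) ∪
        ((P ×ˢ C₂ ×ˢ (Q.filter (fun j => j ∉ G₂))) ∪
          (P ×ˢ C₂ ×ˢ Q).filter (fun ω => b₄ ω.2.1 ω.2.2))) := by
    rintro ⟨i, c, j⟩ hω
    simp only [Finset.mem_filter, Finset.mem_product] at hω
    obtain ⟨⟨hi, hc, hj⟩, hbad⟩ := hω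
    simp only [Finset.mem_union, Finset.mem_filter, Finset.mem_product, Finset.mem_sdiff]
    by_contra hno
    push Not at hno
    apply hbad
    obtain ⟨⟨h1, h2⟩, h3, h4, h5⟩ := hno
    refine ⟨?_, ?_, ?_, ?_, ?_⟩
    · by_contra h; exact h1 ⟨hi, not_le.1 h⟩ hc hj
    · by_contra h; exact h2 hi ⟨hc, h⟩ hj
    · exact h3 ⟨hi, hc, hj⟩
    · exact h4 hi hc hj
    · by_contra h; exact h5 ⟨hi, hc, hj⟩ (not_le.1 h)
  have e3 : (((P ×ˢ C₂ ×ˢ Q).filter (fun ω => ω.1 + ω.2.1 ∉ G₁)).card : ℝ)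
      = (∑ c ∈ C₂, ((P.filter (fun i => i + c ∉ G₁)).card : ℝ)) * Q.card := by
    simp_rw [Finset.card_filter]
    push_cast
    rw [Finset.sum_comm (s := C₂), Finset.sum_mul, Finset.sum_product]
    refine Finset.sum_congr rfl fun i _ => ?_
    rw [Finset.sum_mul, Finset.sum_product]
    refine Finset.sum_congr rfl fun c _ => ?_
    by_cases h : i + c ∈ G₁ <;> simp [h]
  have e5 : (((P ×ˢ C₂ ×ˢ Q).filter (fun ω => b₄ ω.2.1 ω.2.2)).card : ℝ)
      = P.card * ∑ c ∈ C₂, ((Q.filter (b₄ c)).card : ℝ) := by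
    simp_rw [Finset.card_filter]
    push_cast
    simp_rw [Finset.sum_product]
    simp
  have hle := (Finset.card_le_card hsub).trans ((Finset.card_union_le _ _).trans (add_le_add
    (Finset.card_union_le _ _) ((Finset.card_union_le _ _).trans
      (add_le_add le_rfl (Finset.card_union_le _ _)))))
  have hle' : (((P ×ˢ C₂ ×ˢ Q).filter (fun ω => ¬ GoodTriple C₀ C₂ G₁ G₂ γ ω)).card : ℝ)
      ≤ ((P.filter b₁).card * (H * Q.card) + P.card * ((C₂ \ C₀).card * Q.card))
        + ((∑ c ∈ C₂, ((P.filter (fun i => i + c ∉ G₁)).card : ℝ)) * Q.card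
          + (P.card * (H * (Q.filter (fun j => j ∉ G₂)).card)
            + P.card * ∑ c ∈ C₂, ((Q.filter (b₄ c)).card : ℝ))) := by
    rw [← e3, ← e5]
    simp only [Finset.card_product] at hle
    have := (Nat.cast_le (α := ℝ)).2 hle
    push_cast at this
    exact this
  have hm4' : ∑ c ∈ C₂, ((Q.filter (b₄ c)).card : ℝ) ≤ H * (2 * α / γ * N₂) := by
    simpa using Finset.sum_le_card_nsmul C₂ _ _ hm4
  exact hle'.trans (triple_sum_le hm1 hm2 hm3 hm4' hP hQ hC₀ (Nat.cast_nonneg _)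
    (Nat.cast_nonneg _) hH0.le (Nat.cast_nonneg _)
    (Nat.cast_nonneg _) (Finset.sum_nonneg fun _ _ => Nat.cast_nonneg _) hγ.le hα hκ hN₁ hN₂)

/-- The zero frequency of the balanced function controls the density. -/
theorem abs_card_filter_sub_le {B E : Finset ℤ} {m : ℤ} {α β : ℝ}
    (hF : ∀ x : UnitAddCircle, ‖∑ s ∈ shiftBy B m,
      ((ind E s - β : ℝ) : ℂ) * fourier (-s) x‖ ≤ α * B.card) :
    |((B.filter (fun b => m + b ∈ E)).card : ℝ) - β * B.card| ≤ α * B.card := by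
  have h := hF 0
  simp only [fourier_eval_zero, mul_one] at h
  rw [← Complex.ofReal_sum, Complex.norm_real, Real.norm_eq_abs, sum_shiftBy] at h
  convert h using 2
  simp [ind, Finset.sum_sub_distrib, mul_comm, add_comm]

/-! ### Strips and the choice of a cell -/

/-- The part of `A` above the translate `i + C`. -/
noncomputable def stripOf (A : Finset (ℤ × ℤ)) (C : Finset ℤ) (i : ℤ) : Finset (ℤ × ℤ) :=
  A.filter (fun p => p.1 - i ∈ C)

/-- The part of `E` in the translate `i + C`. -/
noncomputable def partOf (E C : Finset ℤ) (i : ℤ) : Finset ℤ := E.filter (fun x => x - i ∈ C)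

theorem mem_partOf {E C : Finset ℤ} {i x : ℤ} : x ∈ partOf E C i ↔ x ∈ E ∧ x - i ∈ C :=
  Finset.mem_filter

theorem stripOf_subset {A : Finset (ℤ × ℤ)} {E₁ E₂ : Finset ℤ} (hA : A ⊆ E₁ ×ˢ E₂) (C : Finset ℤ)
    (i : ℤ) : stripOf A C i ⊆ partOf E₁ C i ×ˢ E₂ := by
  intro p hp
  obtain ⟨h1, h2⟩ := Finset.mem_filter.1 hp
  have := Finset.mem_product.1 (hA h1)
  exact Finset.mem_product.2 ⟨mem_partOf.2 ⟨this.1, h2⟩, this.2⟩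

theorem CornerFree.mono {A A' : Finset (ℤ × ℤ)} (hA : CornerFree A) (h : A' ⊆ A) : CornerFree A' :=
  fun k m t ht ⟨h1, h2, h3⟩ => hA k m t ht ⟨h h1, h h2, h h3⟩

theorem card_partOf_le (E C : Finset ℤ) (i : ℤ) : (partOf E C i).card ≤ C.card := by
  refine Finset.card_le_card_of_injOn (fun x => x - i) ?_ (sub_left_injective.injOn)
  intro x hx
  exact (mem_partOf.1 hx).2

/-- The quantity maximized over cells: the deficit in the corner count plus a large multiple of
the density increment. -/
noncomputable def cellScore (A : Finset (ℤ × ℤ)) (E₁ E₂ B C₁ C₂ : Finset ℤ) (δ D₁ D₂ : ℝ)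
    (ω : ℤ × ℤ × ℤ) : ℝ :=
  -cellCount (stripOf A C₁ ω.1) (partOf E₁ C₁ ω.1) E₂ B (shiftBy C₂ (ω.1 + ω.2.2)) δ
      (ω.1 + ω.2.1) ω.2.2 / D₁
    + D₂ * cellMean (stripOf A C₁ ω.1) (partOf E₁ C₁ ω.1) E₂ B δ (ω.1 + ω.2.1) ω.2.2

/-- The total score is large. -/
theorem le_sum_cellScore (A : Finset (ℤ × ℤ)) (E₁ E₂ B C₁ C₂ P Q : Finset ℤ) (δ D₁ D₂ : ℝ)
    (hδ : 0 ≤ δ) (hD₁ : 0 < D₁) (hA : A ⊆ E₁ ×ˢ E₂) (hcorner : CornerFree A)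
    (hδA : (A.card : ℝ) = δ * E₁.card * E₂.card)
    (hB : ∀ b ∈ B, -b ∈ B) (h12 : ∀ c ∈ C₁, ∀ b ∈ B, c + b ∈ C₂)
    (hP : ∀ x ∈ E₁, ∀ c ∈ C₁, x - c ∈ P) (hQ : ∀ y ∈ E₂, ∀ b ∈ B, y - b ∈ Q)
    (hQ₁ : ∀ y ∈ E₂, ∀ c ∈ C₁, c + y ∈ Q) (hP0 : 0 < P.card) (hQ0 : 0 < Q.card) :
    (B.card : ℝ) ^ 2 / D₁ * (δ * (C₁.card * A.card : ℝ) ^ 2 / (P.card * Q.card) - C₁.card * A.card)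
      ≤ ∑ ω ∈ P ×ˢ C₂ ×ˢ Q, cellScore A E₁ E₂ B C₁ C₂ δ D₁ D₂ ω := by
  have hX : ∀ i, ∀ x ∈ partOf E₁ C₁ i, ∀ b ∈ B, x - b ∈ shiftBy C₂ i := by
    intro i x hx b hb
    rw [mem_shiftBy]
    have := h12 _ (mem_partOf.1 hx).2 _ (hB b hb)
    rwa [show x - i + -b = x - b - i by ring] at this
  have hstripE : ∑ i ∈ P, ((partOf E₁ C₁ i).card : ℝ) = C₁.card * E₁.card :=
    sum_card_filter_translate E₁ id P C₁ hP
  have hstripA : ∑ i ∈ P, ((stripOf A C₁ i).card : ℝ) = C₁.card * A.card :=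
    sum_card_filter_translate A Prod.fst P C₁
      fun t ht c hc => hP _ (Finset.mem_product.1 (hA ht)).1 c hc
  -- Each point of A and of E₁ lies in |C₁| strips, and |A| = δ|E₁||E₂|. The means therefore cancel,
  -- whatever multiple D₂ of them enters the score.
  have hmean : ∑ i ∈ P, ∑ c ∈ C₂, ∑ j ∈ Q,
      cellMean (stripOf A C₁ i) (partOf E₁ C₁ i) E₂ B δ (i + c) j = 0 := by
    have : ∀ i ∈ P, ∑ c ∈ C₂, ∑ j ∈ Q,
        cellMean (stripOf A C₁ i) (partOf E₁ C₁ i) E₂ B δ (i + c) j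
        = (B.card : ℝ) ^ 2 * ((stripOf A C₁ i).card - δ * (partOf E₁ C₁ i).card * E₂.card) := by
      intro i _
      rw [← sum_cellMean _ _ E₂ B (shiftBy C₂ i) Q δ (stripOf_subset hA C₁ i) (hX i) hQ,
        sum_shiftBy]
      simp_rw [add_comm]
    rw [Finset.sum_congr rfl this, ← Finset.mul_sum, Finset.sum_sub_distrib, hstripA,
      ← Finset.sum_mul, ← Finset.mul_sum, hstripE, hδA]
    ring
  have hcount : ∀ i ∈ P, (B.card : ℝ) ^ 2 * (δ / Q.card * ((stripOf A C₁ i).card : ℝ) ^ 2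
      - (stripOf A C₁ i).card) ≤ ∑ c ∈ C₂, ∑ j ∈ Q,
        -cellCount (stripOf A C₁ i) (partOf E₁ C₁ i) E₂ B (shiftBy C₂ (i + j)) δ (i + c) j := by
    intro i _
    have := sum_cellCount_le (stripOf A C₁ i) (partOf E₁ C₁ i) E₂ B (shiftBy C₂ i) Q
      (shiftBy Q i) (fun j => shiftBy C₂ (i + j)) δ hδ (stripOf_subset hA C₁ i)
      (hcorner.mono (Finset.filter_subset _ _)) (hX i) hQ
      (by
        intro x hx y hy
        rw [mem_shiftBy]
        have := hQ₁ y hy _ (mem_partOf.1 hx).2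
        rwa [show x - i + y = x + y - i by ring] at this)
      (by
        intro j _ x hx b hb
        rw [mem_shiftBy]
        have := h12 _ (mem_partOf.1 hx).2 _ hb
        rwa [show x - i + b = x + (j + b) - (i + j) by ring] at this)
      (by rw [card_shiftBy]; exact hQ0)
    rw [sum_shiftBy, card_shiftBy] at this
    simp_rw [Finset.sum_neg_distrib]
    simp_rw [add_comm _ i] at this
    refine le_trans (le_of_eq ?_) (neg_le_neg this)
    ring
  -- Cauchy-Schwarz once more, over the strips, to bound the sum of the squares of their sizes.
  have hcs : (C₁.card * A.card : ℝ) ^ 2 ≤ P.card * ∑ i ∈ P, ((stripOf A C₁ i).card : ℝ) ^ 2 := by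
    rw [← hstripA]
    exact sq_sum_le_card_mul_sum_sq
  have hP0' : (0 : ℝ) < P.card := by exact_mod_cast hP0
  have hQ0' : (0 : ℝ) < Q.card := by exact_mod_cast hQ0
  have hsum : ∑ ω ∈ P ×ˢ C₂ ×ˢ Q, cellScore A E₁ E₂ B C₁ C₂ δ D₁ D₂ ω
      = (∑ i ∈ P, ∑ c ∈ C₂, ∑ j ∈ Q,
        -cellCount (stripOf A C₁ i) (partOf E₁ C₁ i) E₂ B (shiftBy C₂ (i + j)) δ (i + c) j) / D₁ := by
    have e : D₂ * ∑ i ∈ P, ∑ c ∈ C₂, ∑ j ∈ Q,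
      cellMean (stripOf A C₁ i) (partOf E₁ C₁ i) E₂ B δ (i + c) j = 0 := by rw [hmean, mul_zero]
    unfold cellScore
    rw [Finset.sum_add_distrib]
    simp only [Finset.sum_product]
    simp_rw [Finset.mul_sum] at e
    rw [e, add_zero]
    simp_rw [Finset.sum_div]
  rw [hsum, div_mul_eq_mul_div]
  gcongr
  refine le_trans ?_ (Finset.sum_le_sum hcount)
  rw [← Finset.mul_sum, Finset.sum_sub_distrib, hstripA, ← Finset.mul_sum]
  gcongr
  have key : ∀ p q X s : ℝ, 0 < p → 0 < q → X ≤ p * s → δ * X / (p * q) ≤ δ / q * s := by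
    intro p q X s hp hq hX
    calc δ * X / (p * q) ≤ δ * (p * s) / (p * q) := by gcongr
      _ = δ / q * s := by field_simp
  exact key _ _ _ _ hP0' hQ0' hcs

/-- Nested finite sets `C₀ ⊆ C₁ ⊆ C₂ ⊆ C₃` of almost equal size, each absorbing a translation by the
symmetric set `B` into the next one. -/
structure NestedScales (B C₀ C₁ C₂ C₃ : Finset ℤ) (κ : ℝ) : Prop where
  neg_mem : ∀ b ∈ B, -b ∈ B
  card_pos : 0 < B.card
  add₀₁ : ∀ c ∈ C₀, ∀ b ∈ B, c + b ∈ C₁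
  add₁₂ : ∀ c ∈ C₁, ∀ b ∈ B, c + b ∈ C₂
  add₂₃ : ∀ c ∈ C₂, ∀ b ∈ B, c + b ∈ C₃
  subset₁₂ : C₁ ⊆ C₂
  card_sdiff : ((C₂ \ C₀).card : ℝ) ≤ κ * C₂.card
  card₃ : (C₃.card : ℝ) ≤ 2 * C₂.card
  card₁ : (C₂.card : ℝ) ≤ 2 * C₁.card

/-- The main term is at least δ²PH/8 ≥ 2 times c a, the contribution of the degenerate corners. At
least half of the main term therefore survives. -/
theorem score_lower_bound {L H c a p q δ P N₁ N₂ : ℝ} (hL : 0 < L) (hH : 0 < H) (hP : 0 < P)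
    (hδ : 0 < δ) (hN₁ : 0 < N₁) (hN₂ : 0 < N₂) (hc : H ≤ 2 * c) (ha : a = δ * P * N₁ * N₂)
    (hp : 0 < p) (hq : 0 < q) (hp' : p ≤ 2 * N₁) (hq' : q ≤ 2 * N₂)
    (hsize : 16 ≤ δ ^ 2 * P * H) :
    δ ^ 3 * (N₁ * N₂ * H) / 32
      ≤ L ^ 2 / (P ^ 2 * L ^ 2 * H) * (δ * (c * a) ^ 2 / (p * q) - c * a) := by
  have ha0 : 0 < a := by rw [ha]; positivity
  have hc0 : 0 < c := by linarith
  have h1 : δ ^ 2 * P * H / 8 * (c * a) ≤ δ * (c * a) ^ 2 / (p * q) := by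
    rw [le_div_iff₀ (by positivity)]
    calc δ ^ 2 * P * H / 8 * (c * a) * (p * q)
        ≤ δ ^ 2 * P * (2 * c) / 8 * (c * a) * ((2 * N₁) * (2 * N₂)) := by gcongr
      _ = δ * (c * a) * c * (δ * P * N₁ * N₂) := by ring
      _ = δ * (c * a) ^ 2 := by rw [← ha]; ring
  have h2 : δ ^ 2 * P * H / 16 * (c * a) ≤ δ * (c * a) ^ 2 / (p * q) - c * a := by
    have : 0 < c * a := by positivity
    nlinarith
  calc δ ^ 3 * (N₁ * N₂ * H) / 32
      = L ^ 2 / (P ^ 2 * L ^ 2 * H) * (δ ^ 2 * P * H / 16 * (H / 2 * (δ * P * N₁ * N₂))) := by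
        field_simp; norm_num
    _ ≤ L ^ 2 / (P ^ 2 * L ^ 2 * H) * (δ ^ 2 * P * H / 16 * (c * a)) := by
        rw [ha]; gcongr; linarith
    _ ≤ _ := by gcongr

/-- There is a good triple with a large score. -/
theorem exists_goodTriple {B C₀ C₁ C₂ C₃ P P' Q Q' G₁ G₂ E₁ E₂ : Finset ℤ} {A : Finset (ℤ × ℤ)}
    {δ β₁ β₂ α γ κ N₁ N₂ K : ℝ} (hC : NestedScales B C₀ C₁ C₂ C₃ κ)
    (hδ : 0 < δ) (hδ1 : δ ≤ 1) (hβ₁ : 0 < β₁) (hβ₂ : 0 < β₂) (hα : 0 ≤ α) (hγ : 0 < γ) (hκ : 0 ≤ κ)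
    (hN₁ : 0 < N₁) (hN₂ : 0 < N₂) (hK : 0 ≤ K)
    (hA : A ⊆ E₁ ×ˢ E₂) (hcorner : CornerFree A) (hδA : (A.card : ℝ) = δ * E₁.card * E₂.card)
    (hE₁ : (E₁.card : ℝ) = β₁ * N₁) (hE₂ : (E₂.card : ℝ) = β₂ * N₂)
    (hP : (P.card : ℝ) ≤ 2 * N₁) (hQ : (Q.card : ℝ) ≤ 2 * N₂) (hP0 : 0 < P.card) (hQ0 : 0 < Q.card)
    (hPE : ∀ x ∈ E₁, ∀ c ∈ C₁, x - c ∈ P) (hQE : ∀ y ∈ E₂, ∀ b ∈ B, y - b ∈ Q)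
    (hQE' : ∀ y ∈ E₂, ∀ c ∈ C₁, c + y ∈ Q)
    (hP' : ∀ i ∈ P, ∀ e ∈ C₂, i + e ∈ P')
    (hQ₀ : ∀ j ∈ Q, j ∈ Q') (hQ' : ∀ j ∈ Q, ∀ e ∈ C₂, ∀ c ∈ C₂, j + (e - c) ∈ Q')
    (hG₁ : ((P' \ G₁).card : ℝ) ≤ 2 * α * N₁) (hG₂ : ((Q' \ G₂).card : ℝ) ≤ 2 * α * N₂)
    (hsize : 16 ≤ δ ^ 2 * (β₁ * β₂) * C₂.card)
    (hbad : (8 * α / γ + 8 * α + 4 * κ) * (1 / (β₁ * β₂) ^ 2 + K / (β₁ * β₂)) ≤ δ ^ 3 / 64) :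
    ∃ ω : ℤ × ℤ × ℤ, GoodTriple C₀ C₂ G₁ G₂ γ ω ∧ ω.2.1 ∈ C₂ ∧
      δ ^ 3 / 2 ^ 8 ≤ cellScore A E₁ E₂ B C₁ C₂ δ ((β₁ * β₂) ^ 2 * (B.card : ℝ) ^ 2 * C₂.card)
        (K / (β₁ * β₂ * (B.card : ℝ) ^ 2)) ω := by
  classical
  have hB0 := hC.card_pos
  have hL0 : (0 : ℝ) < B.card := by exact_mod_cast hB0
  have hH0 : (0 : ℝ) < C₂.card := by
    by_contra h
    have : (C₂.card : ℝ) = 0 := le_antisymm (not_lt.1 h) (Nat.cast_nonneg _)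
    rw [this] at hsize
    linarith
  have hPp : 0 < β₁ * β₂ := mul_pos hβ₁ hβ₂
  have hlow := le_sum_cellScore A E₁ E₂ B C₁ C₂ P Q δ
    ((β₁ * β₂) ^ 2 * (B.card : ℝ) ^ 2 * C₂.card) (K / (β₁ * β₂ * (B.card : ℝ) ^ 2)) hδ.le
    (by positivity) hA hcorner hδA hC.neg_mem hC.add₁₂ hPE hQE hQE' hP0 hQ0
  have hV := score_lower_bound hL0 hH0 hPp hδ hN₁ hN₂ hC.card₁ (a := A.card)
    (by rw [hδA, hE₁, hE₂]; ring) (Nat.cast_pos.2 hP0) (Nat.cast_pos.2 hQ0) hP hQ hsize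
  have hbadcard := card_not_goodTriple_le C₀ C₂ G₁ G₂ P P' Q Q' α γ κ N₁ N₂ hγ
    (by exact_mod_cast hH0) hC.card_sdiff hκ hα hN₁.le hN₂.le hP hQ hP' hQ₀ hQ' hG₁ hG₂
  have hU0 : 0 ≤ 1 / (β₁ * β₂) ^ 2 + K / (β₁ * β₂) := by positivity
  -- There are at most 4N₁N₂H triples and their total score is at least δ³N₁N₂H/32. The bad triples
  -- account for at most half of this, so some good triple has score at least δ³/2⁸.
  obtain ⟨ω, hω, hgood, hval⟩ := exists_good_of_sum_le (P ×ˢ C₂ ×ˢ Q)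
    (fun ω => GoodTriple C₀ C₂ G₁ G₂ γ ω)
    (cellScore A E₁ E₂ B C₁ C₂ δ ((β₁ * β₂) ^ 2 * (B.card : ℝ) ^ 2 * C₂.card)
        (K / (β₁ * β₂ * (B.card : ℝ) ^ 2))) (δ ^ 3 * (N₁ * N₂ * C₂.card) / 32)
    (4 * (N₁ * N₂ * C₂.card)) (1 / (β₁ * β₂) ^ 2 + K / (β₁ * β₂)) (by positivity) (by positivity)
    (hV.trans hlow)
    (by
      simp only [Finset.card_product]
      push_cast
      calc (P.card : ℝ) * (C₂.card * Q.card) ≤ (2 * N₁) * (C₂.card * (2 * N₂)) := by gcongr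
        _ = _ := by ring)
    (by
      intro ω _
      unfold cellScore
      refine add_le_add ?_ ?_
      · rw [div_le_iff₀ (by positivity)]
        refine (neg_cellCount_le _ _ _ _ _ _ hδ.le hδ1 _ _).trans_eq ?_
        rw [card_shiftBy]
        field_simp
      · calc _ ≤ K / (β₁ * β₂ * (B.card : ℝ) ^ 2) * (B.card : ℝ) ^ 2 := by
              gcongr
              exact cellMean_le _ _ _ _ _ hδ.le hδ1 _ _
          _ = _ := by field_simp)
    (by
      calc _ ≤ (8 * α / γ + 8 * α + 4 * κ) * (N₁ * N₂ * C₂.card)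
            * (1 / (β₁ * β₂) ^ 2 + K / (β₁ * β₂)) := mul_le_mul_of_nonneg_right hbadcard hU0
        _ = (8 * α / γ + 8 * α + 4 * κ) * (1 / (β₁ * β₂) ^ 2 + K / (β₁ * β₂))
            * (N₁ * N₂ * C₂.card) := by ring
        _ ≤ δ ^ 3 / 64 * (N₁ * N₂ * C₂.card) := by gcongr
        _ = _ := by ring)
  refine ⟨ω, hgood, (Finset.mem_product.1 (Finset.mem_product.1 hω).2).1, le_trans (le_of_eq ?_) hval⟩
  have : N₁ * N₂ * C₂.card ≠ 0 := by positivity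
  field_simp
  norm_num

/-- For z = i + j + e the translate has center i + e. It is good if i + e ∈ G₁ and e ∈ C₀, the
latter ensuring that i + e + B stays where the truncated set agrees with E₁. The exceptions have
proportion at most κ + γ ≤ 2γ. Truncation to i + C₁ keeps the set small compared with C₂, as the
Parseval bound requires. -/
theorem isMixing_left {B C₀ C₁ C₂ C₃ G₁ G₂ E₁ : Finset ℤ} {β₁ α γ κ : ℝ}
    (hC : NestedScales B C₀ C₁ C₂ C₃ κ) {i c j : ℤ} (hω : GoodTriple C₀ C₂ G₁ G₂ γ (i, c, j))
    (hβ0 : 0 ≤ β₁) (hβ1 : β₁ ≤ 1) (hα : 0 ≤ α) (hγ : 0 ≤ γ) (hκγ : κ ≤ γ)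
    (hF : ∀ m ∈ G₁, ∀ x : UnitAddCircle, ‖∑ s ∈ shiftBy B m,
      ((ind E₁ s - β₁ : ℝ) : ℂ) * fourier (-s) x‖ ≤ α * B.card) :
    IsMixing (shiftBy C₂ (i + j)) B (fun z b => ind (partOf E₁ C₁ i) (z - j - b)) β₁
      (2 * (2 * γ) + 4 * α) := by
  classical
  refine isMixing_translates B (partOf E₁ C₁ i) (shiftBy C₂ (i + j))
    ((shiftBy C₂ (i + j)).filter (fun z => z - j - i ∈ C₀ ∧ z - j ∈ G₁)) j β₁ α (2 * γ) hβ0 hβ1 hα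
    (by linarith) hC.neg_mem (Finset.filter_subset _ _) ?_ ?_ ?_
  · rw [card_shiftBy]
    have hsub : shiftBy C₂ (i + j) \ (shiftBy C₂ (i + j)).filter
        (fun z => z - j - i ∈ C₀ ∧ z - j ∈ G₁)
        ⊆ shiftBy ((C₂ \ C₀) ∪ C₂.filter (fun e => i + e ∉ G₁)) (i + j) := by
      intro z hz
      simp only [Finset.mem_sdiff, Finset.mem_filter, mem_shiftBy, Finset.mem_union] at hz ⊢
      obtain ⟨h1, h2⟩ := hz
      rw [show z - j - i = z - (i + j) by ring] at h2
      rw [show i + (z - (i + j)) = z - j by ring]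
      tauto
    have h1 := (Finset.card_le_card hsub).trans_eq (card_shiftBy _ _)
    have h2 := (Nat.cast_le (α := ℝ)).2 (h1.trans (Finset.card_union_le _ _))
    push_cast at h2
    have h3 := hC.card_sdiff
    have h4 := hω.few₁
    have h5 : κ * (C₂.card : ℝ) ≤ γ * C₂.card := by gcongr
    simp only at h4
    linarith
  · rw [card_shiftBy]
    have h1 : ((partOf E₁ C₁ i).card : ℝ) ≤ C₁.card := by exact_mod_cast card_partOf_le _ _ _
    have h2 : (C₁.card : ℝ) ≤ C₂.card := by exact_mod_cast Finset.card_le_card hC.subset₁₂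
    have h3 : (0 : ℝ) ≤ C₂.card := Nat.cast_nonneg _
    linarith
  · intro z hz x
    obtain ⟨_, hz0, hz1⟩ := Finset.mem_filter.1 hz
    refine le_trans (le_of_eq ?_) (hF _ hz1 x)
    congr 1
    refine Finset.sum_congr rfl fun s hs => ?_
    have : s - i ∈ C₁ := by
      have := hC.add₀₁ _ hz0 _ (mem_shiftBy.1 hs)
      rwa [show z - j - i + (s - (z - j)) = s - i by ring] at this
    simp only [ind, mem_partOf, this, and_true]

/-- For z = i + j + e the center is j + (e - c), the quantity controlled by `few₂`. All these
translates of B lie in j - c + C₃, so truncation there changes nothing on them and leaves at most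
2|C₂| points. -/
theorem isMixing_right {B C₀ C₁ C₂ C₃ G₁ G₂ E₂ : Finset ℤ} {β₂ α γ κ : ℝ}
    (hC : NestedScales B C₀ C₁ C₂ C₃ κ) {i c j : ℤ} (hω : GoodTriple C₀ C₂ G₁ G₂ γ (i, c, j))
    (hβ0 : 0 ≤ β₂) (hβ1 : β₂ ≤ 1) (hα : 0 ≤ α) (hγ : 0 ≤ γ)
    (hF : ∀ m ∈ G₂, ∀ x : UnitAddCircle, ‖∑ s ∈ shiftBy B m,
      ((ind E₂ s - β₂ : ℝ) : ℂ) * fourier (-s) x‖ ≤ α * B.card) :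
    IsMixing (shiftBy C₂ (i + j)) B (fun z b => ind (partOf E₂ C₃ (j - c)) (z - (i + c) - b)) β₂
      (2 * (2 * γ) + 4 * α) := by
  classical
  refine isMixing_translates B (partOf E₂ C₃ (j - c)) (shiftBy C₂ (i + j))
    ((shiftBy C₂ (i + j)).filter (fun z => z - (i + c) ∈ G₂)) (i + c) β₂ α (2 * γ) hβ0 hβ1 hα
    (by linarith) hC.neg_mem (Finset.filter_subset _ _) ?_ ?_ ?_
  · rw [card_shiftBy]
    have hsub : shiftBy C₂ (i + j) \ (shiftBy C₂ (i + j)).filter (fun z => z - (i + c) ∈ G₂)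
        ⊆ shiftBy (C₂.filter (fun e => j + (e - c) ∉ G₂)) (i + j) := by
      intro z hz
      simp only [Finset.mem_sdiff, Finset.mem_filter, mem_shiftBy] at hz ⊢
      obtain ⟨h1, h2⟩ := hz
      rw [show j + (z - (i + j) - c) = z - (i + c) by ring]
      tauto
    have h1 := (Nat.cast_le (α := ℝ)).2 ((Finset.card_le_card hsub).trans_eq (card_shiftBy _ _))
    have h4 := hω.few₂
    simp only at h4
    have : 0 ≤ γ * (C₂.card : ℝ) := by positivity
    linarith
  · rw [card_shiftBy]
    have h1 : ((partOf E₂ C₃ (j - c)).card : ℝ) ≤ C₃.card := by exact_mod_cast card_partOf_le _ _ _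
    exact h1.trans hC.card₃
  · intro z hz x
    obtain ⟨hz0, hz1⟩ := Finset.mem_filter.1 hz
    refine le_trans (le_of_eq ?_) (hF _ hz1 x)
    congr 1
    refine Finset.sum_congr rfl fun s hs => ?_
    have : s - (j - c) ∈ C₃ := by
      have := hC.add₂₃ _ (mem_shiftBy.1 hz0) _ (mem_shiftBy.1 hs)
      rwa [show z - (i + j) + (s - (z - (i + c))) = s - (j - c) by ring] at this
    simp only [ind, mem_partOf, this, and_true]

/-- A good triple of large score contains a density increment. -/
theorem exists_increment_of_goodTriple {B C₀ C₁ C₂ C₃ G₁ G₂ E₁ E₂ : Finset ℤ} {A : Finset (ℤ × ℤ)}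
    {δ β₁ β₂ α γ κ : ℝ} (hC : NestedScales B C₀ C₁ C₂ C₃ κ)
    (hδ : 0 < δ) (hδ1 : δ ≤ 1) (hβ₁ : 0 < β₁) (hβ₂ : 0 < β₂) (hβ₁' : β₁ ≤ 1) (hβ₂' : β₂ ≤ 1)
    (hα : 0 ≤ α) (hγ : 0 ≤ γ) (hκγ : κ ≤ γ) (hαβ₁ : α ≤ β₁ / 2) (hαβ₂ : α ≤ β₂ / 2)
    (hA : A ⊆ E₁ ×ˢ E₂)
    (hF₁ : ∀ m ∈ G₁, ∀ x : UnitAddCircle, ‖∑ s ∈ shiftBy B m,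
      ((ind E₁ s - β₁ : ℝ) : ℂ) * fourier (-s) x‖ ≤ α * B.card)
    (hF₂ : ∀ m ∈ G₂, ∀ x : UnitAddCircle, ‖∑ s ∈ shiftBy B m,
      ((ind E₂ s - β₂ : ℝ) : ℂ) * fourier (-s) x‖ ≤ α * B.card)
    (hη : √(12 * (2 * (2 * γ) + 4 * α)) ≤ δ ^ 12 / 2 ^ 60 * (β₁ * β₂) ^ 4)
    {i c j : ℤ} (hω : GoodTriple C₀ C₂ G₁ G₂ γ (i, c, j)) (hc : c ∈ C₂)
    (hval : δ ^ 3 / 2 ^ 8 ≤ cellScore A E₁ E₂ B C₁ C₂ δ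
      ((β₁ * β₂) ^ 2 * (B.card : ℝ) ^ 2 * C₂.card)
        (2 ^ 60 / δ ^ 12 / (β₁ * β₂ * (B.card : ℝ) ^ 2)) (i, c, j)) :
    ∃ (y₁ y₂ : ℤ) (F₁ F₂ : Finset ℤ), F₁ ⊆ E₁ ∩ shiftBy B y₁ ∧ F₂ ⊆ E₂ ∩ shiftBy B y₂ ∧
      δ ^ 12 / 2 ^ 51 * β₁ * B.card ≤ F₁.card ∧ δ ^ 12 / 2 ^ 51 * β₂ * B.card ≤ F₂.card ∧
      δ ^ 15 / 2 ^ 80 * (F₁.card * F₂.card) ≤ ∑ x ∈ F₁, ∑ y ∈ F₂, (ind A (x, y) - δ) := by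
  classical
  set X := partOf E₁ C₁ i with hX
  set A' := stripOf A C₁ i with hA'
  have hA'X : A' ⊆ X ×ˢ E₂ := stripOf_subset hA C₁ i
  set S := B.filter (fun b => i + c + b ∈ X) with hS
  set R := B.filter (fun b => j + b ∈ E₂) with hR
  have hL0 : (0 : ℝ) < B.card := by exact_mod_cast hC.card_pos
  -- As c ∈ C₀, the first side i + c + B of the cell lies in i + C₁, so the strip does not cut it.
  have hSeq : S = B.filter (fun b => i + c + b ∈ E₁) := by
    refine Finset.filter_congr fun b hb => ?_
    rw [hX, mem_partOf, show i + c + b - i = c + b by ring]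
    exact and_iff_left (hC.add₀₁ _ hω.mem_core _ hb)
  have hScard := abs_card_filter_sub_le (hF₁ _ hω.mem_left)
  have hRcard := abs_card_filter_sub_le (hF₂ _ hω.mem_right)
  simp only at hScard hRcard
  rw [← hSeq, abs_le] at hScard
  rw [abs_le] at hRcard
  have hα₁ : α * B.card ≤ β₁ / 2 * B.card := by gcongr
  have hα₂ : α * B.card ≤ β₂ / 2 * B.card := by gcongr
  have hb₁ : 0 < β₁ * B.card := by positivity
  have hb₂ : 0 < β₂ * B.card := by positivity
  have hsub : ∀ u v, (u, v) ∈ A' → u ∈ X ∧ v ∈ E₂ := fun u v h => Finset.mem_product.1 (hA'X h)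
  obtain ⟨T₁, hT₁, T₂, hT₂, hinc, hcard₁, hcard₂⟩ := exists_increment_of_mixing
    (shiftBy C₂ (i + j)) B S R (Finset.filter_subset _ _) (Finset.filter_subset _ _)
    (fun b b' => (i + c + b, j + b') ∈ A')
    (fun z b => ind A' (z - j - b, j + b)) (fun z b => ind X (z - j - b))
    (fun z b => ind A' (i + c + b, z - (i + c) - b))
    (fun z b => ind (partOf E₂ C₃ (j - c)) (z - (i + c) - b)) β₁ β₂ (2 * (2 * γ) + 4 * α) δ
    hβ₁ hβ₂ hδ hδ1 (by positivity) hC.card_pos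
    (by rw [card_shiftBy]; exact Finset.card_pos.2 ⟨c, hc⟩)
    (isMixing_left hC hω hβ₁.le hβ₁' hα hγ hκγ hF₁)
    (isMixing_right hC hω hβ₂.le hβ₂' hα hγ hF₂)
    (by
      intro z _ b _
      rw [abs_of_nonneg (ind_nonneg _ _)]
      by_cases h : (z - j - b, j + b) ∈ A'
      · rw [ind_of_mem h, ind_of_mem (hsub _ _ h).1]
      · rw [ind_of_notMem h]; exact ind_nonneg _ _)
    (by
      intro z hz b hb
      rw [abs_of_nonneg (ind_nonneg _ _)]
      by_cases h : (i + c + b, z - (i + c) - b) ∈ A'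
      · rw [ind_of_mem h, ind_of_mem]
        rw [mem_partOf]
        refine ⟨(hsub _ _ h).2, ?_⟩
        -- The third vertex has second coordinate in j - c + C₂ - B, hence in j - c + C₃. The
        -- truncated E₂ is therefore a majorant.
        have := hC.add₂₃ _ (mem_shiftBy.1 hz) _ (hC.neg_mem _ (Finset.mem_filter.1 hb).1)
        rwa [show z - (i + j) + -b = z - (i + c) - b - (j - c) by ring] at this
      · rw [ind_of_notMem h]; exact ind_nonneg _ _)
    (by linarith) (by linarith) (by linarith) (by linarith) hη
    (by
      rw [card_shiftBy]
      refine hval.trans (le_of_eq ?_)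
      unfold cellScore cellCount cellMean
      rw [← mul_div_assoc, div_mul_eq_mul_div]
      rfl)
  -- Passing from the strip back to A can only increase the density.
  have hmono : ∑ x ∈ T₁, ∑ y ∈ T₂, ((if (i + c + x, j + y) ∈ A' then 1 else 0) - δ : ℝ)
      ≤ ∑ x ∈ shiftBy T₁ (i + c), ∑ y ∈ shiftBy T₂ j, (ind A (x, y) - δ) := by
    simp_rw [sum_shiftBy]
    refine Finset.sum_le_sum fun x _ => Finset.sum_le_sum fun y _ => ?_
    rw [add_comm x, add_comm y]
    by_cases h : (i + c + x, j + y) ∈ A'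
    · rw [if_pos h, ind_of_mem (Finset.filter_subset _ _ h)]
    · rw [if_neg h]
      have := ind_nonneg A (i + c + x, j + y)
      linarith
  have hc1 : (T₁.card : ℝ) ≤ S.card := by exact_mod_cast Finset.card_le_card hT₁
  have hc2 : (T₂.card : ℝ) ≤ R.card := by exact_mod_cast Finset.card_le_card hT₂
  refine ⟨i + c, j, shiftBy T₁ (i + c), shiftBy T₂ j, ?_, ?_, ?_, ?_, ?_⟩
  · intro x hx
    have := hT₁ (mem_shiftBy.1 hx)
    rw [hSeq, Finset.mem_filter, add_sub_cancel] at this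
    exact Finset.mem_inter.2 ⟨this.2, mem_shiftBy.2 this.1⟩
  · intro x hx
    have := hT₂ (mem_shiftBy.1 hx)
    rw [hR, Finset.mem_filter, add_sub_cancel] at this
    exact Finset.mem_inter.2 ⟨this.2, mem_shiftBy.2 this.1⟩
  · rw [card_shiftBy]
    refine le_trans ?_ hcard₁
    calc δ ^ 12 / 2 ^ 51 * β₁ * B.card = δ ^ 12 / 2 ^ 50 * (β₁ / 2 * B.card) := by ring
      _ ≤ _ := by gcongr; linarith
  · rw [card_shiftBy]
    refine le_trans ?_ hcard₂
    calc δ ^ 12 / 2 ^ 51 * β₂ * B.card = δ ^ 12 / 2 ^ 50 * (β₂ / 2 * B.card) := by ring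
      _ ≤ _ := by gcongr; linarith
  · rw [card_shiftBy, card_shiftBy]
    refine le_trans ?_ (hinc.trans hmono)
    gcongr

/-! ### Covering and size of Bohr sets -/

section bohr
variable {d : ℕ} (θ : Fin d → UnitAddCircle)

theorem exists_real_lift_norm (x : UnitAddCircle) : ∃ u : ℝ, (u : UnitAddCircle) = x ∧ |u| = ‖x‖ := by
  induction x using QuotientAddGroup.induction_on with
  | H v =>
    refine ⟨v - round v, ?_, (UnitAddCircle.norm_eq).symm⟩
    rw [AddCircle.coe_sub, sub_eq_self]
    have := AddCircle.coe_period (1 : ℝ)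
    rw [show ((round v : ℤ) : ℝ) = round v • (1 : ℝ) by simp, AddCircle.coe_zsmul, this, smul_zero]

theorem norm_coe_le_abs (u : ℝ) : ‖(u : UnitAddCircle)‖ ≤ |u| := by
  rw [UnitAddCircle.norm_eq]
  simpa using round_le u 0

theorem bohrSet_mono {r r' L L' : ℝ} (hr : r ≤ r') (hL : L ≤ L') :
    bohrSet θ r L ⊆ bohrSet θ r' L' := by
  intro n hn
  rw [mem_bohrSet] at *
  exact ⟨hn.1.trans hL, fun j => (hn.2 j).trans_le hr⟩

variable {θ}

theorem neg_mem_bohrSet {r L : ℝ} {n : ℤ} (hn : n ∈ bohrSet θ r L) : -n ∈ bohrSet θ r L := by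
  rw [mem_bohrSet] at *
  refine ⟨by push_cast; rw [abs_neg]; exact hn.1, fun j => ?_⟩
  rw [neg_smul, norm_neg]
  exact hn.2 j

theorem add_mem_bohrSet {r L r' L' r'' L'' : ℝ} {n m : ℤ} (hn : n ∈ bohrSet θ r L)
    (hm : m ∈ bohrSet θ r' L') (hr : r + r' ≤ r'') (hL : L + L' ≤ L'') :
    n + m ∈ bohrSet θ r'' L'' := by
  rw [mem_bohrSet] at *
  refine ⟨?_, fun j => ?_⟩
  · push_cast
    exact (abs_add_le _ _).trans ((add_le_add hn.1 hm.1).trans hL)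
  · rw [add_smul]
    exact (norm_add_le _ _).trans_lt ((add_lt_add (hn.2 j) (hm.2 j)).trans_le hr)

theorem sub_mem_bohrSet {r L r' L' r'' L'' : ℝ} {n m : ℤ} (hn : n ∈ bohrSet θ r L)
    (hm : m ∈ bohrSet θ r' L') (hr : r + r' ≤ r'') (hL : L + L' ≤ L'') :
    n - m ∈ bohrSet θ r'' L'' := by
  rw [sub_eq_add_neg]
  exact add_mem_bohrSet hn (neg_mem_bohrSet hm) hr hL

theorem zero_mem_bohrSet {r L : ℝ} (hr : 0 < r) (hL : 0 ≤ L) : 0 ∈ bohrSet θ r L := by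
  rw [mem_bohrSet]
  simp [hr, hL]

theorem floor_div_mem_Icc {u r : ℝ} {a : ℕ} (hr : 0 < r) (hu : |u| ≤ a * r) :
    ⌊u / r⌋ ∈ Finset.Icc (-(a : ℤ)) a := by
  rw [Finset.mem_Icc, Int.le_floor]
  obtain ⟨h1, h2⟩ := abs_le.1 hu
  constructor
  · rw [le_div_iff₀ hr]; push_cast; linarith
  · have : u / r ≤ a := by rwa [div_le_iff₀ hr]
    exact_mod_cast (Int.floor_le _).trans this

theorem abs_sub_lt_of_floor_div_eq {u v r : ℝ} (hr : 0 < r) (h : ⌊u / r⌋ = ⌊v / r⌋) :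
    |u - v| < r := by
  have := Int.abs_sub_lt_one_of_floor_eq_floor h
  rw [← sub_div, abs_div, abs_of_pos hr, div_lt_one hr] at this
  exact this

/-- A set of integers contained in a dilated Bohr set is covered by few translates of the
Bohr set. -/
theorem card_le_mul_card_bohrSet (θ : Fin d → UnitAddCircle) {r L : ℝ} (hr : 0 < r) (hL : 0 < L)
    (S : Finset ℤ) (a b : ℕ) (hS : ∀ n ∈ S, |(n : ℝ)| ≤ b * L ∧ ∀ j, ‖n • θ j‖ ≤ a * r) :
    S.card ≤ (bohrSet θ r L).card * ((2 * a + 1) ^ d * (2 * b + 1)) := by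
  choose u hu1 hu2 using fun (j : Fin d) (n : ℤ) => exists_real_lift_norm (n • θ j)
  set f : ℤ → (Fin d → ℤ) × ℤ := fun n => (fun j => ⌊u j n / r⌋, ⌊(n : ℝ) / L⌋) with hf
  -- Cells of side r and L. The value a of the floor can occur at the closed end, hence 2a + 1 cells
  -- per frequency and 2b + 1 for the length.
  set T : Finset ((Fin d → ℤ) × ℤ) :=
    (Fintype.piFinset fun _ => Finset.Icc (-(a : ℤ)) a) ×ˢ Finset.Icc (-(b : ℤ)) b with hT
  have hTcard : T.card = (2 * a + 1) ^ d * (2 * b + 1) := by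
    have h : ∀ c : ℕ, ((c : ℤ) + 1 + (c : ℤ)).toNat = 2 * c + 1 := fun c => by omega
    rw [hT, Finset.card_product, Fintype.card_piFinset]
    simp [Int.card_Icc, h]
  rw [← hTcard]
  refine Finset.card_le_mul_card_image_of_maps_to (f := f) ?_ _ ?_
  · intro n hn
    obtain ⟨h1, h2⟩ := hS n hn
    refine Finset.mem_product.2 ⟨Fintype.mem_piFinset.2 fun j => ?_, ?_⟩
    · refine floor_div_mem_Icc hr ?_
      rw [hu2]
      exact h2 j
    · exact floor_div_mem_Icc hL h1
  · intro y _
    rcases (S.filter (fun n => f n = y)).eq_empty_or_nonempty with h | ⟨n₀, hn₀⟩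
    · rw [h]; simp
    -- Two points of one cell differ by an element of the Bohr set.
    · refine Finset.card_le_card_of_injOn (fun n => n - n₀) ?_ (sub_left_injective.injOn)
      intro n hn
      rw [Finset.mem_coe, Finset.mem_filter] at hn
      rw [Finset.mem_filter] at hn₀
      have heq : f n = f n₀ := hn.2.trans hn₀.2.symm
      rw [Finset.mem_coe, mem_bohrSet]
      refine ⟨?_, fun j => ?_⟩
      · push_cast
        exact (abs_sub_lt_of_floor_div_eq hL (congrArg Prod.snd heq)).le
      · rw [sub_smul, ← hu1, ← hu1, ← AddCircle.coe_sub]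
        exact (norm_coe_le_abs _).trans_lt
          (abs_sub_lt_of_floor_div_eq hr (congrFun (congrArg Prod.fst heq) j))

/-- Among the dilates of a Bohr set there is one whose size does not grow much under a further
small dilation. -/
theorem exists_stable_dilate (θ : Fin d → UnitAddCircle) {r L κ : ℝ} (hr : 0 < r) (hL : 0 < L)
    (hκ : 0 < κ) (n : ℕ) (hn : (5 : ℝ) ^ (d + 1) < (1 + κ) ^ n) :
    ∃ t : ℕ, 3 * n ≤ t ∧ t + 3 ≤ 6 * n ∧
      ((bohrSet θ ((t + 3 : ℕ) * r) ((t + 3 : ℕ) * L)).card : ℝ)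
        ≤ (1 + κ) * (bohrSet θ (t * r) (t * L)).card := by
  set R : ℕ → ℝ := fun t => ((bohrSet θ (t * r) (t * L)).card : ℝ) with hR
  have hn0 : 0 < n := by
    rcases Nat.eq_zero_or_pos n with h | h
    · exfalso
      rw [h, pow_zero] at hn
      exact absurd hn (not_lt.2 (one_le_pow₀ (by norm_num)))
    · exact h
  by_contra! hno
  -- If all n steps of length 3 from scale 3n to scale 6n multiplied the size by more than 1 + κ,
  -- the total growth would exceed the covering bound for doubling. The length 3 leaves room for the
  -- scales t, ..., t + 3.
  have hgrow : ∀ l, l ≤ n → (1 + κ) ^ l * R (3 * n) ≤ R (3 * n + 3 * l) := by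
    intro l
    induction l with
    | zero => intro _; simp
    | succ l ih =>
      intro hl
      have h1 := ih (by omega)
      have h2 := hno (3 * n + 3 * l) (by omega) (by omega)
      calc (1 + κ) ^ (l + 1) * R (3 * n) = (1 + κ) * ((1 + κ) ^ l * R (3 * n)) := by ring
        _ ≤ (1 + κ) * R (3 * n + 3 * l) := by gcongr
        _ ≤ R (3 * n + 3 * l + 3) := h2.le
        _ = R (3 * n + 3 * (l + 1)) := by congr 1
  have h3n : (0 : ℝ) < (3 * n : ℕ) := by exact_mod_cast (by omega : 0 < 3 * n)
  -- Covering with a = b = 2, and 5 = 2 · 2 + 1.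
  have hdouble : R (3 * n + 3 * n) ≤ R (3 * n) * (5 : ℝ) ^ (d + 1) := by
    have := card_le_mul_card_bohrSet θ (r := (3 * n : ℕ) * r) (L := (3 * n : ℕ) * L)
      (by positivity) (by positivity)
      (bohrSet θ ((3 * n + 3 * n : ℕ) * r) ((3 * n + 3 * n : ℕ) * L)) 2 2 (by
        intro m hm
        rw [mem_bohrSet] at hm
        refine ⟨hm.1.trans (le_of_eq ?_), fun j => (hm.2 j).le.trans (le_of_eq ?_)⟩ <;>
        · push_cast; ring)
    have h2 := (Nat.cast_le (α := ℝ)).2 this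
    rw [Nat.cast_mul] at h2
    refine h2.trans (le_of_eq ?_)
    congr 1
    push_cast
    ring
  have hpos : 0 < R (3 * n) := by
    simp only [hR]
    exact_mod_cast Finset.card_pos.2 ⟨0, zero_mem_bohrSet (by positivity) (by positivity)⟩
  have h1 := hgrow n le_rfl
  have h2 : R (3 * n) * (5 : ℝ) ^ (d + 1) < R (3 * n) * (1 + κ) ^ n := by gcongr
  linarith

/-- Bernoulli gives (1 + κ)^⌈1/κ⌉ ≥ 2, and 5 < 2³. -/
theorem five_pow_lt_one_add_pow (d : ℕ) {κ : ℝ} (hκ : 0 < κ) :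
    (5 : ℝ) ^ (d + 1) < (1 + κ) ^ (⌈1 / κ⌉₊ * (3 * (d + 1))) := by
  have h1 : (2 : ℝ) ≤ (1 + κ) ^ ⌈1 / κ⌉₊ := by
    have h := one_add_mul_le_pow (a := κ) (by linarith) ⌈1 / κ⌉₊
    have h2 : 1 ≤ (⌈1 / κ⌉₊ : ℝ) * κ := by
      have := Nat.le_ceil (1 / κ)
      rwa [div_le_iff₀ hκ] at this
    linarith
  calc (5 : ℝ) ^ (d + 1) < 8 ^ (d + 1) := by gcongr <;> norm_num
    _ = 2 ^ (3 * (d + 1)) := by rw [pow_mul]; norm_num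
    _ ≤ ((1 + κ) ^ ⌈1 / κ⌉₊) ^ (3 * (d + 1)) := by gcongr
    _ = _ := by rw [← pow_mul]

/-- A lower bound for the size of a Bohr set. -/
theorem le_card_bohrSet (θ : Fin d → UnitAddCircle) {r L : ℝ} (hr : 0 < r) (hr1 : r ≤ 1)
    (hL : 0 < L) : L ≤ (bohrSet θ r L).card * ((4 / r) ^ d * 3) := by
  -- Norms on the circle are at most 1/2 ≤ a r, so the frequency conditions are void at this
  -- dilation and translates of the Bohr set cover all of [0, L].
  set a : ℕ := ⌈1 / (2 * r)⌉₊ with ha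
  have ha1 : 1 / 2 ≤ a * r := by
    have := Nat.le_ceil (1 / (2 * r))
    rw [div_le_iff₀ (by positivity)] at this
    linarith
  have ha2 : 2 * (a : ℝ) + 1 ≤ 4 / r := by
    have := Nat.ceil_lt_add_one (a := 1 / (2 * r)) (by positivity)
    rw [le_div_iff₀ hr]
    have h : (a : ℝ) * r ≤ (1 / (2 * r) + 1) * r := by gcongr
    have h' : (1 / (2 * r) + 1) * r = 1 / 2 + r := by field_simp
    linarith
  have h := card_le_mul_card_bohrSet θ hr hL (Finset.Icc 0 ⌊L⌋) a 1 (by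
    intro n hn
    rw [Finset.mem_Icc] at hn
    refine ⟨?_, fun j => ?_⟩
    · have h0 : (0 : ℝ) ≤ n := by exact_mod_cast hn.1
      rw [abs_of_nonneg h0, Nat.cast_one, one_mul]
      exact Int.le_floor.1 hn.2
    · refine le_trans ?_ ha1
      have := AddCircle.norm_le_half_period (1 : ℝ) (x := n • θ j) one_ne_zero
      simpa using this)
  have h2 := (Nat.cast_le (α := ℝ)).2 h
  have h3 : L ≤ ((Finset.Icc 0 ⌊L⌋).card : ℝ) := by
    rw [Int.card_Icc]
    have h0 : 0 ≤ ⌊L⌋ := Int.floor_nonneg.2 hL.le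
    have : (((⌊L⌋ + 1 - 0).toNat : ℤ) : ℝ) = (⌊L⌋ : ℝ) + 1 := by
      rw [Int.toNat_of_nonneg (by omega)]; push_cast; ring
    rw [← Int.cast_natCast, this]
    exact (Int.lt_floor_add_one L).le
  refine h3.trans (h2.trans ?_)
  push_cast
  gcongr

end bohr

/-! ### Numerical choice of the parameters -/

section parameters
variable {δ P α s : ℝ}

/-- Here 41 · 48 = 1968 ≤ 2000. The main proof takes γ = s²⁴, so that α/γ ≤ γ. This balances the
Markov loss α/γ against the proportion γ of exceptional translates. -/
theorem uniformity_le_pow (hδ : 0 < δ) (hP : 0 < P) (hα : α = δ ^ 96 * P ^ 48 / 2 ^ 2000)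
    (hs : s = δ ^ 2 * P / 2 ^ 41) : α ≤ s ^ 48 := by
  have e : s ^ 48 = δ ^ 96 * P ^ 48 / 2 ^ 1968 := by
    rw [hs, div_pow, mul_pow, ← pow_mul, ← pow_mul]
  rw [hα, e]
  have : (2 : ℝ) ^ 1968 ≤ 2 ^ 2000 := pow_le_pow_right₀ (by norm_num) (by norm_num)
  gcongr

theorem pow_twelve_le (hδ : 0 < δ) (hP : 0 < P) (hs : s = δ ^ 2 * P / 2 ^ 41) :
    s ^ 12 ≤ δ ^ 24 * P ^ 12 / 2 ^ 100 := by
  have e : s ^ 12 = δ ^ 24 * P ^ 12 / 2 ^ 492 := by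
    rw [hs, div_pow, mul_pow, ← pow_mul, ← pow_mul]
  rw [e]
  have : (2 : ℝ) ^ 100 ≤ 2 ^ 492 := pow_le_pow_right₀ (by norm_num) (by norm_num)
  gcongr

/-- The first factor is the proportion of bad triples, at most 20 s²⁴. The second is the worst-case
score, at most 2⁶¹/(δ¹²P²). The former contains high enough powers of δ and P to absorb the latter.
-/
theorem bad_triples_negligible (hδ : 0 < δ) (hδ1 : δ ≤ 1) (hP : 0 < P) (hP1 : P ≤ 1) (hα : 0 < α)
    (hs : s = δ ^ 2 * P / 2 ^ 41) (hαs : α ≤ s ^ 48) :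
    (8 * α / s ^ 24 + 8 * α + 4 * α ^ 2) * (1 / P ^ 2 + 2 ^ 60 / δ ^ 12 / P) ≤ δ ^ 3 / 64 := by
  have hs0 : 0 < s := by rw [hs]; positivity
  have hδ2 : δ ^ 2 ≤ 1 := pow_le_one₀ hδ.le hδ1
  have hδP : δ ^ 2 * P ≤ 1 := mul_le_one₀ hδ2 hP.le hP1
  have hs1 : s ≤ 1 := by rw [hs]; linarith [mul_pos (pow_pos hδ 2) hP]
  have h24 : 0 < s ^ 24 := by positivity
  have h48 : s ^ 48 ≤ s ^ 24 := pow_le_pow_of_le_one hs0.le hs1 (by norm_num)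
  have hα1 : α ≤ 1 := hαs.trans (pow_le_one₀ hs0.le hs1)
  have h1 : 8 * α / s ^ 24 ≤ 8 * s ^ 24 := by
    rw [div_le_iff₀ h24]
    have : s ^ 24 * s ^ 24 = s ^ 48 := by ring
    linarith
  have h2 : 8 * α / s ^ 24 + 8 * α + 4 * α ^ 2 ≤ 20 * s ^ 24 := by nlinarith
  have h3 : 1 / P ^ 2 + 2 ^ 60 / δ ^ 12 / P ≤ 2 ^ 61 / (δ ^ 12 * P ^ 2) := by
    have hδ12 : δ ^ 12 ≤ 1 := pow_le_one₀ hδ.le hδ1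
    rw [div_div, div_add_div _ _ (by positivity) (by positivity),
      div_le_div_iff₀ (by positivity) (by positivity)]
    have hd : 0 < δ ^ 12 := by positivity
    have hq : 0 < δ ^ 12 * P ^ 2 := by positivity
    have e1 : δ ^ 12 * P + P ^ 2 * 2 ^ 60 ≤ P * 2 ^ 61 := by
      have a1 : δ ^ 12 * P ≤ 1 * P := by gcongr
      have a2 : P ^ 2 ≤ P := by nlinarith
      linarith
    calc (1 * (δ ^ 12 * P) + P ^ 2 * 2 ^ 60) * (δ ^ 12 * P ^ 2)
        ≤ (P * 2 ^ 61) * (δ ^ 12 * P ^ 2) := by rw [one_mul]; gcongr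
      _ = 2 ^ 61 * (P ^ 2 * (δ ^ 12 * P)) := by ring
  have h4 : s ^ 24 ≤ s ^ 12 := pow_le_pow_of_le_one hs0.le hs1 (by norm_num)
  have h5 : s ^ 12 ≤ δ ^ 15 * P ^ 2 / 2 ^ 100 := by
    refine (pow_twelve_le hδ hP hs).trans ?_
    have a1 : δ ^ 24 ≤ δ ^ 15 := pow_le_pow_of_le_one hδ.le hδ1 (by norm_num)
    have a2 : P ^ 12 ≤ P ^ 2 := pow_le_pow_of_le_one hP.le hP1 (by norm_num)
    gcongr
  calc _ ≤ 20 * s ^ 24 * (2 ^ 61 / (δ ^ 12 * P ^ 2)) := by gcongr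
    _ ≤ 20 * (δ ^ 15 * P ^ 2 / 2 ^ 100) * (2 ^ 61 / (δ ^ 12 * P ^ 2)) := by
      gcongr
      exact h4.trans h5
    _ = 20 * 2 ^ 61 / 2 ^ 100 * δ ^ 3 := by field_simp
    _ ≤ 1 / 64 * δ ^ 3 := by gcongr ?_ * _; norm_num
    _ = _ := by ring

/-- The quantity under the root is at most 96 s²⁴ ≤ (10 s¹²)². -/
theorem mixing_error_le (hδ : 0 < δ) (hδ1 : δ ≤ 1) (hP : 0 < P) (hP1 : P ≤ 1)
    (hs : s = δ ^ 2 * P / 2 ^ 41) (hαs : α ≤ s ^ 48) :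
    √(12 * (2 * (2 * s ^ 24) + 4 * α)) ≤ δ ^ 12 / 2 ^ 60 * P ^ 4 := by
  have hs0 : 0 < s := by rw [hs]; positivity
  have hδ2 : δ ^ 2 ≤ 1 := pow_le_one₀ hδ.le hδ1
  have hδP : δ ^ 2 * P ≤ 1 := mul_le_one₀ hδ2 hP.le hP1
  have hs1 : s ≤ 1 := by rw [hs]; linarith [mul_pos (pow_pos hδ 2) hP]
  have h48 : s ^ 48 ≤ s ^ 24 := pow_le_pow_of_le_one hs0.le hs1 (by norm_num)
  have h1 : √(12 * (2 * (2 * s ^ 24) + 4 * α)) ≤ 10 * s ^ 12 := by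
    rw [Real.sqrt_le_left (by positivity)]
    have : (10 * s ^ 12) ^ 2 = 100 * s ^ 24 := by ring
    rw [this]
    have : 0 < s ^ 24 := by positivity
    linarith
  refine (h1.trans (mul_le_mul_of_nonneg_left (pow_twelve_le hδ hP hs) (by norm_num))).trans ?_
  have a1 : δ ^ 24 ≤ δ ^ 12 := pow_le_pow_of_le_one hδ.le hδ1 (by norm_num)
  have a2 : P ^ 12 ≤ P ^ 4 := pow_le_pow_of_le_one hP.le hP1 (by norm_num)
  calc 10 * (δ ^ 24 * P ^ 12 / 2 ^ 100) ≤ 10 * (δ ^ 12 * P ^ 4 / 2 ^ 100) := by gcongr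
    _ = 10 / 2 ^ 100 * (δ ^ 12 * P ^ 4) := by ring
    _ ≤ 1 / 2 ^ 60 * (δ ^ 12 * P ^ 4) := by gcongr ?_ * _; norm_num
    _ = _ := by ring

/-- The attendant Bohr set is large when `N` is large. -/
theorem one_le_card_bohrSet_mul {d : ℕ} (hd : 1 ≤ d) (θ : Fin d → UnitAddCircle)
    {ε₀ N ε ε' ρ M : ℝ} (hε₀ : 0 < ε₀) (hε₀' : ε₀ ≤ 1) (hN : 0 < N)
    (hε : 0 < ε) (hεs : ε ≤ 1 / 2 ^ 13) (hε' : ε' = ε ^ 2 / 2 ^ 10) (hρ : ε' * ε₀ / 2 ≤ ρ)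
    (hρ1 : ρ ≤ 1) (hM : ε' * N / 2 ≤ M)
    (hlarge : 2 ^ 10 * d * Real.log (1 / (ε₀ * ε)) ≤ Real.log N) :
    1 ≤ (bohrSet θ ρ M).card * ε := by
  set q := ε₀ * ε with hq
  have hq0 : 0 < q := by positivity
  have hqε : q ≤ ε := by nlinarith
  have hq1 : q ≤ 1 := hqε.trans (hεs.trans (by norm_num))
  -- Exponentiated, the hypothesis on N beats any power of q = ε₀ε up to 1024d. Only 3 + 3d + 1 is
  -- needed: q³ for the length, q³ for each frequency, and a last q ≤ ε.
  have hNq : 1 ≤ N * q ^ (1024 * d) := by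
    have h : Real.log 1 ≤ Real.log (N * q ^ (1024 * d)) := by
      rw [Real.log_one, Real.log_mul hN.ne' (by positivity), Real.log_pow]
      rw [one_div, Real.log_inv] at hlarge
      push_cast
      linarith
    exact (Real.log_le_log_iff one_pos (by positivity)).1 h
  have hε'0 : 0 < ε' := by rw [hε']; positivity
  have hρ0 : 0 < ρ := lt_of_lt_of_le (by positivity) hρ
  have hM0 : 0 < M := lt_of_lt_of_le (by positivity) hM
  have hcube : ε ^ 3 ≤ ε ^ 2 / 2 ^ 13 := by
    calc ε ^ 3 = ε ^ 2 * ε := by ring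
      _ ≤ ε ^ 2 * (1 / 2 ^ 13) := by gcongr
      _ = _ := by ring
  have h1 : q ^ 3 ≤ ρ / 4 := by
    have hε₀3 : ε₀ ^ 3 ≤ ε₀ := by
      calc ε₀ ^ 3 ≤ ε₀ ^ 1 := pow_le_pow_of_le_one hε₀.le hε₀' (by norm_num)
        _ = ε₀ := pow_one _
    calc q ^ 3 = ε ^ 3 * ε₀ ^ 3 := by rw [hq]; ring
      _ ≤ ε ^ 2 / 2 ^ 13 * ε₀ := by gcongr
      _ = ε' * ε₀ / 2 / 4 := by rw [hε']; ring
      _ ≤ ρ / 4 := by gcongr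
  have h2 : q ^ 3 * N ≤ M / 3 := by
    calc q ^ 3 * N ≤ ε ^ 3 * N := by gcongr
      _ ≤ ε ^ 2 / 2 ^ 13 * N := by gcongr
      _ ≤ ε' * N / 2 / 3 := by rw [hε']; nlinarith [mul_pos (pow_pos hε 2) hN]
      _ ≤ M / 3 := by gcongr
  have hB := le_card_bohrSet θ hρ0 hρ1 hM0
  set L : ℝ := ((bohrSet θ ρ M).card : ℝ) with hL
  have h3 : M / 3 * (ρ / 4) ^ d ≤ L := by
    have e : (4 / ρ) ^ d * (ρ / 4) ^ d = 1 := by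
      rw [← mul_pow]; field_simp; simp
    calc M / 3 * (ρ / 4) ^ d ≤ L * ((4 / ρ) ^ d * 3) / 3 * (ρ / 4) ^ d := by gcongr
      _ = L * ((4 / ρ) ^ d * (ρ / 4) ^ d) := by ring
      _ = L := by rw [e, mul_one]
  calc 1 ≤ N * q ^ (1024 * d) := hNq
    _ ≤ N * q ^ (3 + 3 * d + 1) := by
      gcongr ?_ * ?_
      exact pow_le_pow_of_le_one hq0.le hq1 (by omega)
    _ = q ^ 3 * N * (q ^ 3) ^ d * q := by rw [← pow_mul]; ring
    _ ≤ M / 3 * (ρ / 4) ^ d * ε := by gcongr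
    _ ≤ L * ε := by gcongr

end parameters

/-! ### From the definitions to the hypotheses of the argument -/

theorem le_balancedFourierSup (Q W : Finset ℤ) (c : ℝ) (x : UnitAddCircle) :
    ‖∑ s ∈ W, ((ind Q s - c : ℝ) : ℂ) * fourier (-s) x‖ ≤ balancedFourierSup Q W c := by
  unfold balancedFourierSup ind
  refine le_ciSup (f := fun x : UnitAddCircle =>
    ‖∑ s ∈ W, (((if s ∈ Q then 1 else 0) - c : ℝ) : ℂ) * fourier (-s) x‖) ?_ x
  -- A real supremum defaults to 0 when unbounded, so boundedness by the ℓ¹ norm must be checked.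
  refine ⟨∑ s ∈ W, ‖(((if s ∈ Q then 1 else 0) - c : ℝ) : ℂ)‖, ?_⟩
  rintro _ ⟨y, rfl⟩
  refine (norm_sum_le _ _).trans (Finset.sum_le_sum fun s _ => ?_)
  rw [norm_mul, fourier_apply, Circle.norm_coe, mul_one]

theorem densityIn_of_subset {Λ Q : Finset ℤ} {β : ℝ} (h : Q ⊆ Λ) (hβ : (Q.card : ℝ) = β * Λ.card)
    (hΛ : 0 < Λ.card) : densityIn Λ Q = β := by
  unfold densityIn
  rw [Finset.inter_eq_left.2 h, hβ]
  have : (Λ.card : ℝ) ≠ 0 := by exact_mod_cast hΛ.ne'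
  field_simp

/-- The centers of the translates of `Λ'` on which a uniform set has small Fourier coefficients. -/
theorem IsUniformIn.exists_good_centers {α β : ℝ} {Λ Λ' Q : Finset ℤ} (h : IsUniformIn α Λ Λ' Q)
    (hβ : (Q.card : ℝ) = β * Λ.card) (hΛ : 0 < Λ.card) :
    ∃ G ⊆ Λ, (1 - α) * Λ.card ≤ (G.card : ℝ) ∧ ∀ m ∈ G, ∀ x : UnitAddCircle,
      ‖∑ s ∈ shiftBy Λ' m, ((ind Q s - β : ℝ) : ℂ) * fourier (-s) x‖ ≤ α * Λ'.card := by
  classical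
  have hden := densityIn_of_subset h.subset hβ hΛ
  have h1 := h.local_fourier
  rw [hden] at h1
  refine ⟨Λ.filter (fun m => ¬ α * Λ'.card ≤ balancedFourierSup Q (shiftBy Λ' m) β),
    Finset.filter_subset _ _, ?_, ?_⟩
  · have h2 := Finset.card_filter_add_card_filter_not (s := Λ)
      (fun m => α * Λ'.card ≤ balancedFourierSup Q (shiftBy Λ' m) β)
    have h3 := congrArg (Nat.cast (R := ℝ)) h2
    push_cast at h3
    have h4 : ((Λ.filter (fun m => α * Λ'.card ≤ balancedFourierSup Q (shiftBy Λ' m) β)).card : ℝ)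
        ≤ α * Λ.card := by convert h1
    linarith
  · intro m hm x
    exact (le_balancedFourierSup Q _ β x).trans (not_le.1 (Finset.mem_filter.1 hm).2).le

theorem densityIn_product_ge {A : Finset (ℤ × ℤ)} {F₁ F₂ : Finset ℤ} {δ ω : ℝ}
    (h1 : 0 < F₁.card) (h2 : 0 < F₂.card)
    (h : ω * (F₁.card * F₂.card) ≤ ∑ x ∈ F₁, ∑ y ∈ F₂, (ind A (x, y) - δ)) :
    δ + ω ≤ densityIn (F₁ ×ˢ F₂) A := by
  have h1' : (0 : ℝ) < F₁.card := by exact_mod_cast h1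
  have h2' : (0 : ℝ) < F₂.card := by exact_mod_cast h2
  have e : ∑ x ∈ F₁, ∑ y ∈ F₂, (ind A (x, y) - δ)
      = ((A ∩ F₁ ×ˢ F₂).card : ℝ) - δ * (F₁.card * F₂.card) := by
    rw [← Finset.sum_product' (f := fun x y => ind A (x, y) - δ), Finset.sum_sub_distrib, sum_ind,
      Finset.filter_mem_eq_inter, Finset.inter_comm]
    simp [mul_comm]
  unfold densityIn
  rw [Finset.card_product, le_div_iff₀ (by push_cast; positivity)]
  push_cast
  linarith

/-- Dilates of a Bohr set at a well-chosen scale form nested scales. -/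
theorem nestedScales_bohrSet {d : ℕ} (θ : Fin d → UnitAddCircle) {ρ M κ : ℝ} (hρ : 0 < ρ)
    (hM : 0 < M) (hκ1 : κ ≤ 1) (t : ℕ)
    (ht : ((bohrSet θ ((t + 3 : ℕ) * ρ) ((t + 3 : ℕ) * M)).card : ℝ)
        ≤ (1 + κ) * (bohrSet θ (t * ρ) (t * M)).card) (hκ : 0 ≤ κ) :
    NestedScales (bohrSet θ ρ M) (bohrSet θ (t * ρ) (t * M))
      (bohrSet θ ((t + 1 : ℕ) * ρ) ((t + 1 : ℕ) * M)) (bohrSet θ ((t + 2 : ℕ) * ρ) ((t + 2 : ℕ) * M))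
      (bohrSet θ ((t + 3 : ℕ) * ρ) ((t + 3 : ℕ) * M)) κ := by
  have hsub : ∀ a b : ℕ, a ≤ b → bohrSet θ (a * ρ) (a * M) ⊆ bohrSet θ (b * ρ) (b * M) :=
    fun a b hab => bohrSet_mono θ (by gcongr) (by gcongr)
  have hcard : ∀ a b : ℕ, a ≤ b → ((bohrSet θ (a * ρ) (a * M)).card : ℝ)
      ≤ (bohrSet θ (b * ρ) (b * M)).card := fun a b hab => by
    exact_mod_cast Finset.card_le_card (hsub a b hab)
  have hadd : ∀ a : ℕ, ∀ c ∈ bohrSet θ (a * ρ) (a * M), ∀ b ∈ bohrSet θ ρ M,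
      c + b ∈ bohrSet θ ((a + 1 : ℕ) * ρ) ((a + 1 : ℕ) * M) := fun a c hc b hb =>
    add_mem_bohrSet hc hb (le_of_eq (by push_cast; ring)) (le_of_eq (by push_cast; ring))
  have h01 := hcard t (t + 1) (by omega)
  have h02 := hcard t (t + 2) (by omega)
  have h23 := hcard (t + 2) (t + 3) (by omega)
  have h0 : (0 : ℝ) ≤ (bohrSet θ (t * ρ) (t * M)).card := Nat.cast_nonneg _
  have hκ0 : κ * ((bohrSet θ (t * ρ) (t * M)).card : ℝ) ≤ (bohrSet θ (t * ρ) (t * M)).card :=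
    mul_le_of_le_one_left h0 hκ1
  refine ⟨fun b hb => neg_mem_bohrSet hb, Finset.card_pos.2 ⟨0, zero_mem_bohrSet hρ hM.le⟩,
    hadd t, hadd (t + 1), hadd (t + 2), hsub _ _ (by omega), ?_, by linarith, by linarith⟩
  rw [Finset.cast_card_sdiff (hsub t (t + 2) (by omega))]
  have : κ * ((bohrSet θ (t * ρ) (t * M)).card : ℝ)
      ≤ κ * (bohrSet θ ((t + 2 : ℕ) * ρ) ((t + 2 : ℕ) * M)).card := by gcongr
  linarith

/-- A regular Bohr set grows little when it is slightly enlarged. -/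
theorem IsRegularBohr.card_enlarge_le {d : ℕ} {θ : Fin d → UnitAddCircle} {ε N κ s S : ℝ}
    (h : IsRegularBohr θ ε N) (hε : 0 < ε) (hN : 0 < N) (hκ : 0 < κ) (hκ1 : κ < 1) (hs : 0 ≤ s)
    (hS : 0 ≤ S) (hs' : s < κ / (100 * d) * ε) (hS' : S < κ / (100 * d) * N) :
    ((bohrSet θ (ε + s) (N + S)).card : ℝ) ≤ (1 + κ) * (bohrSet θ ε N).card := by
  have h1 := (h κ hκ hκ1 (ε + s) (N + S) (by
    rw [sub_add_cancel_left, abs_neg, abs_of_nonneg hs]; exact hs') (by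
    rw [sub_add_cancel_left, abs_neg, abs_of_nonneg hS]; exact hS')).2
  have h0 : (0 : ℝ) < (bohrSet θ ε N).card := by
    exact_mod_cast Finset.card_pos.2 ⟨0, zero_mem_bohrSet hε hN.le⟩
  exact ((div_lt_iff₀ h0).1 h1).le

/-- P \ G splits into the enlargement P \ Λ and the bad centers Λ \ G, of proportions κ ≤ α and α.
-/
theorem card_sdiff_le_of_enlarge {P G Λ : Finset ℤ} {α κ : ℝ} (hG : G ⊆ Λ) (hΛ : Λ ⊆ P)
    (hGc : (1 - α) * Λ.card ≤ (G.card : ℝ)) (hP : (P.card : ℝ) ≤ (1 + κ) * Λ.card) (hκα : κ ≤ α) :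
    ((P \ G).card : ℝ) ≤ 2 * α * Λ.card := by
  rw [Finset.cast_card_sdiff (hG.trans hΛ)]
  have : κ * (Λ.card : ℝ) ≤ α * Λ.card := by gcongr
  linarith

/-- The number of scales needed is small compared with the ratio of the two extreme scales. -/
theorem scales_mul_lt {d : ℕ} (hd : 1 ≤ d) {α ε ε' : ℝ} (hα : 0 < α) (hα1 : α ≤ 1)
    (hε : ε = α ^ 2 / 2 ^ 100 / (100 * d)) (hε' : ε' = ε ^ 2 / 2 ^ 10) :
    18 * ((⌈1 / α ^ 2⌉₊ * (3 * (d + 1)) : ℕ) : ℝ) * ε' < α ^ 2 / (100 * d) := by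
  have hd' : (1 : ℝ) ≤ d := by exact_mod_cast hd
  have hκ : 0 < α ^ 2 := by positivity
  have hκ1 : α ^ 2 ≤ 1 := pow_le_one₀ hα.le hα1
  have hε0 : 0 < ε := by rw [hε]; positivity
  have hκε : α ^ 2 / (100 * d) = 2 ^ 100 * ε := by rw [hε]; ring
  have hdκ : d / α ^ 2 * ε = 1 / (2 ^ 100 * 100) := by rw [hε]; field_simp
  have hceil : (⌈1 / α ^ 2⌉₊ : ℝ) ≤ 2 / α ^ 2 := by
    have h1 := (Nat.ceil_lt_add_one (a := 1 / α ^ 2) (by positivity)).le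
    have h2 : 1 ≤ 1 / α ^ 2 := by rw [le_div_iff₀ hκ]; linarith
    have h3 : 2 / α ^ 2 = 1 / α ^ 2 + 1 / α ^ 2 := by ring
    linarith
  have hn : ((⌈1 / α ^ 2⌉₊ * (3 * (d + 1)) : ℕ) : ℝ) ≤ 12 * (d / α ^ 2) := by
    push_cast
    calc (⌈1 / α ^ 2⌉₊ : ℝ) * (3 * (d + 1)) ≤ 2 / α ^ 2 * (3 * (d + d)) := by gcongr
      _ = _ := by ring
  rw [hκε]
  calc _ ≤ 18 * (12 * (d / α ^ 2)) * (ε ^ 2 / 2 ^ 10) := by rw [hε']; gcongr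
    _ = 18 * 12 / 2 ^ 10 * (d / α ^ 2 * ε) * ε := by ring
    _ = 18 * 12 / 2 ^ 10 * (1 / (2 ^ 100 * 100)) * ε := by rw [hdκ]
    _ < 2 ^ 100 * ε := by gcongr ?_ * _; norm_num

/-! ### The density increment -/

set_option maxHeartbeats 1000000 in
theorem theorem4p3
    (d : ℕ) (hd : 1 ≤ d) (θ : Fin d → UnitAddCircle)
    -- the regular Bohr sets `Λ₁ = Λ_{θ,ε₀,N}` and `Λ₂ = Λ_{θ,ε₂,N₂}`, with `Λ₁ ≤ Λ₂`
    (ε₀ N ε₂ N₂ : ℝ) (hε₀ : 0 < ε₀) (hε₀' : ε₀ ≤ 1) (hN : 0 < N)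
    (hε₂ : ε₀ ≤ ε₂) (hN₂ : N ≤ N₂)
    (hreg₁ : IsRegularBohr θ ε₀ N) (hreg₂ : IsRegularBohr θ ε₂ N₂)
    (E₁ E₂ : Finset ℤ) (hE₁ : E₁ ⊆ bohrSet θ ε₀ N) (hE₂ : E₂ ⊆ bohrSet θ ε₂ N₂)
    (β₁ β₂ : ℝ)
    (hβ₁ : (E₁.card : ℝ) = β₁ * (bohrSet θ ε₀ N).card)
    (hβ₂ : (E₂.card : ℝ) = β₂ * (bohrSet θ ε₂ N₂).card)
    (A : Finset (ℤ × ℤ)) (hA : A ⊆ E₁ ×ˢ E₂)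
    (δ : ℝ) (hδ : (A.card : ℝ) = δ * E₁.card * E₂.card)
    (hcorner : CornerFree A)
    (α₀ ε ε' : ℝ)
    (hα₀ : α₀ = δ ^ 96 * β₁ ^ 48 * β₂ ^ 48 / 2 ^ 2000)
    (hε : ε = α₀ ^ 2 / 2 ^ 100 / (100 * d))
    (hε' : ε' = ε ^ 2 / 2 ^ 10)
    -- `E₁` and `E₂` are `(α₀, ε')`-uniform, with respect to an `ε'` attendant of `Λ₁`
    (ρ M : ℝ) (hatt : IsAttendant ε' θ ε₀ N ρ M)
    (hunif₁ : IsUniformIn α₀ (bohrSet θ ε₀ N) (bohrSet θ ρ M) E₁)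
    (hunif₂ : IsUniformIn α₀ (bohrSet θ ε₂ N₂) (bohrSet θ ρ M) E₂)
    (hlarge : 2 ^ 10 * d * Real.log (1 / (ε₀ * ε)) ≤ Real.log N) :
    ∃ (ε_t N_t : ℝ) (y₁ y₂ : ℤ) (F₁ F₂ : Finset ℤ),
      IsRegularBohr θ ε_t N_t ∧
      ε' * ε₀ / 2 ^ 5 ≤ ε_t ∧ ε' * N / 2 ^ 5 ≤ N_t ∧
      F₁ ⊆ E₁ ∩ shiftBy (bohrSet θ ε_t N_t) y₁ ∧
      F₂ ⊆ E₂ ∩ shiftBy (bohrSet θ ε_t N_t) y₂ ∧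
      δ ^ 12 * β₁ * (bohrSet θ ε_t N_t).card / 2 ^ 125 ≤ (F₁.card : ℝ) ∧
      δ ^ 12 * β₂ * (bohrSet θ ε_t N_t).card / 2 ^ 125 ≤ (F₂.card : ℝ) ∧
      δ + δ ^ 37 / 2 ^ 500 ≤ densityIn (F₁ ×ˢ F₂) A := by
  obtain ⟨⟨hε'0, hε'1⟩, hreg', ⟨hρl, hρu⟩, hMl, hMu⟩ := hatt
  have hε₂0 : 0 < ε₂ := hε₀.trans_le hε₂
  have hN₂0 : 0 < N₂ := hN.trans_le hN₂
  have hd' : (1 : ℝ) ≤ d := by exact_mod_cast hd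
  -- positivity of the parameters
  have hΛ₁ : 0 < (bohrSet θ ε₀ N).card := Finset.card_pos.2 ⟨0, zero_mem_bohrSet hε₀ hN.le⟩
  have hΛ₂ : 0 < (bohrSet θ ε₂ N₂).card := Finset.card_pos.2 ⟨0, zero_mem_bohrSet hε₂0 hN₂0.le⟩
  have hΛ₁' : (0 : ℝ) < (bohrSet θ ε₀ N).card := by exact_mod_cast hΛ₁
  have hΛ₂' : (0 : ℝ) < (bohrSet θ ε₂ N₂).card := by exact_mod_cast hΛ₂
  -- An attendant has ε' > 0 by definition. This propagates backwards to ε, α₀, δ, β₁ and β₂.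
  have hε_ne : ε ≠ 0 := by rintro rfl; norm_num at hε'; linarith
  have hα_ne : α₀ ≠ 0 := by rintro rfl; norm_num at hε; exact hε_ne hε
  have hδ_ne : δ ≠ 0 := by rintro rfl; norm_num at hα₀; exact hα_ne hα₀
  have hβ₁_ne : β₁ ≠ 0 := by rintro rfl; norm_num at hα₀; exact hα_ne hα₀
  have hβ₂_ne : β₂ ≠ 0 := by rintro rfl; norm_num at hα₀; exact hα_ne hα₀
  have hβ₁0 : 0 < β₁ := by
    refine lt_of_le_of_ne ?_ hβ₁_ne.symm
    by_contra! h
    have := mul_neg_of_neg_of_pos h hΛ₁'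
    have : (0 : ℝ) ≤ E₁.card := Nat.cast_nonneg _
    linarith
  have hβ₂0 : 0 < β₂ := by
    refine lt_of_le_of_ne ?_ hβ₂_ne.symm
    by_contra! h
    have := mul_neg_of_neg_of_pos h hΛ₂'
    have : (0 : ℝ) ≤ E₂.card := Nat.cast_nonneg _
    linarith
  have hβ₁1 : β₁ ≤ 1 := by
    have : (E₁.card : ℝ) ≤ (bohrSet θ ε₀ N).card := by exact_mod_cast Finset.card_le_card hE₁
    rw [hβ₁] at this
    exact le_of_mul_le_mul_right (by linarith) hΛ₁'
  have hβ₂1 : β₂ ≤ 1 := by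
    have : (E₂.card : ℝ) ≤ (bohrSet θ ε₂ N₂).card := by exact_mod_cast Finset.card_le_card hE₂
    rw [hβ₂] at this
    exact le_of_mul_le_mul_right (by linarith) hΛ₂'
  have hE0 : (0 : ℝ) < E₁.card * E₂.card := by rw [hβ₁, hβ₂]; positivity
  have hδA : (A.card : ℝ) = δ * (E₁.card * E₂.card) := by rw [hδ]; ring
  have hδ0 : 0 < δ := by
    refine lt_of_le_of_ne ?_ hδ_ne.symm
    by_contra! h
    have := mul_neg_of_neg_of_pos h hE0
    have : (0 : ℝ) ≤ A.card := Nat.cast_nonneg _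
    linarith
  have hδ1 : δ ≤ 1 := by
    have : (A.card : ℝ) ≤ E₁.card * E₂.card := by
      have := Finset.card_le_card hA
      rw [Finset.card_product] at this
      exact_mod_cast this
    rw [hδA] at this
    exact le_of_mul_le_mul_right (by linarith) hE0
  obtain ⟨P, hP⟩ : ∃ P, P = β₁ * β₂ := ⟨_, rfl⟩
  have hP0 : 0 < P := by rw [hP]; positivity
  have hP1 : P ≤ 1 := by rw [hP]; exact mul_le_one₀ hβ₁1 hβ₂0.le hβ₂1
  have hPβ₁ : P ≤ β₁ := by rw [hP]; exact mul_le_of_le_one_right hβ₁0.le hβ₂1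
  have hPβ₂ : P ≤ β₂ := by rw [hP]; exact mul_le_of_le_one_left hβ₂0.le hβ₁1
  have hαP : α₀ = δ ^ 96 * P ^ 48 / 2 ^ 2000 := by rw [hα₀, hP]; ring
  obtain ⟨s, hs⟩ : ∃ s, s = δ ^ 2 * P / 2 ^ 41 := ⟨_, rfl⟩
  have hs0 : 0 < s := by rw [hs]; positivity
  have hδ2 : δ ^ 2 ≤ 1 := pow_le_one₀ hδ0.le hδ1
  have hδ2P : δ ^ 2 * P ≤ P := mul_le_of_le_one_left hP0.le hδ2
  have hsP : s ≤ δ ^ 2 * P / 2 := by rw [hs]; gcongr; norm_num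
  have hs1 : s ≤ 1 := by linarith
  have hα0 : 0 < α₀ := by rw [hαP]; exact div_pos (by positivity) (pow_pos two_pos _)
  have hαs := uniformity_le_pow hδ0 hP0 hαP hs
  have hαs1 : α₀ ≤ s := hαs.trans (pow_le_of_le_one hs0.le hs1 (by norm_num))
  have hα1 : α₀ ≤ 1 / 2 := by linarith
  -- α₀² serves as κ both for the regularity of Λ₁ and Λ₂ and for the stable dilate.
  have hκ0 : 0 < α₀ ^ 2 := by positivity
  have hκα : α₀ ^ 2 ≤ α₀ := pow_le_of_le_one hα0.le (by linarith) (by norm_num)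
  have hε0 : 0 < ε := by rw [hε]; positivity
  have hε_le : ε ≤ α₀ / 2 ^ 100 := by
    rw [hε]
    have : α₀ ^ 2 / 2 ^ 100 ≤ α₀ / 2 ^ 100 := by gcongr
    exact (div_le_self (by positivity) (by linarith)).trans this
  have hρ0 : 0 < ρ := lt_of_lt_of_le (by positivity) hρl
  have hM0 : 0 < M := lt_of_lt_of_le (by positivity) hMl
  have hρ1 : ρ ≤ 1 := hρu.trans (mul_le_one₀ hε'1 hε₀.le hε₀')
  -- the intermediate scales
  set n : ℕ := ⌈1 / α₀ ^ 2⌉₊ * (3 * (d + 1)) with hn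
  obtain ⟨t, ht1, ht2, ht3⟩ := exists_stable_dilate θ hρ0 hM0 hκ0 n (five_pow_lt_one_add_pow d hκ0)
  have hC := nestedScales_bohrSet θ hρ0 hM0 (by linarith) t ht3 hκ0.le
  have hnε := scales_mul_lt hd hα0 (by linarith) hε hε'
  rw [← hn] at hnε
  -- Every scale up to t + 3 is at most 6n. At most three such dilations are ever stacked, which
  -- accounts for the factor 18n in the comparison with the regularity range.
  set m : ℝ := 6 * (n : ℝ) with hm
  have hmt : ∀ k : ℕ, k ≤ t + 3 → (k : ℝ) ≤ m := by
    intro k hk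
    have : k ≤ 6 * n := by omega
    rw [hm]
    exact_mod_cast this
  have hm0 : 0 ≤ m := by rw [hm]; positivity
  have hlow : ∀ k : ℕ, k ≤ t + 3 →
      bohrSet θ (k * ρ) (k * M) ⊆ bohrSet θ (m * ρ) (m * M) := fun k hk =>
    bohrSet_mono θ (mul_le_mul_of_nonneg_right (hmt k hk) hρ0.le)
      (mul_le_mul_of_nonneg_right (hmt k hk) hM0.le)
  have hBlow : bohrSet θ ρ M ⊆ bohrSet θ (m * ρ) (m * M) := by
    simpa using hlow 1 (by omega)
  have hρs : 3 * m * ρ < α₀ ^ 2 / (100 * d) * ε₀ := by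
    calc 3 * m * ρ ≤ 3 * m * (ε' * ε₀) := by gcongr
      _ = 18 * n * ε' * ε₀ := by rw [hm]; ring
      _ < _ := by gcongr
  have hMs : 3 * m * M < α₀ ^ 2 / (100 * d) * N := by
    calc 3 * m * M ≤ 3 * m * (ε' * N) := by gcongr
      _ = 18 * n * ε' * N := by rw [hm]; ring
      _ < _ := by gcongr
  have henl₁ : ∀ k : ℝ, 0 ≤ k → k ≤ 3 →
      ((bohrSet θ (ε₀ + k * (m * ρ)) (N + k * (m * M))).card : ℝ)
        ≤ (1 + α₀ ^ 2) * (bohrSet θ ε₀ N).card := by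
    intro k hk0 hk
    have h1 : k * (m * ρ) ≤ 3 * (m * ρ) := by gcongr
    have h2 : k * (m * M) ≤ 3 * (m * M) := by gcongr
    exact hreg₁.card_enlarge_le hε₀ hN hκ0 (by linarith) (by positivity) (by positivity)
      (by linarith) (by linarith)
  have henl₂ : ∀ k : ℝ, 0 ≤ k → k ≤ 3 →
      ((bohrSet θ (ε₂ + k * (m * ρ)) (N₂ + k * (m * M))).card : ℝ)
        ≤ (1 + α₀ ^ 2) * (bohrSet θ ε₂ N₂).card := by
    intro k hk0 hk
    have h1 : k * (m * ρ) ≤ 3 * (m * ρ) := by gcongr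
    have h2 : k * (m * M) ≤ 3 * (m * M) := by gcongr
    have h3 : α₀ ^ 2 / (100 * d) * ε₀ ≤ α₀ ^ 2 / (100 * d) * ε₂ := by gcongr
    have h4 : α₀ ^ 2 / (100 * d) * N ≤ α₀ ^ 2 / (100 * d) * N₂ := by gcongr
    exact hreg₂.card_enlarge_le hε₂0 hN₂0 hκ0 (by linarith) (by positivity) (by positivity)
      (by linarith) (by linarith)
  have hmρ : 0 ≤ m * ρ := by positivity
  have hmM : 0 ≤ m * M := by positivity
  have hκΛ₁ : (1 + α₀ ^ 2) * ((bohrSet θ ε₀ N).card : ℝ) ≤ 2 * (bohrSet θ ε₀ N).card := by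
    gcongr; linarith
  have hκΛ₂ : (1 + α₀ ^ 2) * ((bohrSet θ ε₂ N₂).card : ℝ) ≤ 2 * (bohrSet θ ε₂ N₂).card := by
    gcongr; linarith
  obtain ⟨G₁, hG₁, hG₁c, hF₁⟩ := hunif₁.exists_good_centers hβ₁ hΛ₁
  obtain ⟨G₂, hG₂, hG₂c, hF₂⟩ := hunif₂.exists_good_centers hβ₂ hΛ₂
  have hsize : 16 ≤ δ ^ 2 * (β₁ * β₂) *
      (bohrSet θ ((t + 2 : ℕ) * ρ) ((t + 2 : ℕ) * M)).card := by
    have h1 := one_le_card_bohrSet_mul hd θ hε₀ hε₀' hN hε0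
      (hε_le.trans (by linarith)) hε' hρl hρ1 hMl hlarge
    have h2 : ((bohrSet θ ρ M).card : ℝ)
        ≤ (bohrSet θ ((t + 2 : ℕ) * ρ) ((t + 2 : ℕ) * M)).card := by
      have : bohrSet θ ρ M ⊆ bohrSet θ ((t + 2 : ℕ) * ρ) ((t + 2 : ℕ) * M) := by
        have h : (1 : ℝ) ≤ (t + 2 : ℕ) := by exact_mod_cast (by omega : 1 ≤ t + 2)
        exact bohrSet_mono θ (le_mul_of_one_le_left hρ0.le h) (le_mul_of_one_le_left hM0.le h)
      exact_mod_cast Finset.card_le_card this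
    have h3 : ε ≤ δ ^ 2 * P / 16 := by linarith
    rw [← hP]
    calc (16 : ℝ) = 16 * 1 := by ring
      _ ≤ 16 * ((bohrSet θ ρ M).card * (δ ^ 2 * P / 16)) := by
        gcongr
        exact h1.trans (by gcongr)
      _ = δ ^ 2 * P * (bohrSet θ ρ M).card := by ring
      _ ≤ _ := by gcongr
  have hκγ : α₀ ^ 2 ≤ s ^ 24 :=
    hκα.trans (hαs.trans (pow_le_pow_of_le_one hs0.le hs1 (by norm_num)))
  have hsub₁ : ∀ k : ℝ, 0 ≤ k → bohrSet θ ε₀ N ⊆ bohrSet θ (ε₀ + k * (m * ρ)) (N + k * (m * M)) :=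
    fun k hk => bohrSet_mono θ (le_add_of_nonneg_right (by positivity))
      (le_add_of_nonneg_right (by positivity))
  have hsub₂ : ∀ k : ℝ, 0 ≤ k →
      bohrSet θ ε₂ N₂ ⊆ bohrSet θ (ε₂ + k * (m * ρ)) (N₂ + k * (m * M)) :=
    fun k hk => bohrSet_mono θ (le_add_of_nonneg_right (by positivity))
      (le_add_of_nonneg_right (by positivity))
  -- P and Q absorb one translation by a scale. P' absorbs one more (by e), and Q' absorbs two more
  -- (by e - c), hence the multiples 1, 2, 1, 3.
  obtain ⟨⟨i, c, j⟩, hω, hc, hval⟩ := exists_goodTriple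
    (P := bohrSet θ (ε₀ + 1 * (m * ρ)) (N + 1 * (m * M)))
    (P' := bohrSet θ (ε₀ + 2 * (m * ρ)) (N + 2 * (m * M)))
    (Q := bohrSet θ (ε₂ + 1 * (m * ρ)) (N₂ + 1 * (m * M)))
    (Q' := bohrSet θ (ε₂ + 3 * (m * ρ)) (N₂ + 3 * (m * M))) (G₁ := G₁) (G₂ := G₂)
    (α := α₀) (γ := s ^ 24) (K := 2 ^ 60 / δ ^ 12) hC hδ0 hδ1 hβ₁0 hβ₂0 hα0.le (by positivity)
    hκ0.le hΛ₁' hΛ₂' (by positivity) hA hcorner hδ hβ₁ hβ₂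
    ((henl₁ 1 (by norm_num) (by norm_num)).trans hκΛ₁)
    ((henl₂ 1 (by norm_num) (by norm_num)).trans hκΛ₂)
    (hΛ₁.trans_le (Finset.card_le_card (hsub₁ 1 (by norm_num))))
    (hΛ₂.trans_le (Finset.card_le_card (hsub₂ 1 (by norm_num))))
    (fun x hx c hc => sub_mem_bohrSet (hE₁ hx) (hlow _ (by omega) hc) (by linarith) (by linarith))
    (fun y hy b hb => sub_mem_bohrSet (hE₂ hy) (hBlow hb) (by linarith) (by linarith))
    (fun y hy c hc => add_mem_bohrSet (hlow _ (by omega) hc) (hE₂ hy) (by linarith) (by linarith))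
    (fun i hi e he => add_mem_bohrSet hi (hlow _ (by omega) he) (by linarith) (by linarith))
    (fun j hj => bohrSet_mono θ (by linarith) (by linarith) hj)
    (fun j hj e he c hc => add_mem_bohrSet hj (sub_mem_bohrSet (hlow _ (by omega) he)
      (hlow _ (by omega) hc) le_rfl le_rfl) (by linarith) (by linarith))
    (card_sdiff_le_of_enlarge hG₁ (hsub₁ 2 (by norm_num)) hG₁c
      (henl₁ 2 (by norm_num) (by norm_num)) hκα)
    (card_sdiff_le_of_enlarge hG₂ (hsub₂ 3 (by norm_num)) hG₂c
      (henl₂ 3 (by norm_num) (by norm_num)) hκα)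
    hsize (by rw [← hP]; exact bad_triples_negligible hδ0 hδ1 hP0 hP1 hα0 hs hαs)
  obtain ⟨y₁, y₂, F₁, F₂, hF₁E, hF₂E, hc₁, hc₂, hinc⟩ := exists_increment_of_goodTriple hC hδ0 hδ1
    hβ₁0 hβ₂0 hβ₁1 hβ₂1 hα0.le (by positivity) hκγ (by linarith) (by linarith) hA hF₁ hF₂
    (by rw [← hP]; exact mixing_error_le hδ0 hδ1 hP0 hP1 hs hαs) hω hc hval
  have hL0 : (0 : ℝ) < (bohrSet θ ρ M).card := by exact_mod_cast hC.card_pos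
  have hF₁0 : 0 < F₁.card := by
    have : (0 : ℝ) < F₁.card := lt_of_lt_of_le (by positivity) hc₁
    exact_mod_cast this
  have hF₂0 : 0 < F₂.card := by
    have : (0 : ℝ) < F₂.card := lt_of_lt_of_le (by positivity) hc₂
    exact_mod_cast this
  have h0₁ : 0 ≤ ε' * ε₀ := by positivity
  have h0₂ : 0 ≤ ε' * N := by positivity
  -- The attendant itself is the new Bohr set. The bounds obtained are stronger than the stated
  -- ones.
  refine ⟨ρ, M, y₁, y₂, F₁, F₂, hreg', by linarith, by linarith, hF₁E, hF₂E, ?_, ?_, ?_⟩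
  · refine le_trans ?_ hc₁
    have : 0 ≤ δ ^ 12 * β₁ * (bohrSet θ ρ M).card := by positivity
    linarith
  · refine le_trans ?_ hc₂
    have : 0 ≤ δ ^ 12 * β₂ * (bohrSet θ ρ M).card := by positivity
    linarith
  · refine le_trans ?_ (densityIn_product_ge hF₁0 hF₂0 hinc)
    have h15 : δ ^ 37 ≤ δ ^ 15 := pow_le_pow_of_le_one hδ0.le hδ1 (by norm_num)
    have h2 : (2 : ℝ) ^ 80 ≤ 2 ^ 500 := pow_le_pow_right₀ (by norm_num) (by norm_num)
    gcongr
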